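/- Let $k$ be a commutative ring of characteristic $0$ and let $(A,\mu,\alpha)$ be a regular unital (multiplicative) hom-associative algebra over $k$: a $k$-module $A$ with a bilinear product $a\cdot b$, an invertible linear map $\alpha$ with $\alpha(a\cdot b)=\alpha(a)\cdot\alpha(b)$ and $(a\cdot b)\cdot\alpha(c)=\alpha(a)\cdot(b\cdot c)$, and an element $1\in A$ with $\alpha(1)=1$ and $a\cdot 1=1\cdot a=\alpha(a)$. **Cochains.** For $n\ge 0$ let $C^n_\alpha(A)=\{f:A^{\otimes n}\to A \mid \alpha\circ f=f\circ\alpha^{\otimes n}\}$ (so $C^0_\alpha(A)=\{a\in A\mid\alpha(a)=a\}$), with partial compositions, for $f\in C^p_\alpha(A)$, $g\in C^q_\alpha(A)$, $1\le i\le p$, $$(f\circ_i g)(a_1,\dots,a_{p+q-1})=f(\alpha^{q-1}a_1,\dots,\alpha^{q-1}a_{i-1},g(a_i,\dots,a_{i+q-1}),\alpha^{q-1}a_{i+q},\dots,\alpha^{q-1}a_{p+q-1}),$$ and coboundary $$(\delta f)(a_1,\dots,a_{n+1})=\alpha^{n-1}(a_1)\cdot f(a_2,\dots,a_{n+1})+\sum_{i=1}^n(-1)^i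 f(\alpha a_1,\dots,a_i\cdot a_{i+1},\dots,\alpha a_{n+1})+(-1)^{n+1}f(a_1,\dots,a_n)\cdot\alpha^{n-1}(a_{n+1}).$$ Let $H^n_\alpha(A)$, $n\ge 0$, be its cohomology, with $H^n_\alpha(A)=0$ for $n<0$. Put $f\cup g=(\mu\circ_2 f)\circ_1 g$ and $$[f,g]=\sum_{i=1}^p(-1)^{(q-1)(i-1)}f\circ_i g-(-1)^{(p-1)(q-1)}\sum_{i=1}^q(-1)^{(p-1)(i-1)}g\circ_i f .$$ **Chains.** For $n\ge0$ let $C_n^\alpha(A)=A\otimes A^{\otimes n}$ with boundary $$d(a_0\otimes a_1\cdots a_n)=a_0\cdot a_1\otimes\alpha a_2\cdots\alpha a_n+\sum_{i=1}^{n-1}(-1)^i\alpha a_0\otimes\alpha a_1\cdots(a_i\cdot a_{i+1})\cdots\alpha a_n+(-1)^n a_n\cdot a_0\otimes\alpha a_1\cdots\alpha a_{n-1},$$ and homology $H_n^\alpha(A)$, with $H_n^\alpha(A)=0$ for $n<0$. For $f\in C^p_\alpha(A)$ put $i_f=0$ on $C_n^\alpha(A)$ for $n<p$, and for $n\ge p$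 $$i_f(a_0\otimes a_1\cdots a_n)=\alpha^{p-1}(a_0)\cdot f(a_1,\dots,a_p)\otimes\alpha^p a_{p+1}\cdots\alpha^p a_n .$$ With $t(a_0\otimes a_1\cdots a_n)=a_n\otimes a_0\cdots a_{n-1}$, let Connes' operator $B:C_n^\alpha(A)\to C_{n+1}^\alpha(A)$ be $$B x=\sum_{i=0}^n(-1)^{in}\,(\mathrm{id}-(-1)^{n+1}t)\,t\,(s\,t^i x),\qquad s(a_0\otimes a_1\cdots a_n)=\alpha^{-1}a_0\otimes\alpha^{-1}a_1\cdots\alpha^{-1}a_n\otimes 1 .$$ **Proposition.** The operations $\cup$, $[\ ,\ ]$, $(f,x)\mapsto i_fx$ and $B$ descend to $H^\bullet_\alpha(A)$ and $H_\bullet^\alpha(A)$. Let $d\ge 0$ and let $c\in H_d^\alpha(A)$ satisfy $B(c)=0$. Suppose that for every $n\ge 0$ the map $H^n_\alpha(A)\to H^\alpha_{d-n}(A)$, $f\mapsto i_fc$, is bijective (so that these maps form an isomorphism of $H^\bullet_\alpha(A)$-modules), and that $B(i_fc)=0$ for all $f\in H^0_\alpha(A)$ (which is necessary for $\Delta$ below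 to exist, and is automatic if $H_{d+1}^\alpha(A)=0$, that is, if the maps $f\mapsto i_fc$ are bijective for all $n\in\mathbb Z$). Then $(H^\bullet_\alpha(A),\cup,[\ ,\ ])$ is a Gerstenhaber algebra, i.e. $\cup$ is associative and graded commutative, $[\ ,\ ]$ is a graded Lie bracket of degree $-1$, and $[f,g\cup h]=[f,g]\cup h+(-1)^{(p-1)q}g\cup[f,h]$ for $f\in H^p_\alpha(A)$, $g\in H^q_\alpha(A)$; and there is a unique linear map $\Delta:H^\bullet_\alpha(A)\to H^\bullet_\alpha(A)$ with $$i_{\Delta f}\,c=B(i_fc)\qquad\text{for all } f\in H^\bullet_\alpha(A).$$ It is a BV generator: it has degree $-1$, $\Delta^2=0$, and $$[f,g]=-(-1)^p\big(\Delta(f\cup g)-\Delta(f)\cup g-(-1)^p f\cup\Delta(g)\big)\qquad\text{for } f\in H^p_\alpha(A),\ g\in H^\bullet_\alpha(A).$$ Hence $H^\bullet_\alpha(A)$ is a BV algebra. -/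

import Mathlib

/-! # Hochschild calculus of a regular unital hom-associative algebra -/

noncomputable section

namespace HomHochschild

/-! ## Gerstenhaber algebras and BV generators -/

/-- `(V, cup, br)` with the `ℤ`-grading `V = ⨁ 𝒜 n` is a Gerstenhaber algebra over `k`:
a graded commutative associative product and a degree `-1` graded Lie bracket, related by the
Leibniz rule. -/
structure IsGerstenhaber {k V : Type*} [CommRing k] [AddCommGroup V] [Module k V]
    (𝒜 : ℤ → Submodule k V) (cup br : V →ₗ[k] V →ₗ[k] V) : Prop where
  isInternal : DirectSum.IsInternal 𝒜
  cup_mem : ∀ {p q : ℤ} {f g : V}, f ∈ 𝒜 p → g ∈ 𝒜 q → cup f g ∈ 𝒜 (p + q)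
  cup_assoc : ∀ f g h : V, cup (cup f g) h = cup f (cup g h)
  cup_comm : ∀ {p q : ℤ} {f g : V}, f ∈ 𝒜 p → g ∈ 𝒜 q →
    cup f g = Int.negOnePow (p * q) • cup g f
  br_mem : ∀ {p q : ℤ} {f g : V}, f ∈ 𝒜 p → g ∈ 𝒜 q → br f g ∈ 𝒜 (p + q - 1)
  br_skew : ∀ {p q : ℤ} {f g : V}, f ∈ 𝒜 p → g ∈ 𝒜 q →
    br f g = -(Int.negOnePow ((p - 1) * (q - 1)) • br g f)
  jacobi : ∀ {p q r : ℤ} {f g h : V}, f ∈ 𝒜 p → g ∈ 𝒜 q → h ∈ 𝒜 r →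
    br f (br g h) = br (br f g) h + Int.negOnePow ((p - 1) * (q - 1)) • br g (br f h)
  leibniz : ∀ {p q r : ℤ} {f g h : V}, f ∈ 𝒜 p → g ∈ 𝒜 q → h ∈ 𝒜 r →
    br f (cup g h) = cup (br f g) h + Int.negOnePow ((p - 1) * q) • cup g (br f h)

/-- `Δ` is a BV generator: a square-zero map of degree `-1` with
`[f, g] = -(-1)^p (Δ(f ∪ g) - Δ f ∪ g - (-1)^p f ∪ Δ g)` for `f` of degree `p`. -/
structure IsBVGenerator {k V : Type*} [CommRing k] [AddCommGroup V] [Module k V]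
    (𝒜 : ℤ → Submodule k V) (cup br : V →ₗ[k] V →ₗ[k] V) (Δ : V →ₗ[k] V) : Prop where
  map_mem : ∀ {n : ℤ} {f : V}, f ∈ 𝒜 n → Δ f ∈ 𝒜 (n - 1)
  sq_zero : ∀ f : V, Δ (Δ f) = 0
  bracket_eq : ∀ {p : ℤ} {f : V}, f ∈ 𝒜 p → ∀ g : V,
    br f g = -(Int.negOnePow p • (Δ (cup f g) - cup (Δ f) g - Int.negOnePow p • cup f (Δ g)))

/-! ## Homology of an endomorphism and induced maps -/

section Homology

variable {k C D E : Type*} [CommRing k] [AddCommGroup C] [Module k C] [AddCommGroup D] [Module k D]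
  [AddCommGroup E] [Module k E]

/-- The (co)homology `ker d / im d` of a total complex `(C, d)`
(literally `ker d / (im d ∩ ker d)`). -/
abbrev Homology (d : C →ₗ[k] C) : Type _ :=
  LinearMap.ker d ⧸ (LinearMap.range d).submoduleOf (LinearMap.ker d)

/-- The class of a (co)cycle. -/
def cls (d : C →ₗ[k] C) : LinearMap.ker d →ₗ[k] Homology d :=
  ((LinearMap.range d).submoduleOf (LinearMap.ker d)).mkQ

/-- `T'` is the map induced by `T` on homology: `T` maps cycles to cycles, and `T' [x] = [T x]`. -/
def Induces (dC : C →ₗ[k] C) (dD : D →ₗ[k] D) (T : C →ₗ[k] D)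
    (T' : Homology dC →ₗ[k] Homology dD) : Prop :=
  ∀ x : LinearMap.ker dC, ∃ h : T x ∈ LinearMap.ker dD, T' (cls dC x) = cls dD ⟨T x, h⟩

/-- `T'` is the bilinear map induced by `T` on homology: `T' [x] [y] = [T x y]`. -/
def Induces₂ (dC : C →ₗ[k] C) (dD : D →ₗ[k] D) (dE : E →ₗ[k] E) (T : C →ₗ[k] D →ₗ[k] E)
    (T' : Homology dC →ₗ[k] Homology dD →ₗ[k] Homology dE) : Prop :=
  ∀ (x : LinearMap.ker dC) (y : LinearMap.ker dD), ∃ h : T x y ∈ LinearMap.ker dE,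
    T' (cls dC x) (cls dD y) = cls dE ⟨T x y, h⟩

open Classical in
/-- The map induced by `T` on homology (it is unique; the value is `0` if `T` does not descend). -/
def induced (dC : C →ₗ[k] C) (dD : D →ₗ[k] D) (T : C →ₗ[k] D) :
    Homology dC →ₗ[k] Homology dD :=
  if h : ∃ T', Induces dC dD T T' then h.choose else 0

open Classical in
/-- The bilinear map induced by `T` on homology (it is unique; the value is `0` if `T` does not
descend). -/
def induced₂ (dC : C →ₗ[k] C) (dD : D →ₗ[k] D) (dE : E →ₗ[k] E) (T : C →ₗ[k] D →ₗ[k] E) :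
    Homology dC →ₗ[k] Homology dD →ₗ[k] Homology dE :=
  if h : ∃ T', Induces₂ dC dD dE T T' then h.choose else 0

end Homology

/-- The elements of degree `n ∈ ℤ` of an `ℕ`-graded module `⨁ m, M m`: all components of degree
different from `n` vanish. It is `0` for `n < 0`. -/
def homogeneous (k : Type*) [CommRing k] (M : ℕ → Type*) [∀ m, AddCommGroup (M m)]
    [∀ m, Module k (M m)] (n : ℤ) : Submodule k (DirectSum ℕ M) where
  carrier := {x | ∀ m : ℕ, (m : ℤ) ≠ n → x m = 0}
  zero_mem' := fun _ _ => rfl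
  add_mem' := fun {x y} hx hy m hm => by
    rw [DirectSum.add_apply, hx m hm, hy m hm, add_zero]
  smul_mem' := fun c x hx m hm => by
    rw [DirectSum.smul_apply, hx m hm, smul_zero]

/-- The degree `n` part of the (co)homology of a total complex: classes of (co)cycles of
degree `n`. -/
def homologyDeg {k : Type*} [CommRing k] {M : ℕ → Type*} [∀ m, AddCommGroup (M m)]
    [∀ m, Module k (M m)] (d : DirectSum ℕ M →ₗ[k] DirectSum ℕ M) (n : ℤ) :
    Submodule k (Homology d) :=
  ((homogeneous k M n).submoduleOf (LinearMap.ker d)).map (cls d)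

/-! ## Hom-associative algebras -/

/-- A regular unital (multiplicative) hom-associative algebra structure on the `k`-module `A`;
regular means that the structure map `α` is invertible. -/
structure RegUnitalHomAssoc (k A : Type*) [CommRing k] [AddCommGroup A] [Module k A] where
  mul : A →ₗ[k] A →ₗ[k] A
  α : A ≃ₗ[k] A
  hom_assoc : ∀ a b c : A, mul (mul a b) (α c) = mul (α a) (mul b c)
  map_mul : ∀ a b : A, α (mul a b) = mul (α a) (α b)
  one : A
  map_one : α one = one
  mul_one : ∀ a : A, mul a one = α a
  one_mul : ∀ a : A, mul one a = α a

namespace RegUnitalHomAssoc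

variable {k A : Type*} [CommRing k] [AddCommGroup A] [Module k A] (R : RegUnitalHomAssoc k A)

/-- The power `α ^ m`, `m ∈ ℤ`. -/
def tw (m : ℤ) : A ≃ₗ[k] A := R.α ^ m

/-- Insertion of `g` at (zero-based) position `i` of a word:
`(α^{q-1} a_0, …, α^{q-1} a_{i-1}, g (a_i, …, a_{i+q-1}), α^{q-1} a_{i+q}, …)`. -/
def insertWord {q M N : ℕ} (h : M + q = N + 1) (i : Fin M)
    (g : MultilinearMap k (fun _ : Fin q => A) A) (a : Fin N → A) : Fin M → A := fun j =>
  if _ : (j : ℕ) < i then R.tw ((q : ℤ) - 1) (a ⟨j, by omega⟩)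
  else if _ : (j : ℕ) = i then g (fun l => a ⟨i + l, by omega⟩)
  else R.tw ((q : ℤ) - 1) (a ⟨j + q - 1, by omega⟩)

/-- The position of a letter of the long word in the short word. -/
def block {q M N : ℕ} (h : M + q = N + 1) (i : Fin M) (l : Fin N) : Fin M :=
  if _ : (l : ℕ) < i then ⟨l, by omega⟩
  else if _ : (l : ℕ) < i + q then i
  else ⟨l + 1 - q, by omega⟩

theorem insertWord_update {q M N : ℕ} (h : M + q = N + 1) (i : Fin M)
    (g : MultilinearMap k (fun _ : Fin q => A) A) (a : Fin N → A) (l : Fin N) :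
    ∃ φ : A →ₗ[k] A, ∀ x : A, R.insertWord h i g (Function.update a l x) =
      Function.update (R.insertWord h i g a) (block h i l) (φ x) := by
  by_cases h1 : (l : ℕ) < i
  · refine ⟨(R.tw ((q : ℤ) - 1)).toLinearMap, fun x => ?_⟩
    funext j
    simp only [insertWord, block, h1, dite_true, Function.update_apply, Fin.ext_iff]
    split_ifs <;> first | rfl | omega | skip
    congr 1
    funext m
    rw [if_neg (by omega)]
  · by_cases h2 : (l : ℕ) < i + q
    · refine ⟨g.toLinearMap (fun m => a ⟨i + m, by omega⟩) ⟨l - i, by omega⟩, fun x => ?_⟩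
      funext j
      simp only [insertWord, block, h1, h2, dite_true, dite_false, Function.update_apply,
        Fin.ext_iff]
      split_ifs <;> first | rfl | omega | skip
      rw [MultilinearMap.toLinearMap_apply]
      congr 1
      funext m
      simp only [Function.update_apply, Fin.ext_iff]
      split_ifs <;> first | rfl | omega
    · refine ⟨(R.tw ((q : ℤ) - 1)).toLinearMap, fun x => ?_⟩
      funext j
      simp only [insertWord, block, h1, h2, dite_false, Function.update_apply, Fin.ext_iff]
      split_ifs <;> first | rfl | omega | skip
      congr 1
      funext m
      rw [if_neg (by omega)]

/-- The multilinear map `a ↦ F (insertWord g i a)`, linear in `F` and in `g`. -/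
def insert {E : Type*} [AddCommGroup E] [Module k E] {q M N : ℕ} (h : M + q = N + 1) (i : Fin M) :
    MultilinearMap k (fun _ : Fin M => A) E →ₗ[k] MultilinearMap k (fun _ : Fin q => A) A →ₗ[k]
      MultilinearMap k (fun _ : Fin N => A) E :=
  LinearMap.mk₂ k
    (fun F g => MultilinearMap.mk' (fun a => F (R.insertWord h i g a))
      (fun a l x y => by
        obtain ⟨φ, hφ⟩ := R.insertWord_update h i g a l
        simp only [hφ, _root_.map_add, MultilinearMap.map_update_add])
      (fun a l c x => by
        obtain ⟨φ, hφ⟩ := R.insertWord_update h i g a l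
        simp only [hφ, _root_.map_smul, MultilinearMap.map_update_smul]))
    (fun _ _ _ => rfl) (fun _ _ _ => rfl)
    (fun F g g' => by
      ext a
      have key : ∀ g : MultilinearMap k (fun _ : Fin q => A) A, R.insertWord h i g a =
          Function.update (R.insertWord h i 0 a) i (g fun l => a ⟨i + l, by omega⟩) := by
        intro g
        funext j
        simp only [insertWord, Function.update_apply, Fin.ext_iff]
        split_ifs <;> first | rfl | omega
      change F _ = F _ + F _
      rw [key, key g, key g', _root_.add_apply, MultilinearMap.map_update_add])
    (fun c F g => by
      ext a
      have key : ∀ g : MultilinearMap k (fun _ : Fin q => A) A, R.insertWord h i g a =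
          Function.update (R.insertWord h i 0 a) i (g fun l => a ⟨i + l, by omega⟩) := by
        intro g
        funext j
        simp only [insertWord, Function.update_apply, Fin.ext_iff]
        split_ifs <;> first | rfl | omega
      change F _ = c • F _
      rw [key, key g, _root_.smul_apply, MultilinearMap.map_update_smul])

theorem insert_apply {E : Type*} [AddCommGroup E] [Module k E] {q M N : ℕ} (h : M + q = N + 1)
    (i : Fin M) (F : MultilinearMap k (fun _ : Fin M => A) E)
    (g : MultilinearMap k (fun _ : Fin q => A) A) (a : Fin N → A) :
    R.insert h i F g a = F (R.insertWord h i g a) := rfl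

/-! ## Hochschild cochains -/

/-- The cochains `C^n_α(A) = {f : A^{⊗ n} → A | α ∘ f = f ∘ α^{⊗ n}}`, `n ≥ 0`;
for `n = 0` these are the elements of `A` fixed by `α`. -/
def cochains (n : ℕ) : Submodule k (MultilinearMap k (fun _ : Fin n => A) A) where
  carrier := {f | ∀ a : Fin n → A, R.α (f a) = f (fun j => R.α (a j))}
  zero_mem' := fun _ => by simp
  add_mem' := fun {f g} hf hg a => by
    simp only [_root_.add_apply, _root_.map_add, hf a, hg a]
  smul_mem' := fun c f hf a => by
    simp only [_root_.smul_apply, _root_.map_smul, hf a]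

/-- The module `C^n_α(A)`. -/
def Cochain (n : ℕ) : Type _ := R.cochains n

instance (n : ℕ) : AddCommGroup (R.Cochain n) := inferInstanceAs (AddCommGroup (R.cochains n))

instance (n : ℕ) : Module k (R.Cochain n) := inferInstanceAs (Module k (R.cochains n))

/-- The multilinear map underlying a cochain. -/
def toMultilinear (n : ℕ) : R.Cochain n →ₗ[k] MultilinearMap k (fun _ : Fin n => A) A :=
  (R.cochains n).subtype

theorem α_tw (m : ℤ) (x : A) : R.α (R.tw m x) = R.tw m (R.α x) := by
  change (R.α * R.α ^ m) x = (R.α ^ m * R.α) x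
  rw [(Commute.self_zpow R.α m).eq]

theorem α_insertWord {q M N : ℕ} (h : M + q = N + 1) (i : Fin M) (g : R.Cochain q)
    (a : Fin N → A) (j : Fin M) :
    R.α (R.insertWord h i (R.toMultilinear q g) a j) =
      R.insertWord h i (R.toMultilinear q g) (fun l => R.α (a l)) j := by
  simp only [insertWord]
  split_ifs
  · exact R.α_tw _ _
  · exact g.2 _
  · exact R.α_tw _ _

/-- The partial composition `f ∘_{i+1} g`, for `f` of degree `p` and `g` of degree `q`, of degree
`r = p + q - 1`. -/
def comp {p q r : ℕ} (h : p + q = r + 1) (i : Fin p) :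
    R.Cochain p →ₗ[k] R.Cochain q →ₗ[k] R.Cochain r :=
  LinearMap.mk₂ k
    (fun f g => ⟨R.insert h i (R.toMultilinear p f) (R.toMultilinear q g), fun a => by
      rw [insert_apply, insert_apply]
      exact (f.2 _).trans (congrArg (R.toMultilinear p f)
        (funext fun j => R.α_insertWord h i g a j))⟩)
    (fun f f' g => Subtype.ext (LinearMap.congr_fun
      ((R.insert h i).map_add (R.toMultilinear p f) (R.toMultilinear p f')) _))
    (fun c f g => Subtype.ext (LinearMap.congr_fun
      ((R.insert h i).map_smul c (R.toMultilinear p f)) _))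
    (fun f g g' => Subtype.ext
      ((R.insert h i (R.toMultilinear p f)).map_add (R.toMultilinear q g) (R.toMultilinear q g')))
    (fun c f g => Subtype.ext
      ((R.insert h i (R.toMultilinear p f)).map_smul c (R.toMultilinear q g)))

/-- The multiplication, as an element of `C^2_α(A)`. -/
def mulCochain : R.Cochain 2 :=
  ⟨MultilinearMap.mk' (fun a : Fin 2 → A => R.mul (a 0) (a 1))
    (fun a l x y => by fin_cases l <;> simp)
    (fun a l c x => by fin_cases l <;> simp), fun a => R.map_mul _ _⟩

/-- The unit, as an element of `C^0_α(A)`. -/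
def oneCochain : R.Cochain 0 :=
  ⟨MultilinearMap.constOfIsEmpty k (fun _ : Fin 0 => A) R.one, fun _ => R.map_one⟩

/-- The Hochschild coboundary `C^n_α(A) → C^{n+1}_α(A)`:
`(δ f)(a_1, …, a_{n+1}) = α^{n-1}(a_1) · f(a_2, …, a_{n+1})
  + ∑_{i=1}^n (-1)^i f(α a_1, …, a_i · a_{i+1}, …, α a_{n+1})
  + (-1)^{n+1} f(a_1, …, a_n) · α^{n-1}(a_{n+1})`. -/
def coboundary (n : ℕ) : R.Cochain n →ₗ[k] R.Cochain (n + 1) :=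
  R.comp (p := 2) (by omega) 1 R.mulCochain
    + ∑ i : Fin n, Int.negOnePow ((i : ℤ) + 1) • (R.comp (p := n) (q := 2) (r := n + 1) (by omega) i).flip R.mulCochain
    + Int.negOnePow ((n : ℤ) + 1) • R.comp (p := 2) (by omega) 0 R.mulCochain

/-- The cup product `f ∪ g = (μ ∘_2 f) ∘_1 g`. -/
def cup (p q : ℕ) : R.Cochain p →ₗ[k] R.Cochain q →ₗ[k] R.Cochain (p + q) :=
  R.comp (p := p + 1) (by omega) 0 ∘ₗ R.comp (p := 2) (r := p + 1) (by omega) 1 R.mulCochain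

/-- `∑_{i=1}^p (-1)^{(q-1)(i-1)} f ∘_i g`. -/
def circ (p q r : ℕ) (h : r = p + q - 1) : R.Cochain p →ₗ[k] R.Cochain q →ₗ[k] R.Cochain r :=
  ∑ i : Fin p, Int.negOnePow (((q : ℤ) - 1) * i) • R.comp (p := p) (q := q) (r := r) (by have := i.2; omega) i

/-- The Gerstenhaber bracket
`[f, g] = ∑_{i=1}^p (-1)^{(q-1)(i-1)} f ∘_i g
  - (-1)^{(p-1)(q-1)} ∑_{i=1}^q (-1)^{(p-1)(i-1)} g ∘_i f`, of degree `p + q - 1`;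
it is zero for `p = q = 0`, where both sums are empty. -/
def bracket (p q : ℕ) : R.Cochain p →ₗ[k] R.Cochain q →ₗ[k] R.Cochain (p + q - 1) :=
  R.circ p q _ rfl - Int.negOnePow (((p : ℤ) - 1) * ((q : ℤ) - 1)) •
    (R.circ q p _ (by omega)).flip

/-! ## Hochschild chains -/

end RegUnitalHomAssoc

/-- The chains `C_n(A) = A ⊗ A^{⊗ n}`, that is, `A^{⊗ (n+1)}`. -/
def Chain (k A : Type*) [CommRing k] [AddCommGroup A] [Module k A] (n : ℕ) : Type _ :=
  PiTensorProduct k (fun _ : Fin (n + 1) => A)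

instance (k A : Type*) [CommRing k] [AddCommGroup A] [Module k A] (n : ℕ) :
    AddCommGroup (Chain k A n) :=
  inferInstanceAs (AddCommGroup (PiTensorProduct k (fun _ : Fin (n + 1) => A)))

instance (k A : Type*) [CommRing k] [AddCommGroup A] [Module k A] (n : ℕ) :
    Module k (Chain k A n) :=
  inferInstanceAs (Module k (PiTensorProduct k (fun _ : Fin (n + 1) => A)))

/-- The elementary tensor `a_0 ⊗ a_1 ⋯ a_n`. -/
def elem (k A : Type*) [CommRing k] [AddCommGroup A] [Module k A] (n : ℕ) :
    MultilinearMap k (fun _ : Fin (n + 1) => A) (Chain k A n) :=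
  PiTensorProduct.tprod k

/-- The cyclic operator `t (a_0 ⊗ a_1 ⋯ a_n) = a_n ⊗ a_0 a_1 ⋯ a_{n-1}`. -/
def cyc (k A : Type*) [CommRing k] [AddCommGroup A] [Module k A] (n : ℕ) :
    Chain k A n →ₗ[k] Chain k A n :=
  (PiTensorProduct.reindex k (fun _ : Fin (n + 1) => A) (finRotate (n + 1))).toLinearMap

namespace RegUnitalHomAssoc

variable {k A : Type*} [CommRing k] [AddCommGroup A] [Module k A] (R : RegUnitalHomAssoc k A)

/-- The comp module map `f •_i`, for `f` of degree `p`, from chains of degree `n` to chains of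
degree `m = n - p + 1`: `f •_i (a_0 ⊗ ⋯ ⊗ a_n) =
α^{p-1} a_0 ⊗ ⋯ ⊗ α^{p-1} a_{i-1} ⊗ f (a_i, …, a_{i+p-1}) ⊗ α^{p-1} a_{i+p} ⊗ ⋯ ⊗ α^{p-1} a_n`. -/
def act {p m n : ℕ} (h : m + p = n + 1) (i : Fin (m + 1)) :
    R.Cochain p →ₗ[k] Chain k A n →ₗ[k] Chain k A m :=
  (PiTensorProduct.lift (R := k) (s := fun _ : Fin (n + 1) => A) (E := Chain k A m)).toLinearMap ∘ₗ
    R.insert (by omega) i (elem k A m) ∘ₗ R.toMultilinear p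

/-- The Hochschild boundary `C_{n+1}(A) → C_n(A)`:
`a_0 ⊗ ⋯ ⊗ a_{n+1} ↦ ∑_{i=0}^n (-1)^i α a_0 ⊗ ⋯ ⊗ a_i · a_{i+1} ⊗ ⋯ ⊗ α a_{n+1}
  + (-1)^{n+1} a_{n+1} · a_0 ⊗ α a_1 ⊗ ⋯ ⊗ α a_n`. -/
def boundary (n : ℕ) : Chain k A (n + 1) →ₗ[k] Chain k A n :=
  (∑ i : Fin (n + 1), Int.negOnePow (i : ℤ) • R.act (by omega) i R.mulCochain)
    + Int.negOnePow ((n : ℤ) + 1) • R.act (by omega) 0 R.mulCochain ∘ₗ cyc k A (n + 1)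

/-- The cap product `i_f = (μ ∘_2 f) •_0 : C_{m+p}(A) → C_m(A)`, for `f` of degree `p`:
`i_f (a_0 ⊗ ⋯ ⊗ a_n) = α^{p-1}(a_0) · f (a_1, …, a_p) ⊗ α^p(a_{p+1}) ⊗ ⋯ ⊗ α^p(a_n)`. -/
def cap {p m n : ℕ} (h : m + p = n) : R.Cochain p →ₗ[k] Chain k A n →ₗ[k] Chain k A m :=
  R.act (by omega) 0 ∘ₗ R.comp (p := 2) (r := p + 1) (by omega) 1 R.mulCochain

/-- Connes' boundary operator
`B x = ∑_{i=0}^n (-1)^{i n} (id - (-1)^{n+1} t) t (e •_{n+1} t^i x) : C_n(A) → C_{n+1}(A)`. -/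
def connes (n : ℕ) : Chain k A n →ₗ[k] Chain k A (n + 1) :=
  ∑ i ∈ Finset.range (n + 1), Int.negOnePow ((i : ℤ) * n) •
    ((LinearMap.id - Int.negOnePow ((n : ℤ) + 1) • cyc k A (n + 1)) ∘ₗ cyc k A (n + 1) ∘ₗ
      R.act (by omega) (Fin.last (n + 1)) R.oneCochain ∘ₗ (cyc k A n) ^ i)

/-! ## Total complexes, cohomology and homology -/

/-- All cochains. -/
abbrev CochainTot : Type _ := DirectSum ℕ (fun n => R.Cochain n)

end RegUnitalHomAssoc

/-- All chains. -/
abbrev ChainTot (k A : Type*) [CommRing k] [AddCommGroup A] [Module k A] : Type _ :=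
  DirectSum ℕ (fun n => Chain k A n)

/-- The bilinear map on direct sums with the given components. -/
def bilin {k : Type*} [CommRing k] {M N : ℕ → Type*} {E : Type*} [∀ n, AddCommGroup (M n)]
    [∀ n, Module k (M n)] [∀ n, AddCommGroup (N n)] [∀ n, Module k (N n)] [AddCommGroup E]
    [Module k E] (T : ∀ p q : ℕ, M p →ₗ[k] N q →ₗ[k] E) :
    DirectSum ℕ M →ₗ[k] DirectSum ℕ N →ₗ[k] E :=
  DirectSum.toModule k ℕ _ fun p =>
    (DirectSum.toModule k ℕ _ fun q => (T p q).flip).flip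

namespace RegUnitalHomAssoc

variable {k A : Type*} [CommRing k] [AddCommGroup A] [Module k A] (R : RegUnitalHomAssoc k A)

/-- The Hochschild coboundary on all cochains. -/
def δ : R.CochainTot →ₗ[k] R.CochainTot :=
  DirectSum.toModule k ℕ _ fun n =>
    DirectSum.lof k ℕ (fun n => R.Cochain n) (n + 1) ∘ₗ R.coboundary n

/-- The cup product on all cochains. -/
def cupTot : R.CochainTot →ₗ[k] R.CochainTot →ₗ[k] R.CochainTot :=
  bilin fun p q => (R.cup p q).compr₂ (DirectSum.lof k ℕ (fun n => R.Cochain n) (p + q))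

/-- The Gerstenhaber bracket on all cochains. -/
def bracketTot : R.CochainTot →ₗ[k] R.CochainTot →ₗ[k] R.CochainTot :=
  bilin fun p q => (R.bracket p q).compr₂ (DirectSum.lof k ℕ (fun n => R.Cochain n) (p + q - 1))

/-- The Hochschild boundary on all chains, zero on chains of degree `0`. -/
def b : ChainTot k A →ₗ[k] ChainTot k A :=
  DirectSum.toModule k ℕ _ fun n => match n with
    | 0 => 0
    | n + 1 => DirectSum.lof k ℕ (fun n => Chain k A n) n ∘ₗ R.boundary n

/-- The cap product `f, x ↦ i_f x` of all cochains with all chains, zero if the degree of `f`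
exceeds that of `x`. -/
def capTot : R.CochainTot →ₗ[k] ChainTot k A →ₗ[k] ChainTot k A :=
  bilin fun p n => if h : p ≤ n then
    (R.cap (p := p) (m := n - p) (n := n) (by omega)).compr₂
      (DirectSum.lof k ℕ (fun n => Chain k A n) (n - p)) else 0

/-- Connes' operator on all chains. -/
def connesTot : ChainTot k A →ₗ[k] ChainTot k A :=
  DirectSum.toModule k ℕ _ fun n =>
    DirectSum.lof k ℕ (fun n => Chain k A n) (n + 1) ∘ₗ R.connes n

/-- The Hochschild cohomology `H^•_α(A)`. -/
abbrev HCoh : Type _ := Homology R.δ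

/-- The Hochschild homology `H_•^α(A)`. -/
abbrev HHom : Type _ := Homology R.b

/-- `H^n_α(A)`, `n ∈ ℤ`. -/
def cohDeg (n : ℤ) : Submodule k R.HCoh := homologyDeg R.δ n

/-- `H_n^α(A)`, `n ∈ ℤ`. -/
def homDeg (n : ℤ) : Submodule k R.HHom := homologyDeg R.b n

/-- The cup product on cohomology. -/
def cupH : R.HCoh →ₗ[k] R.HCoh →ₗ[k] R.HCoh := induced₂ R.δ R.δ R.δ R.cupTot

/-- The Gerstenhaber bracket on cohomology. -/
def bracketH : R.HCoh →ₗ[k] R.HCoh →ₗ[k] R.HCoh := induced₂ R.δ R.δ R.δ R.bracketTot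

/-- The action `f, x ↦ i_f x` of cohomology on homology. -/
def capH : R.HCoh →ₗ[k] R.HHom →ₗ[k] R.HHom := induced₂ R.δ R.b R.b R.capTot

/-- Connes' operator on homology. -/
def connesH : R.HHom →ₗ[k] R.HHom := induced R.b R.b R.connesTot

/-- The cup product, the bracket, the cap product and Connes' operator descend from (co)chains to
(co)homology. -/
def OperationsDescend : Prop :=
  Induces₂ R.δ R.δ R.δ R.cupTot R.cupH ∧ Induces₂ R.δ R.δ R.δ R.bracketTot R.bracketH ∧
    Induces₂ R.δ R.b R.b R.capTot R.capH ∧ Induces R.b R.b R.connesTot R.connesH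

end RegUnitalHomAssoc

end HomHochschild

end

noncomputable section

namespace HomHochschild

/-! ## Operations on elementary tensors -/

/-! On homology, capping is multiplicative, B² = 0, and the derived bracket identity i_[f,g] =
[[i_f, B], i_g] holds for graded commutators (`capH_bracketH`, with its signs). The Lie-theoretic
identities then follow formally inside the endomorphisms of homology. The commutator L_f = [i_f, B]
is a derivation of composition, which gives the Leibniz rule; it commutes with B because B² = 0,
which gives L_[f,g] = [L_f, L_g] up to sign and hence Jacobi. Since f ↦ i_f c is injective,
identities between these operators evaluated at c are identities in cohomology. Graded commutativity
of ∪ is proved on cochains: the homotopy is f ∘ g (`δ_circ`). Evaluating the bracket identity at c,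
where Bc = 0, gives the BV formula, Δ being B transported through f ↦ i_f c. Surjectivity supplies Δ
in positive degrees; in degree 0 the hypothesis B(i_f c) = 0 replaces it.

The work lies in the bracket identity on cycles. All chains are put in one module and counted by
letters. With λ the signed rotation (`lam`), a cochain f becomes the operator `op` on the first
letters, and `pos i` conjugates an operator by λ^i, moving it to position i and producing the Koszul
signs. The relations needed are `op_comp` (nested slots), `op_pos_disjoint` (disjoint slots),
`opMul_assoc`, `opMul_opOne`, and λ^N = 1 on N letters. The twists by α enter only in establishing
these and in `cochain_ext`; the rest is a formal calculation. Writing μ_i for the product at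
position i, E for the unit put in front and N for the norm, b is the sum of μ_i over all positions,
b' omits the last one, B = (1 - λ) E N, and b'E + Eb' = 1.

Three homotopies on cycles carry the identity, each up to boundaries and signs. By
`exists_b_eq_lieOp`, B i_f is L_f minus f N; by `exists_b_eq_mulOp_connesTot`, i_f B is f N;
together they form the Cartan formula. In the commutator of L_f with i_g, the placements of f that
do not involve the first letter yield g ∘ f (`lieOp_mulOp`), and those that involve it yield f ∘ g
(`exists_boundary_compFrom`). The two halves make up the bracket. -/

theorem chain_ext {k A E : Type*} [CommRing k] [AddCommGroup A] [Module k A] [AddCommGroup E]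
    [Module k E] {n : ℕ} {φ ψ : Chain k A n →ₗ[k] E}
    (h : ∀ a, φ (elem k A n a) = ψ (elem k A n a)) : φ = ψ :=
  PiTensorProduct.ext (MultilinearMap.ext h)

theorem cyc_elem {k A : Type*} [CommRing k] [AddCommGroup A] [Module k A] (n : ℕ)
    (a : Fin (n + 1) → A) :
    cyc k A n (elem k A n a) = elem k A n fun j => a ((finRotate (n + 1)).symm j) :=
  PiTensorProduct.reindex_tprod _ _

theorem cyc_iterate_elem {k A : Type*} [CommRing k] [AddCommGroup A] [Module k A] (n i : ℕ)
    (a : Fin (n + 1) → A) :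
    (cyc k A n ^ i) (elem k A n a) =
      elem k A n fun j => a ((finRotate (n + 1)).symm^[i] j) := by
  induction i with
  | zero => rfl
  | succ i ih =>
    rw [pow_succ', Module.End.mul_apply, ih, cyc_elem]
    rfl

theorem finRotate_symm_iterate (n : ℕ) (j : Fin (n + 1)) :
    (finRotate (n + 1)).symm^[n + 1] j = j := by
  have key : ∀ i : ℕ, ((finRotate (n + 1))^[i] j : ℕ) = (j + i) % (n + 1) := by
    intro i
    induction i with
    | zero => simp [Nat.mod_eq_of_lt j.2]
    | succ i ih =>
      rw [Function.iterate_succ_apply', finRotate_apply, Fin.val_add, ih, Fin.val_one',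
        ← Nat.add_mod, add_assoc]
  have h : (finRotate (n + 1))^[n + 1] j = j := Fin.ext <| by
    rw [key, Nat.add_mod_right, Nat.mod_eq_of_lt j.2]
  have h2 := Function.LeftInverse.iterate (finRotate (n + 1)).symm_apply_apply (n + 1) j
  rwa [h] at h2

theorem coe_finRotate_symm (n : ℕ) (j : Fin (n + 1)) :
    ((finRotate (n + 1)).symm j : ℕ) = if (j : ℕ) = 0 then n else j - 1 := by
  split_ifs with hj
  · have : j = finRotate (n + 1) (Fin.last n) := by
      rw [finRotate_last]; exact Fin.ext hj
    rw [this, Equiv.symm_apply_apply, Fin.val_last]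
  · exact coe_finRotate_symm_of_ne_zero (fun h => hj (by simp [h]))

theorem cyc_pow_self {k A : Type*} [CommRing k] [AddCommGroup A] [Module k A] (n : ℕ) :
    cyc k A n ^ (n + 1) = 1 := by
  refine chain_ext fun a => ?_
  rw [cyc_iterate_elem]
  simp only [finRotate_symm_iterate]
  rfl

namespace RegUnitalHomAssoc

variable {k A : Type*} [CommRing k] [AddCommGroup A] [Module k A] (R : RegUnitalHomAssoc k A)

theorem act_elem {p m n : ℕ} (h : m + p = n + 1) (i : Fin (m + 1)) (f : R.Cochain p)
    (a : Fin (n + 1) → A) :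
    R.act h i f (elem k A n a) =
      elem k A m (R.insertWord (by omega) i (R.toMultilinear p f) a) :=
  PiTensorProduct.lift.tprod _

theorem tw_add (x y : ℤ) (a : A) : R.tw (x + y) a = R.tw x (R.tw y a) := by
  simp only [tw, zpow_add]
  rfl

theorem tw_one (a : A) : R.tw 1 a = R.α a := by
  simp only [tw, zpow_one]

/-- Commutation with α is part of the definition of a cochain; negative powers follow because α is
injective and can be cancelled. -/
theorem tw_cochain {n : ℕ} (f : R.Cochain n) (z : ℤ) (a : Fin n → A) :
    R.tw z (R.toMultilinear n f a) = R.toMultilinear n f fun j => R.tw z (a j) := by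
  induction z using Int.induction_on generalizing a with
  | zero => rfl
  | succ z ih =>
    rw [add_comm, tw_add, ih, tw_one]
    simp only [tw_add, tw_one]
    exact f.2 _
  | pred z ih =>
    rw [sub_eq_add_neg, tw_add]
    have h1 : R.tw (-1) (R.toMultilinear n f a) =
        R.toMultilinear n f fun j => R.tw (-1) (a j) := by
      apply R.α.injective
      rw [← R.tw_one, ← R.tw_one, ← tw_add]
      have h2 := f.2 fun j => R.tw (-1) (a j)
      have h3 : ∀ x, R.α (R.tw (-1) x) = x := fun x => by
        rw [← R.tw_one, ← tw_add]; rfl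
      simp only [h3] at h2
      rw [R.tw_one]
      exact h2.symm
    rw [h1, ih]
    simp only [tw_add]

section insertWord

variable {q M N : ℕ} (h : M + q = N + 1) (i : Fin M) (g : MultilinearMap k (fun _ : Fin q => A) A)
  (a : Fin N → A) {j : Fin M}

theorem insertWord_of_lt (hj : (j : ℕ) < i) (l : Fin N) (hl : (l : ℕ) = j) :
    R.insertWord h i g a j = R.tw ((q : ℤ) - 1) (a l) := by
  rw [insertWord, dif_pos hj]
  congr 2
  exact Fin.ext hl.symm

theorem insertWord_of_eq (hj : (j : ℕ) = i) (w : Fin q → A)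
    (hw : ∀ (s : Fin q) (l : Fin N), (l : ℕ) = i + s → w s = a l) :
    R.insertWord h i g a j = g w := by
  rw [insertWord, dif_neg (by omega), dif_pos hj]
  congr 1
  funext s
  exact (hw s _ rfl).symm

theorem insertWord_of_gt (hj : (i : ℕ) < j) (l : Fin N) (hl : (l : ℕ) + 1 = j + q) :
    R.insertWord h i g a j = R.tw ((q : ℤ) - 1) (a l) := by
  rw [insertWord, dif_neg (by omega), dif_neg (by omega)]
  congr 2
  exact Fin.ext (by simp only; omega)

end insertWord

/-- A rotation pushes the slot of `f` one place to the right. The bound i < m excludes the last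
slot, where the value of `f` would itself be carried to the front. -/
theorem cyc_act {p m n : ℕ} (h : m + p = n + 1) (i : ℕ) (hi : i < m) (f : R.Cochain p)
    (x : Chain k A n) :
    cyc k A m (R.act h ⟨i, by omega⟩ f x) = R.act h ⟨i + 1, by omega⟩ f (cyc k A n x) := by
  refine LinearMap.congr_fun (f := cyc k A m ∘ₗ R.act h ⟨i, by omega⟩ f)
    (g := R.act h ⟨i + 1, by omega⟩ f ∘ₗ cyc k A n) (chain_ext fun a => ?_) x
  simp only [LinearMap.comp_apply, act_elem, cyc_elem]
  congr 1
  funext j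
  have hj := coe_finRotate_symm m j
  have hn : ∀ l l' : Fin (n + 1), (l' : ℕ) = (if (l : ℕ) = 0 then n else l - 1) →
      a ((finRotate (n + 1)).symm l) = a l' := fun l l' hl => by
    congr 1
    exact Fin.ext (by rw [coe_finRotate_symm, hl])
  by_cases h0 : (j : ℕ) = 0
  · rw [if_pos h0] at hj
    rw [R.insertWord_of_gt _ _ _ _ (by simp only; omega) ⟨n, by omega⟩ (by simp only; omega),
      R.insertWord_of_lt _ _ _ _ (by simp only; omega) ⟨0, by omega⟩ (by simp only; omega),
      hn _ ⟨n, by omega⟩ (by simp)]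
  rw [if_neg h0] at hj
  rcases lt_trichotomy (j : ℕ) (i + 1) with hji | hji | hji
  · rw [R.insertWord_of_lt _ _ _ _ (by simp only; omega) ⟨j - 1, by omega⟩ (by simp only; omega),
      R.insertWord_of_lt _ _ _ _ (by simp only; omega) ⟨j, by omega⟩ (by simp only),
      hn _ ⟨j - 1, by omega⟩ (by simp [h0])]
  · rw [R.insertWord_of_eq _ _ _ _ (by simp only; omega) (fun s => a ⟨i + s, by omega⟩)
        (fun s l hl => by congr 1; exact Fin.ext hl.symm),
      R.insertWord_of_eq _ _ _ _ (by simp only; omega) (fun s => a ⟨i + s, by omega⟩)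
        (fun s l hl => (hn _ _ (by simp only at hl ⊢; split_ifs <;> omega)).symm)]
  · rw [R.insertWord_of_gt _ _ _ _ (by simp only; omega) ⟨j + p - 2, by omega⟩
        (by simp only; omega),
      R.insertWord_of_gt _ _ _ _ (by simp only; omega) ⟨j + p - 1, by omega⟩
        (by simp only; omega),
      hn _ ⟨j + p - 2, by omega⟩ (by simp only; split_ifs <;> omega)]

/-- Letters outside both slots are twisted by α^(q-1) and then α^(p-1), which is α^(r-1) because r -
1 = (p - 1) + (q - 1). -/
theorem act_comp {p q r m n l : ℕ} (hg : m + q = n + 1) (hf : l + p = m + 1) (hr : l + r = n + 1)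
    (hc : p + q = r + 1) (i : ℕ) (hi : i < p) (f : R.Cochain p) (g : R.Cochain q)
    (x : Chain k A n) :
    R.act hf ⟨0, by omega⟩ f (R.act hg ⟨i, by omega⟩ g x) =
      R.act hr ⟨0, by omega⟩ (R.comp hc ⟨i, hi⟩ f g) x := by
  refine LinearMap.congr_fun (f := R.act hf ⟨0, by omega⟩ f ∘ₗ R.act hg ⟨i, by omega⟩ g)
    (g := R.act hr ⟨0, by omega⟩ (R.comp hc ⟨i, hi⟩ f g)) (chain_ext fun a => ?_) x
  simp only [LinearMap.comp_apply, act_elem]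
  congr 1
  funext j
  have hcf : ∀ w : Fin r → A, R.toMultilinear r (R.comp hc ⟨i, hi⟩ f g) w =
    R.toMultilinear p f (R.insertWord hc ⟨i, hi⟩ (R.toMultilinear q g) w) := fun w => rfl
  by_cases h0 : (j : ℕ) = 0
  · rw [R.insertWord_of_eq (q := r) (i := (⟨0, by omega⟩ : Fin (l + 1))) _ _ _ (by simpa using h0)
        (fun s => a ⟨s, by omega⟩) (fun s t ht => by congr 1; exact Fin.ext (by simpa using ht.symm)),
      hcf]
    refine R.insertWord_of_eq _ _ _ _ (by simpa using h0) _ fun s t ht => ?_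
    have ht' : (t : ℕ) = s := by simpa using ht
    rcases lt_trichotomy (s : ℕ) i with hsi | hsi | hsi
    · rw [R.insertWord_of_lt (j := s) hc ⟨i, hi⟩ _ _ (by simp only; omega) ⟨s, by omega⟩ rfl,
        R.insertWord_of_lt (N := n + 1) (i := ⟨i, by omega⟩) (j := t) _ _ _ (by simp only; omega)
          ⟨s, by omega⟩ (by simp only; omega)]
    · rw [R.insertWord_of_eq (j := s) hc ⟨i, hi⟩ _ _ (by simp only; omega) (fun u => a ⟨i + u, by omega⟩)
          (fun u v hv => by congr 1; exact Fin.ext (by simpa using hv.symm)),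
        R.insertWord_of_eq (N := n + 1) (i := ⟨i, by omega⟩) (j := t) _ _ _ (by simp only; omega)
          (fun u => a ⟨i + u, by omega⟩)
          (fun u v hv => by congr 1; exact Fin.ext (by simpa using hv.symm))]
    · rw [R.insertWord_of_gt (j := s) hc ⟨i, hi⟩ _ _ (by simp only; omega) ⟨s + q - 1, by omega⟩
          (by simp only; omega),
        R.insertWord_of_gt (N := n + 1) (i := ⟨i, by omega⟩) (j := t) _ _ _ (by simp only; omega)
          ⟨s + q - 1, by omega⟩
          (by simp only; omega)]
  · rw [R.insertWord_of_gt (i := (⟨0, by omega⟩ : Fin (l + 1))) _ _ _ (by simp only; omega)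
        ⟨j + p - 1, by omega⟩ (by simp only; omega),
      R.insertWord_of_gt (i := (⟨0, by omega⟩ : Fin (l + 1))) _ _ _ (by simp only; omega)
        ⟨j + r - 1, by omega⟩ (by simp only; omega),
      R.insertWord_of_gt _ _ _ _ (by simp only; omega) ⟨j + r - 1, by omega⟩ (by simp only; omega),
      ← tw_add]
    congr 2
    omega

/-- The slots are disjoint. Since `f` contracts p letters to one, slot p + r becomes slot r + 1.
Each value receives the twist of the other cochain, which may be moved inside by `tw_cochain`. -/
theorem act_act {p q m₁ m₂ n l : ℕ} (hg : m₁ + q = n + 1) (hf : l + p = m₁ + 1)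
    (hf' : m₂ + p = n + 1) (hg' : l + q = m₂ + 1) (r : ℕ) (hr : r < l) (f : R.Cochain p)
    (g : R.Cochain q) (x : Chain k A n) :
    R.act hf ⟨0, by omega⟩ f (R.act hg ⟨p + r, by omega⟩ g x) =
      R.act hg' ⟨r + 1, by omega⟩ g (R.act hf' ⟨0, by omega⟩ f x) := by
  refine LinearMap.congr_fun (f := R.act hf ⟨0, by omega⟩ f ∘ₗ R.act hg ⟨p + r, by omega⟩ g)
    (g := R.act hg' ⟨r + 1, by omega⟩ g ∘ₗ R.act hf' ⟨0, by omega⟩ f) (chain_ext fun a => ?_) x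
  simp only [LinearMap.comp_apply, act_elem]
  congr 1
  funext j
  have hcomm : ∀ y, R.tw ((q : ℤ) - 1) (R.tw ((p : ℤ) - 1) y) =
      R.tw ((p : ℤ) - 1) (R.tw ((q : ℤ) - 1) y) := fun y => by
    rw [← tw_add, ← tw_add, add_comm]
  by_cases h0 : (j : ℕ) = 0
  · rw [R.insertWord_of_eq (i := (⟨0, by omega⟩ : Fin (l + 1))) (j := j) _ _ _ (by simpa using h0)
        (fun s => R.tw ((q : ℤ) - 1) (a ⟨s, by omega⟩)) (fun s t ht =>
          (R.insertWord_of_lt _ _ _ _ (by simp only at ht ⊢; omega) ⟨s, by omega⟩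
            (by simp only at ht ⊢; omega)).symm),
      R.insertWord_of_lt (j := j) _ _ _ _ (by simp only; omega) ⟨0, by omega⟩ h0.symm,
      R.insertWord_of_eq (i := (⟨0, by omega⟩ : Fin (m₂ + 1))) _ _ _ (by simp) (fun s => a ⟨s, by omega⟩)
        (fun s t ht => by congr 1; exact Fin.ext (by simpa using ht.symm)),
      tw_cochain]
  rw [R.insertWord_of_gt (i := (⟨0, by omega⟩ : Fin (l + 1))) _ _ _ (by simp only; omega)
        ⟨j + p - 1, by omega⟩ (by simp only; omega)]
  rcases lt_trichotomy (j : ℕ) (r + 1) with hji | hji | hji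
  · rw [R.insertWord_of_lt _ _ _ _ (by simp only; omega) ⟨j + p - 1, by omega⟩ (by simp only),
      R.insertWord_of_lt _ _ _ _ (by simp only; omega) ⟨j, by omega⟩ (by simp only),
      R.insertWord_of_gt (i := (⟨0, by omega⟩ : Fin (m₂ + 1))) _ _ _ (by simp only; omega) ⟨j + p - 1, by omega⟩
        (by simp only; omega), hcomm]
  · rw [R.insertWord_of_eq _ _ _ _ (by simp only; omega) (fun s => a ⟨p + r + s, by omega⟩)
        (fun s t ht => by congr 1; exact Fin.ext (by simpa using ht.symm)),
      R.insertWord_of_eq (j := j) _ _ _ _ (by simp only; omega)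
        (fun s => R.tw ((p : ℤ) - 1) (a ⟨p + r + s, by omega⟩)) (fun s t ht =>
          (R.insertWord_of_gt _ _ _ _ (by simp only at ht ⊢; omega) _ (by simp only at ht ⊢; omega)).symm),
      tw_cochain]
  · rw [R.insertWord_of_gt _ _ _ _ (by simp only; omega) ⟨j + p + q - 2, by omega⟩
        (by simp only; omega),
      R.insertWord_of_gt (j := j) _ _ _ _ (by simp only; omega) ⟨j + q - 1, by omega⟩
        (by simp only; omega),
      R.insertWord_of_gt (i := (⟨0, by omega⟩ : Fin (m₂ + 1))) _ _ _ (by simp only; omega)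
        ⟨j + p + q - 2, by omega⟩ (by simp only; omega), hcomm]

theorem toMultilinear_mulCochain (w : Fin 2 → A) :
    R.toMultilinear 2 R.mulCochain w = R.mul (w 0) (w 1) := rfl

theorem toMultilinear_oneCochain (w : Fin 0 → A) :
    R.toMultilinear 0 R.oneCochain w = R.one := rfl

/-- Inserting the unit twists the other letters by α⁻¹, and the product twists them back; in the
first slot, 1 · α⁻¹(a) = a. -/
theorem act_mul_act_one {n : ℕ} (x : Chain k A n) :
    R.act (p := 2) (n := n + 1) (m := n) rfl ⟨0, by omega⟩ R.mulCochain
      (R.act (p := 0) rfl ⟨0, by omega⟩ R.oneCochain x) = x := by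
  refine LinearMap.congr_fun
    (f := R.act (p := 2) (n := n + 1) (m := n) rfl ⟨0, by omega⟩ R.mulCochain ∘ₗ
      R.act (p := 0) rfl ⟨0, by omega⟩ R.oneCochain)
    (g := LinearMap.id) (chain_ext fun a => ?_) x
  simp only [LinearMap.comp_apply, act_elem, LinearMap.id_apply]
  congr 1
  funext j
  have htw : ∀ y, R.tw (((2 : ℕ) : ℤ) - 1) (R.tw (((0 : ℕ) : ℤ) - 1) y) = y := fun y => by
    rw [← tw_add]; rfl
  by_cases h0 : (j : ℕ) = 0
  · rw [R.insertWord_of_eq (j := j) _ _ _ _ h0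
      (![R.one, R.tw (((0 : ℕ) : ℤ) - 1) (a j)]) (fun s t ht => ?_), toMultilinear_mulCochain]
    · have h1 : R.tw (1 + (((0 : ℕ) : ℤ) - 1)) (a j) = a j := rfl
      rw [tw_add, tw_one] at h1
      exact (R.one_mul _).trans h1
    · fin_cases s
      · exact Eq.trans (b := R.toMultilinear 0 R.oneCochain Fin.elim0) rfl
          (R.insertWord_of_eq (i := ⟨0, by omega⟩) (j := t) _ _ _ (show (t : ℕ) = 0 from ht) Fin.elim0
          (fun s => s.elim0)).symm
      · exact (R.insertWord_of_gt _ _ _ _ (by simp only at ht ⊢; omega) j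
          (by simp only at ht ⊢; omega)).symm
  · rw [R.insertWord_of_gt (j := j) _ _ _ _ (by simp only; omega) ⟨j + 1, by omega⟩ rfl,
      R.insertWord_of_gt (j := ⟨(j : ℕ) + 1, by omega⟩) _ _ _ _ (by simp only; omega) j rfl, htw]

theorem toMultilinear_injective {n : ℕ} {f g : R.Cochain n}
    (h : ∀ a, R.toMultilinear n f a = R.toMultilinear n g a) : f = g :=
  Subtype.ext (MultilinearMap.ext h)

theorem elem_zero_injective {a b : Fin 1 → A} (h : elem k A 0 a = elem k A 0 b) : a 0 = b 0 := by
  have := congrArg (PiTensorProduct.lift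
    (MultilinearMap.ofSubsingleton k A A (0 : Fin 1) LinearMap.id)) h
  exact (PiTensorProduct.lift.tprod a).symm.trans (this.trans (PiTensorProduct.lift.tprod b))

theorem tw_one_eq (z : ℤ) : R.tw z R.one = R.one := by
  have := R.tw_cochain R.oneCochain z Fin.elim0
  simpa only [toMultilinear_oneCochain] using this

/-- Append a unit to the arguments and multiply: f(a) · 1 = α(f(a)), and α is injective. The extra
letter also makes room for p = 0, since a chain has at least one letter. -/
theorem cochain_ext {p : ℕ} {f g : R.Cochain p}
    (h : ∀ x : Chain k A p, R.act (p := p) (m := 1) (n := p) (by omega) ⟨0, by omega⟩ f x =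
      R.act (by omega) ⟨0, by omega⟩ g x) : f = g := by
  refine R.toMultilinear_injective fun a => R.α.injective ?_
  have key : ∀ f : R.Cochain p, R.act (p := 2) (n := 1) (m := 0) rfl ⟨0, by omega⟩ R.mulCochain
      (R.act (p := p) (m := 1) (n := p) (by omega) ⟨0, by omega⟩ f
        (elem k A p (Fin.snoc (α := fun _ => A) a R.one))) =
      elem k A 0 fun _ => R.α (R.toMultilinear p f a) := by
    intro f
    rw [act_elem, act_elem]
    congr 1
    funext j
    rw [R.insertWord_of_eq _ _ _ _ (by simp only; omega)
      ![R.toMultilinear p f a, R.one] (fun s t ht => ?_), toMultilinear_mulCochain]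
    · exact R.mul_one _
    · fin_cases s
      · refine (R.insertWord_of_eq _ _ _ _ (by simpa using ht) a fun s l hl => ?_).symm
        have : l = s.castSucc := Fin.ext (by simpa using hl)
        rw [this, Fin.snoc_castSucc]
      · rw [R.insertWord_of_gt _ _ _ _ (by simp only at ht ⊢; omega) (Fin.last p)
          (by simp only [Fin.val_last] at ht ⊢; omega), Fin.snoc_last, tw_one_eq]
        rfl
  have h1 := key f
  rw [h, key g] at h1
  exact (elem_zero_injective h1).symm

end RegUnitalHomAssoc
end HomHochschild
end

noncomputable section

namespace HomHochschild

/-! ## Operators on the total module of chains -/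

theorem exists_lof_of_mem_homogeneous {k : Type*} [CommRing k] {M : ℕ → Type*}
    [∀ m, AddCommGroup (M m)] [∀ m, Module k (M m)] {n : ℕ} {x : DirectSum ℕ M}
    (hx : x ∈ homogeneous k M n) : x = DirectSum.lof k ℕ M n (x n) := by
  refine DFinsupp.ext fun m => ?_
  by_cases h : m = n
  · subst h
    exact (DirectSum.lof_apply k m (x m)).symm
  · rw [hx m (by exact_mod_cast h)]
    exact (DFinsupp.single_eq_of_ne h).symm

theorem lof_mem_homogeneous {k : Type*} [CommRing k] {M : ℕ → Type*}
    [∀ m, AddCommGroup (M m)] [∀ m, Module k (M m)] {n : ℕ} {z : ℤ} (h : z = n) (y : M n) :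
    DirectSum.lof k ℕ M n y ∈ homogeneous k M z := fun m hm =>
  DFinsupp.single_eq_of_ne (by rintro rfl; exact hm h.symm)

theorem homogeneous_of_neg {k : Type*} [CommRing k] {M : ℕ → Type*}
    [∀ m, AddCommGroup (M m)] [∀ m, Module k (M m)] {z : ℤ} (h : z < 0) {x : DirectSum ℕ M}
    (hx : x ∈ homogeneous k M z) : x = 0 :=
  DFinsupp.ext fun m => hx m (by omega)

/-! ### The signed rotation and operators at a position -/

section Rotation

variable (k A : Type*) [CommRing k] [AddCommGroup A] [Module k A]

/-- The chains with `N` letters. -/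
def letters (N : ℕ) : Submodule k (ChainTot k A) := homogeneous k (Chain k A) ((N : ℤ) - 1)

/-- The signed cyclic operator on all chains. -/
def rotEquiv : ChainTot k A ≃ₗ[k] ChainTot k A :=
  DFinsupp.mapRange.linearEquiv fun n =>
    (PiTensorProduct.reindex k (fun _ : Fin (n + 1) => A) (finRotate (n + 1))).trans
      (LinearEquiv.smulOfUnit ((-1 : kˣ) ^ n))

/-- The powers of the signed cyclic operator. -/
def lam (i : ℤ) : ChainTot k A →ₗ[k] ChainTot k A := (rotEquiv k A ^ i).toLinearMap

variable {k A}

theorem lam_zero (x : ChainTot k A) : lam k A 0 x = x := rfl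

theorem lam_lam (i j : ℤ) (x : ChainTot k A) : lam k A i (lam k A j x) = lam k A (i + j) x := by
  simp only [lam, zpow_add]
  rfl

theorem lam_one_lof (n : ℕ) (y : Chain k A n) :
    lam k A 1 (DirectSum.lof k ℕ (fun n => Chain k A n) n y) =
      Int.negOnePow n • DirectSum.lof k ℕ (fun n => Chain k A n) n (cyc k A n y) := by
  have h : lam k A 1 (DirectSum.lof k ℕ (fun n => Chain k A n) n y) =
      DirectSum.lof k ℕ (fun n => Chain k A n) n (((-1 : kˣ) ^ n) • cyc k A n y) := by
    simp only [lam, zpow_one]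
    exact DFinsupp.mapRange_single (hf := fun n => map_zero _)
  rw [h, Int.negOnePow_def, zpow_natCast]
  rcases Nat.even_or_odd n with hn | hn
  · rw [hn.neg_one_pow, hn.neg_one_pow, one_smul, one_smul]
  · rw [hn.neg_one_pow, hn.neg_one_pow, Units.neg_smul, Units.neg_smul, one_smul, one_smul,
      map_neg]

theorem eq_zero_of_mem_letters_zero {x : ChainTot k A} (hx : x ∈ letters k A 0) : x = 0 :=
  homogeneous_of_neg (by simp) hx

theorem exists_lof_of_mem_letters {n : ℕ} {x : ChainTot k A} (hx : x ∈ letters k A (n + 1)) :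
    ∃ y, x = DirectSum.lof k ℕ (fun n => Chain k A n) n y :=
  ⟨_, exists_lof_of_mem_homogeneous (by simpa [letters] using hx)⟩

theorem lof_mem_letters (n : ℕ) (y : Chain k A n) :
    DirectSum.lof k ℕ (fun n => Chain k A n) n y ∈ letters k A (n + 1) :=
  lof_mem_homogeneous (by simp) y

theorem lam_natCast_lof (i n : ℕ) (y : Chain k A n) :
    lam k A i (DirectSum.lof k ℕ (fun n => Chain k A n) n y) =
      Int.negOnePow (i * n) • DirectSum.lof k ℕ (fun n => Chain k A n) n ((cyc k A n ^ i) y) := by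
  induction i with
  | zero => simp [lam_zero]
  | succ i ih =>
    rw [Nat.cast_succ, add_comm, ← lam_lam, ih, Units.smul_def, map_zsmul, lam_one_lof,
      ← Units.smul_def, smul_smul, ← Int.negOnePow_add, pow_succ']
    congr 2
    ring_nf

theorem lam_period {N : ℕ} {x : ChainTot k A} (hx : x ∈ letters k A N) : lam k A N x = x := by
  cases N with
  | zero => rfl
  | succ n =>
    obtain ⟨y, rfl⟩ := exists_lof_of_mem_letters hx
    rw [lam_natCast_lof, cyc_pow_self, Module.End.one_apply,
      Int.negOnePow_even _ (by rw [mul_comm]; exact_mod_cast Nat.even_mul_succ_self n), one_smul]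

theorem lam_one_mem {N : ℕ} {x : ChainTot k A} (hx : x ∈ letters k A N) :
    lam k A 1 x ∈ letters k A N := by
  cases N with
  | zero => rw [eq_zero_of_mem_letters_zero hx, map_zero]; exact Submodule.zero_mem _
  | succ n =>
    obtain ⟨y, rfl⟩ := exists_lof_of_mem_letters hx
    rw [lam_one_lof, Units.smul_def]
    exact zsmul_mem (lof_mem_letters _ _) _

theorem lam_mem {N : ℕ} {x : ChainTot k A} (hx : x ∈ letters k A N) (i : ℤ) :
    lam k A i x ∈ letters k A N := by
  have hnat : ∀ (i : ℕ), ∀ x ∈ letters k A N, lam k A i x ∈ letters k A N := by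
    intro i
    induction i with
    | zero => exact fun x hx => hx
    | succ i ih =>
      intro x hx
      rw [Nat.cast_succ, ← lam_lam]
      exact ih _ (lam_one_mem hx)
  have hper : ∀ (j : ℕ), ∀ x ∈ letters k A N, lam k A (j * N : ℤ) x = x := by
    intro j
    induction j with
    | zero => intro x _; simp [lam_zero]
    | succ j ih =>
      intro x hx
      rw [Nat.cast_succ, add_mul, one_mul, ← lam_lam, lam_period hx, ih x hx]
  cases N with
  | zero => rw [eq_zero_of_mem_letters_zero hx, map_zero]; exact Submodule.zero_mem _
  | succ n =>
    rw [← hper i.natAbs x hx, lam_lam]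
    -- Adding |i| times the period makes the exponent nonnegative without changing the rotation.
    obtain ⟨m, hm⟩ : ∃ m : ℕ, i + (i.natAbs * (n + 1 : ℕ) : ℤ) = m := by
      refine ⟨(i + (i.natAbs * (n + 1 : ℕ) : ℤ)).toNat, (Int.toNat_of_nonneg ?_).symm⟩
      push_cast
      nlinarith [neg_abs_le i, mul_nonneg (abs_nonneg i) (Nat.cast_nonneg (α := ℤ) n)]
    rw [hm]
    exact hnat m x hx

theorem lam_add_period {N : ℕ} {x : ChainTot k A} (hx : x ∈ letters k A N) {i j : ℤ}
    (h : i = j + N) : lam k A i x = lam k A j x := by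
  rw [h, ← lam_lam, lam_period hx]

/-- The operator `φ` moved to position `i`. -/
def pos (i : ℤ) (φ : ChainTot k A →ₗ[k] ChainTot k A) : ChainTot k A →ₗ[k] ChainTot k A :=
  lam k A i ∘ₗ φ ∘ₗ lam k A (-i)

theorem pos_apply (i : ℤ) (φ : ChainTot k A →ₗ[k] ChainTot k A) (x : ChainTot k A) :
    pos i φ x = lam k A i (φ (lam k A (-i) x)) := rfl

theorem pos_zero (φ : ChainTot k A →ₗ[k] ChainTot k A) (x : ChainTot k A) :
    pos 0 φ x = φ x := rfl

theorem lam_pos (j i : ℤ) (φ : ChainTot k A →ₗ[k] ChainTot k A) (x : ChainTot k A) :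
    lam k A j (pos i φ x) = pos (j + i) φ (lam k A j x) := by
  rw [pos_apply, pos_apply, lam_lam, lam_lam]
  congr 3
  ring_nf

theorem pos_lam (j i : ℤ) (φ : ChainTot k A →ₗ[k] ChainTot k A) (x : ChainTot k A) :
    pos i φ (lam k A j x) = lam k A j (pos (i - j) φ x) := by
  rw [lam_pos, add_sub_cancel]

theorem pos_pos (i j : ℤ) (φ ψ : ChainTot k A →ₗ[k] ChainTot k A) (x : ChainTot k A) :
    pos i φ (pos j ψ x) = pos i (φ ∘ₗ pos (j - i) ψ) x := by
  change lam k A i (φ (lam k A (-i) (pos j ψ x))) = lam k A i (φ (pos (j - i) ψ (lam k A (-i) x)))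
  rw [lam_pos, neg_add_eq_sub]

end Rotation

/-! ### Cochains as operators on chains -/

namespace RegUnitalHomAssoc

variable {k A : Type*} [CommRing k] [AddCommGroup A] [Module k A] (R : RegUnitalHomAssoc k A)

/-- The operator on chains that applies the cochain `f` to the first letters, zero if there are
fewer letters than arguments. -/
def op (p : ℕ) : R.Cochain p →ₗ[k] ChainTot k A →ₗ[k] ChainTot k A :=
  (DirectSum.toModule k ℕ _ fun n => (if h : p ≤ n + 1 then
    (R.act (p := p) (m := n + 1 - p) (n := n) (by omega) ⟨0, by omega⟩).compr₂
      (DirectSum.lof k ℕ (fun n => Chain k A n) (n + 1 - p)) else 0).flip).flip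

variable {R} {p q : ℕ}

theorem op_lof (f : R.Cochain p) {m n : ℕ} (h : m + p = n + 1) (y : Chain k A n) :
    R.op p f (DirectSum.lof k ℕ (fun n => Chain k A n) n y) =
      DirectSum.lof k ℕ (fun n => Chain k A n) m (R.act h ⟨0, by omega⟩ f y) := by
  obtain rfl : m = n + 1 - p := by omega
  rw [op, LinearMap.flip_apply, DirectSum.toModule_lof, LinearMap.flip_apply, dif_pos (by omega)]
  rfl

theorem op_lof_of_lt (f : R.Cochain p) {n : ℕ} (h : n + 1 < p) (y : Chain k A n) :
    R.op p f (DirectSum.lof k ℕ (fun n => Chain k A n) n y) = 0 := by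
  rw [op, LinearMap.flip_apply, DirectSum.toModule_lof, LinearMap.flip_apply, dif_neg (by omega)]
  rfl

theorem op_eq_zero (f : R.Cochain p) {N : ℕ} {x : ChainTot k A} (hx : x ∈ letters k A N)
    (h : N < p) : R.op p f x = 0 := by
  cases N with
  | zero => rw [eq_zero_of_mem_letters_zero hx, map_zero]
  | succ n =>
    obtain ⟨y, rfl⟩ := exists_lof_of_mem_letters hx
    exact op_lof_of_lt f h y

theorem op_mem (f : R.Cochain p) {N M : ℕ} {x : ChainTot k A} (hx : x ∈ letters k A N)
    (h : M + p = N + 1) : R.op p f x ∈ letters k A M := by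
  cases N with
  | zero => rw [eq_zero_of_mem_letters_zero hx, map_zero]; exact Submodule.zero_mem _
  | succ n =>
    obtain ⟨y, rfl⟩ := exists_lof_of_mem_letters hx
    cases M with
    | zero => rw [op_lof_of_lt f (by omega)]; exact Submodule.zero_mem _
    | succ m =>
      rw [op_lof f (m := m) (by omega)]
      exact lof_mem_letters _ _

theorem pos_mem {φ : ChainTot k A →ₗ[k] ChainTot k A} {N M : ℕ}
    (hφ : ∀ x ∈ letters k A N, φ x ∈ letters k A M) (i : ℤ) {x : ChainTot k A}
    (hx : x ∈ letters k A N) : pos i φ x ∈ letters k A M :=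
  lam_mem (hφ _ (lam_mem hx _)) _

theorem pos_op_mem (f : R.Cochain p) {N M : ℕ} (i : ℤ) {x : ChainTot k A}
    (hx : x ∈ letters k A N) (h : M + p = N + 1) : pos i (R.op p f) x ∈ letters k A M :=
  pos_mem (fun _ hx => op_mem f hx h) i hx

theorem pos_op_eq_zero (f : R.Cochain p) {N : ℕ} (i : ℤ) {x : ChainTot k A}
    (hx : x ∈ letters k A N) (h : N < p) : pos i (R.op p f) x = 0 := by
  rw [pos_apply, op_eq_zero f (lam_mem hx _) h, map_zero]

theorem pos_op_lof (f : R.Cochain p) {m n : ℕ} (h : m + p = n + 1) (i : ℕ) (hi : i < m + 1)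
    (y : Chain k A n) :
    pos i (R.op p f) (DirectSum.lof k ℕ (fun n => Chain k A n) n y) =
      Int.negOnePow (i * ((p : ℤ) - 1)) •
        DirectSum.lof k ℕ (fun n => Chain k A n) m (R.act h ⟨i, hi⟩ f y) := by
  induction i generalizing y with
  | zero =>
    rw [Nat.cast_zero, pos_zero, op_lof f h, zero_mul, Int.negOnePow_zero, one_smul]
  | succ i ih =>
    obtain ⟨z, hz⟩ := exists_lof_of_mem_letters (lam_mem (lof_mem_letters n y) (-1))
    have h1 := congrArg (lam k A 1) hz
    rw [lam_lam, lam_one_lof] at h1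
    have h2 : pos ((i + 1 : ℕ) : ℤ) (R.op p f) (DirectSum.lof k ℕ (fun n => Chain k A n) n y) =
        lam k A 1 (pos i (R.op p f) (lam k A (-1)
          (DirectSum.lof k ℕ (fun n => Chain k A n) n y))) := by
      rw [lam_pos, lam_lam]
      congr 2
      push_cast; ring_nf
    have h3 : y = Int.negOnePow n • cyc k A n z := by
      have := congrArg (fun w : ChainTot k A => w n) h1
      simp only [Int.add_right_neg, lam_zero, DirectSum.lof_apply] at this
      rw [this]
      simp only [Units.smul_def]
      rw [← map_zsmul, DirectSum.lof_apply]
    rw [h2, hz, ih (by omega), Units.smul_def, map_zsmul, lam_one_lof, cyc_act R _ i (by omega), h3,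
      ← Units.smul_def, smul_smul]
    simp only [Units.smul_def, map_zsmul, smul_smul, ← Units.val_mul, ← Int.negOnePow_add]
    congr 2
    -- The rotation has sign (-1)^n before `f` and (-1)^m after it, so each step to the right costs
    -- (-1)^(p-1).
    have : (n : ℤ) = m + p - 1 := by omega
    rw [this, Int.negOnePow_eq_iff]
    exact ⟨-p + 1, by push_cast; ring⟩

theorem chainTot_induction {C : ChainTot k A → Prop} (h0 : C 0)
    (hadd : ∀ x y, C x → C y → C (x + y))
    (h : ∀ (n : ℕ) (x), x ∈ letters k A (n + 1) → C x) (x : ChainTot k A) : C x := by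
  induction x using DirectSum.induction_on with
  | zero => exact h0
  | of n y => exact h n _ (lof_mem_letters n y)
  | add x y hx hy => exact hadd x y hx hy

theorem chainTot_hom_ext {E : Type*} [AddCommGroup E] [Module k E] {φ ψ : ChainTot k A →ₗ[k] E}
    (h : ∀ (n : ℕ) (x), x ∈ letters k A (n + 1) → φ x = ψ x) (x : ChainTot k A) : φ x = ψ x :=
  chainTot_induction (by simp) (fun x y hx hy => by rw [map_add, map_add, hx, hy]) h x

/-- The sign only undoes the one hidden in `pos`. When there are fewer than r letters, both sides
vanish, the right one because either `g` or then `f` lacks arguments. -/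
theorem op_comp (f : R.Cochain p) (g : R.Cochain q) {r : ℕ} (hc : p + q = r + 1) (i : ℕ)
    (hi : i < p) (x : ChainTot k A) :
    R.op r (R.comp hc ⟨i, hi⟩ f g) x =
      Int.negOnePow (i * ((q : ℤ) - 1)) • R.op p f (pos i (R.op q g) x) := by
  refine chainTot_hom_ext (φ := R.op r (R.comp hc ⟨i, hi⟩ f g))
    (ψ := ((Int.negOnePow (i * ((q : ℤ) - 1)) : ℤˣ) : ℤ) • (R.op p f ∘ₗ pos i (R.op q g)))
    (fun n x hx => ?_) x
  change _ = ((Int.negOnePow (i * ((q : ℤ) - 1)) : ℤˣ) : ℤ) • R.op p f (pos i (R.op q g) x)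
  by_cases h : n + 1 < r
  · rw [op_eq_zero _ hx h]
    by_cases h' : n + 1 < q
    · rw [pos_op_eq_zero _ _ hx h', map_zero, smul_zero]
    · rw [op_eq_zero f (pos_op_mem g (M := n + 2 - q) i hx (by omega)) (by omega), smul_zero]
  · obtain ⟨y, rfl⟩ := exists_lof_of_mem_letters hx
    rw [op_lof _ (m := n + 1 - r) (by omega), pos_op_lof g (m := n + 1 - q) (by omega) i (by omega),
      Units.smul_def, map_zsmul, op_lof f (m := n + 1 - r) (by omega), smul_smul, ← Units.val_mul,
      Int.units_mul_self, Units.val_one, one_smul]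
    exact congrArg _ (act_comp R _ _ _ hc i hi f g y).symm

/-- Operators of degrees p - 1 and q - 1 at disjoint places commute in the Koszul sense: the signs
carried by `pos` at p + r and at r + 1 differ by (-1)^((p-1)(q-1)). -/
theorem op_pos_disjoint (f : R.Cochain p) (g : R.Cochain q) {N : ℕ} (r : ℕ) (hr : p + q + r ≤ N)
    {x : ChainTot k A} (hx : x ∈ letters k A N) :
    R.op p f (pos (p + r) (R.op q g) x) = Int.negOnePow (((p : ℤ) - 1) * ((q : ℤ) - 1)) •
      pos (r + 1) (R.op q g) (R.op p f x) := by
  cases N with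
  | zero => simp [eq_zero_of_mem_letters_zero hx]
  | succ n =>
    obtain ⟨y, rfl⟩ := exists_lof_of_mem_letters hx
    have h1 := pos_op_lof g (m := n + 1 - q) (n := n) (by omega) (p + r) (by omega) y
    rw [Nat.cast_add] at h1
    have h2 := pos_op_lof g (m := n + 2 - p - q) (n := n + 1 - p) (by omega) (r + 1) (by omega)
      (R.act (p := p) (m := n + 1 - p) (n := n) (by omega) ⟨0, by omega⟩ f y)
    rw [Nat.cast_succ] at h2
    rw [h1, Units.smul_def, map_zsmul, op_lof f (m := n + 2 - p - q) (n := n + 1 - q) (by omega),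
      op_lof f (m := n + 1 - p) (by omega), h2, smul_smul,
      act_act R (m₂ := n + 1 - p) _ _ (by omega) (by omega) r (by omega), ← Units.smul_def,
      ← Int.negOnePow_add]
    congr 1
    rw [Int.negOnePow_eq_iff]
    exact ⟨0, by ring⟩

variable (R)

/-- The product, as an operator on the first two letters. -/
abbrev opMul : ChainTot k A →ₗ[k] ChainTot k A := R.op 2 R.mulCochain

/-- The operator that puts a unit in front. -/
abbrev opOne : ChainTot k A →ₗ[k] ChainTot k A := R.op 0 R.oneCochain

theorem opMul_opOne (x : ChainTot k A) : R.opMul (R.opOne x) = x := by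
  refine chainTot_hom_ext (φ := R.opMul ∘ₗ R.opOne) (ψ := LinearMap.id) (fun n x hx => ?_) x
  obtain ⟨y, rfl⟩ := exists_lof_of_mem_letters hx
  rw [LinearMap.comp_apply, op_lof (p := 0) _ (m := n + 1) rfl,
    op_lof (p := 2) _ (m := n) rfl, act_mul_act_one]
  rfl

theorem comp_mul_mul :
    R.comp (p := 2) (q := 2) (r := 3) rfl ⟨0, by omega⟩ R.mulCochain R.mulCochain =
      R.comp (p := 2) (q := 2) (r := 3) rfl ⟨1, by omega⟩ R.mulCochain R.mulCochain := by
  refine R.toMultilinear_injective fun a => ?_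
  have h := R.hom_assoc (a 0) (a 1) (a 2)
  rw [← R.tw_one, ← R.tw_one] at h
  exact h

/-- Hom-associativity says that the two partial compositions of the product with itself agree. As
the product is an odd operator, this becomes an anticommutation. -/
theorem opMul_assoc (x : ChainTot k A) :
    R.opMul (pos 1 R.opMul x) = -R.opMul (R.opMul x) := by
  have h0 := op_comp R.mulCochain R.mulCochain (r := 3) rfl 0 (by omega) x
  have h1 := op_comp R.mulCochain R.mulCochain (r := 3) rfl 1 (by omega) x
  rw [comp_mul_mul, h1] at h0
  have h2 : R.opMul (R.opMul x) = -R.opMul (pos 1 R.opMul x) := by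
    simpa [opMul, Int.negOnePow_succ, pos_zero] using h0.symm
  rw [h2, neg_neg]

variable {R}

theorem op_injective {f g : R.Cochain p} (h : ∀ x, R.op p f x = R.op p g x) : f = g := by
  refine R.cochain_ext fun y => ?_
  have := h (DirectSum.lof k ℕ (fun n => Chain k A n) p y)
  rw [op_lof f (m := 1) (by omega), op_lof g (m := 1) (by omega)] at this
  exact DirectSum.of_injective _ this

end RegUnitalHomAssoc
end HomHochschild
end

noncomputable section

namespace HomHochschild

/-! ## Calculus of operators -/

/-! ### Sums over positions and over rotations -/

section Sums

variable {k A : Type*} [CommRing k] [AddCommGroup A] [Module k A]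

/-- The sum of the operators `φ` at the first `n` positions. -/
def posSum (n : ℕ) (φ : ChainTot k A →ₗ[k] ChainTot k A) : ChainTot k A →ₗ[k] ChainTot k A :=
  ∑ i ∈ Finset.range n, pos i φ

theorem posSum_apply (n : ℕ) (φ : ChainTot k A →ₗ[k] ChainTot k A) (x : ChainTot k A) :
    posSum n φ x = ∑ i ∈ Finset.range n, pos i φ x := by
  rw [posSum, LinearMap.sum_apply]

theorem posSum_zero (φ : ChainTot k A →ₗ[k] ChainTot k A) (x : ChainTot k A) :
    posSum 0 φ x = 0 := by
  rw [posSum_apply, Finset.sum_range_zero]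

theorem posSum_succ' (n : ℕ) (φ : ChainTot k A →ₗ[k] ChainTot k A) (x : ChainTot k A) :
    posSum (n + 1) φ x = φ x + ∑ i ∈ Finset.range n, pos (i + 1) φ x := by
  rw [posSum_apply, Finset.sum_range_succ', add_comm]
  push_cast
  rfl

variable (k A) in
/-- The sum of the first `N` powers of the signed cyclic operator. -/
def norm (N : ℕ) : ChainTot k A →ₗ[k] ChainTot k A := ∑ i ∈ Finset.range N, lam k A i

theorem norm_apply (N : ℕ) (x : ChainTot k A) :
    norm k A N x = ∑ i ∈ Finset.range N, lam k A i x := by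
  rw [norm, LinearMap.sum_apply]

theorem norm_mem {N : ℕ} {x : ChainTot k A} (hx : x ∈ letters k A N) (M : ℕ) :
    norm k A M x ∈ letters k A N := by
  rw [norm_apply]
  exact Submodule.sum_mem _ fun i _ => lam_mem hx _

theorem posSum_mem {N M : ℕ} {φ : ChainTot k A →ₗ[k] ChainTot k A}
    (hφ : ∀ x ∈ letters k A N, φ x ∈ letters k A M) (n : ℕ) {x : ChainTot k A}
    (hx : x ∈ letters k A N) : posSum n φ x ∈ letters k A M := by
  rw [posSum_apply]
  exact Submodule.sum_mem _ fun i _ => RegUnitalHomAssoc.pos_mem hφ _ hx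

theorem lam_one_norm {N : ℕ} {x : ChainTot k A} (hx : x ∈ letters k A N) :
    lam k A 1 (norm k A N x) = norm k A N x := by
  have h1 := Finset.sum_range_succ (fun i : ℕ => lam k A i x) N
  rw [Finset.sum_range_succ', lam_period hx] at h1
  rw [norm_apply, map_sum]
  simp only [lam_lam]
  rw [← add_right_cancel_iff, ← h1]
  simp only [Nat.cast_zero, lam_zero]
  push_cast
  simp only [add_comm]

theorem norm_lam_one {N : ℕ} {x : ChainTot k A} (hx : x ∈ letters k A N) :
    norm k A N (lam k A 1 x) = norm k A N x := by
  rw [← lam_one_norm hx, norm_apply, norm_apply, map_sum]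
  simp only [lam_lam, add_comm]

/-- The image of the norm is rotation invariant because the exponents run over a full period. -/
theorem lam_norm {N : ℕ} {x : ChainTot k A} (hx : x ∈ letters k A N) (i : ℤ) :
    lam k A i (norm k A N x) = norm k A N x := by
  induction i using Int.induction_on with
  | zero => rfl
  | succ i ih => rw [← lam_lam, lam_one_norm hx, ih]
  | pred i ih =>
    conv_lhs => rw [← lam_one_norm hx, lam_lam]
    rw [sub_add_cancel, ih]

theorem norm_lam {N : ℕ} {x : ChainTot k A} (hx : x ∈ letters k A N) (i : ℤ) :
    norm k A N (lam k A i x) = norm k A N x := by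
  rw [← lam_norm hx i, norm_apply, norm_apply, map_sum]
  simp only [lam_lam, add_comm]

theorem sum_lam_neg {N : ℕ} {x : ChainTot k A} (hx : x ∈ letters k A N) :
    ∑ i ∈ Finset.range N, lam k A (-(i : ℤ)) x = norm k A N x := by
  rw [← norm_lam hx 1, norm_apply, ← Finset.sum_range_reflect]
  refine Finset.sum_congr rfl fun i hi => ?_
  rw [Finset.mem_range] at hi
  rw [lam_lam]
  refine (lam_add_period hx ?_).symm
  push_cast [Nat.sub_sub, Nat.cast_sub (show 1 + i ≤ N by omega)]
  ring

theorem pos_comp (i : ℤ) (φ ψ : ChainTot k A →ₗ[k] ChainTot k A) (x : ChainTot k A) :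
    pos i (φ ∘ₗ ψ) x = pos i φ (pos i ψ x) := by
  rw [pos_pos, sub_self]
  rfl

theorem pos_add_comp (i j : ℤ) (φ ψ : ChainTot k A →ₗ[k] ChainTot k A) (x : ChainTot k A) :
    pos i φ (pos (i + j) ψ x) = pos i (φ ∘ₗ pos j ψ) x := by
  rw [pos_pos, add_sub_cancel_left]

end Sums

namespace RegUnitalHomAssoc

variable {k A : Type*} [CommRing k] [AddCommGroup A] [Module k A] {R : RegUnitalHomAssoc k A}
  {p q : ℕ}

/-- The sign `(-1)^(p-1)`. -/
def sgn (p : ℕ) : ℤˣ := Int.negOnePow ((p : ℤ) - 1)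

/-- The sign `(-1)^((p-1)(q-1))`. -/
def sgn₂ (p q : ℕ) : ℤˣ := Int.negOnePow (((p : ℤ) - 1) * ((q : ℤ) - 1))

theorem sgn_succ (p : ℕ) : sgn (p + 1) = -sgn p := by
  rw [sgn, sgn, Nat.cast_succ, add_sub_right_comm, Int.negOnePow_succ]

theorem sgn₂_two_left (q : ℕ) : sgn₂ 2 q = sgn q := by
  rw [sgn, sgn₂]; congr 1; push_cast; ring

theorem sgn₂_two_right (q : ℕ) : sgn₂ q 2 = sgn q := by
  rw [sgn, sgn₂]; congr 1; push_cast; ring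

theorem sgn₂_comm (p q : ℕ) : sgn₂ p q = sgn₂ q p := by
  rw [sgn₂, sgn₂, mul_comm]

theorem map_sign {M M' : Type*} [AddCommGroup M] [AddCommGroup M'] [Module k M] [Module k M']
    (φ : M →ₗ[k] M') (u : ℤˣ) (x : M) : φ (u • x) = u • φ x := by
  rw [Units.smul_def, Units.smul_def, map_zsmul]

theorem opMul_mem {N : ℕ} {x : ChainTot k A} (hx : x ∈ letters k A (N + 1)) :
    R.opMul x ∈ letters k A N := op_mem _ hx rfl

theorem opMul_eq_zero {N : ℕ} {x : ChainTot k A} (hx : x ∈ letters k A N) (h : N < 2) :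
    R.opMul x = 0 := op_eq_zero _ hx h

theorem posSum_opMul_mem {N M n : ℕ} {x : ChainTot k A} (hx : x ∈ letters k A N)
    (h : N = M + 1) : posSum n R.opMul x ∈ letters k A M := by
  subst h
  exact posSum_mem (fun _ => opMul_mem) _ hx

/-- b = b' + μλ: the wrap-around term sits at position M, where λ^M is trivial on the M letters of
the result and λ^(-M) = λ on the M + 1 letters of the argument. -/
theorem posSum_opMul_succ {M : ℕ} {x : ChainTot k A} (hx : x ∈ letters k A (M + 1)) :
    posSum (M + 1) R.opMul x = posSum M R.opMul x + R.opMul (lam k A 1 x) := by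
  rw [posSum_apply, Finset.sum_range_succ, ← posSum_apply, pos_apply,
    lam_period (opMul_mem (lam_mem hx _))]
  congr 2
  exact (lam_add_period hx (by push_cast; ring)).symm

theorem lam_one_posSum_opMul {M : ℕ} (x : ChainTot k A) :
    lam k A 1 (posSum M R.opMul x) =
      posSum (M + 1) R.opMul (lam k A 1 x) - R.opMul (lam k A 1 x) := by
  rw [posSum_succ', add_sub_cancel_left, posSum_apply, map_sum]
  simp only [lam_pos, add_comm]

/-- `b (1 - λ) = (1 - λ) b'`. -/
theorem posSum_opMul_sub_lam {M : ℕ} {x : ChainTot k A} (hx : x ∈ letters k A (M + 1)) :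
    posSum (M + 1) R.opMul (x - lam k A 1 x) =
      posSum M R.opMul x - lam k A 1 (posSum M R.opMul x) := by
  rw [lam_one_posSum_opMul, map_sub, posSum_opMul_succ hx]
  abel

/-- `N b = b' N`. -/
theorem norm_posSum_opMul {M : ℕ} {x : ChainTot k A} (hx : x ∈ letters k A (M + 1)) :
    norm k A M (posSum (M + 1) R.opMul x) = posSum M R.opMul (norm k A (M + 1) x) := by
  have h1 : ∀ i : ℤ, norm k A M (pos i R.opMul x) = norm k A M (R.opMul (lam k A (-i) x)) :=
    fun i => norm_lam (opMul_mem (lam_mem hx _)) i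
  have h2 : ∀ i : ℤ, pos i R.opMul (norm k A (M + 1) x) =
      lam k A i (R.opMul (norm k A (M + 1) x)) := fun i => by
    rw [pos_apply, lam_norm hx]
  rw [posSum_apply, posSum_apply, map_sum]
  simp only [h1, h2]
  rw [← norm_apply, ← map_sum, ← map_sum, sum_lam_neg hx]

theorem opOne_mem {N : ℕ} {x : ChainTot k A} (hx : x ∈ letters k A N) :
    R.opOne x ∈ letters k A (N + 1) := op_mem _ hx rfl

/-- `b' E + E b' = 1`. -/
theorem posSum_opMul_opOne {M : ℕ} {x : ChainTot k A} (hx : x ∈ letters k A (M + 1)) :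
    posSum (M + 1) R.opMul (R.opOne x) = x - R.opOne (posSum M R.opMul x) := by
  rw [posSum_succ', opMul_opOne, posSum_apply, map_sum, sub_eq_add_neg, ← Finset.sum_neg_distrib]
  congr 1
  refine Finset.sum_congr rfl fun r hr => ?_
  rw [Finset.mem_range] at hr
  -- The term at position 0 is μE = 1. Every later product avoids the new unit and so anticommutes
  -- with E.
  have h := op_pos_disjoint R.oneCochain R.mulCochain r (by omega) hx
  have h1 : Int.negOnePow ((((0 : ℕ) : ℤ) - 1) * (((2 : ℕ) : ℤ) - 1)) = -1 := rfl
  rw [h1, Nat.cast_zero, zero_add, Units.neg_smul, one_smul] at h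
  rw [h, neg_neg]

/-- Insertion of `g` into the result of `f`. -/
theorem posSum_op_op (f : R.Cochain p) (g : R.Cochain q) {N s : ℕ} (hs : s + p + q = N + 1)
    {x : ChainTot k A} (hx : x ∈ letters k A N) :
    posSum (s + 1) (R.op q g) (R.op p f x) = R.op q g (R.op p f x) +
      sgn₂ p q • (R.op p f (posSum (p + s) (R.op q g) x) -
        R.op p f (posSum p (R.op q g) x)) := by
  rw [posSum_succ', posSum_apply (p + s), Finset.sum_range_add, map_add, ← posSum_apply,
    add_sub_cancel_left, map_sum, Finset.smul_sum]
  congr 1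
  refine Finset.sum_congr rfl fun r hr => ?_
  rw [Finset.mem_range] at hr
  rw [Nat.cast_add, op_pos_disjoint f g r (by omega) hx, smul_smul, sgn₂, Int.units_mul_self,
    one_smul]

/-- The product of the first letter with the value of `f` on the following ones. -/
def mulOp (f : R.Cochain p) : ChainTot k A →ₗ[k] ChainTot k A := R.opMul ∘ₗ pos 1 (R.op p f)

theorem mulOp_apply (f : R.Cochain p) (x : ChainTot k A) :
    mulOp f x = R.opMul (pos 1 (R.op p f) x) := rfl

/-- The operator of the (signed) coboundary of `f`. -/
def dOp (f : R.Cochain p) : ChainTot k A →ₗ[k] ChainTot k A :=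
  R.opMul ∘ₗ R.op p f + mulOp f - ((sgn p : ℤˣ) : ℤ) • (R.op p f ∘ₗ posSum p R.opMul)

theorem dOp_apply (f : R.Cochain p) (x : ChainTot k A) :
    dOp f x = R.opMul (R.op p f x) + mulOp f x - sgn p • R.op p f (posSum p R.opMul x) := rfl

theorem mulOp_mem (f : R.Cochain p) {N M : ℕ} (h : M + p = N) {x : ChainTot k A}
    (hx : x ∈ letters k A N) : mulOp f x ∈ letters k A M :=
  opMul_mem (pos_op_mem f 1 hx (by omega))

theorem op_opMul_eq_zero (f : R.Cochain p) {N : ℕ} (h : N ≤ p) {x : ChainTot k A}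
    (hx : x ∈ letters k A N) {y : ChainTot k A} (hy : y ∈ letters k A (N - 1)) :
    R.op p f y = 0 := by
  cases N with
  | zero => rw [eq_zero_of_mem_letters_zero hy, map_zero]
  | succ n => exact op_eq_zero f hy (by omega)

theorem posSum_opMul_mem' {N n : ℕ} {x : ChainTot k A} (hx : x ∈ letters k A N) :
    posSum n R.opMul x ∈ letters k A (N - 1) := by
  cases N with
  | zero => rw [eq_zero_of_mem_letters_zero hx, map_zero]; exact Submodule.zero_mem _
  | succ n => exact posSum_opMul_mem hx rfl

theorem opMul_op_eq_zero (f : R.Cochain p) {N : ℕ} (h : N ≤ p) {x : ChainTot k A}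
    (hx : x ∈ letters k A N) : R.opMul (R.op p f x) = 0 := by
  by_cases h' : N < p
  · rw [op_eq_zero f hx h', map_zero]
  · exact opMul_eq_zero (op_mem f (M := 1) hx (by omega)) (by omega)

theorem mulOp_eq_zero (f : R.Cochain p) {N : ℕ} (h : N ≤ p) {x : ChainTot k A}
    (hx : x ∈ letters k A N) : mulOp f x = 0 := by
  by_cases h' : N < p
  · rw [mulOp_apply, pos_op_eq_zero f _ hx h', map_zero]
  · exact opMul_eq_zero (pos_op_mem f (M := 1) 1 hx (by omega)) (by omega)

theorem op_posSum_eq_zero (f : R.Cochain p) {N n : ℕ} (h : N ≤ p) {x : ChainTot k A}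
    (hx : x ∈ letters k A N) : R.op p f (posSum n R.opMul x) = 0 :=
  op_opMul_eq_zero f h hx (posSum_opMul_mem' hx)

/-- The coboundary takes p + 1 arguments, and each of its three terms already vanishes for lack of
letters. This lets the commutator formulas hold for every N despite truncated subtraction. -/
theorem dOp_eq_zero (f : R.Cochain p) {N : ℕ} (h : N ≤ p) {x : ChainTot k A}
    (hx : x ∈ letters k A N) : dOp f x = 0 := by
  rw [dOp_apply, opMul_op_eq_zero f h hx, mulOp_eq_zero f h hx, op_posSum_eq_zero f h hx]
  simp

theorem dOp_mem (f : R.Cochain p) {N M : ℕ} (h : M + p = N) {x : ChainTot k A}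
    (hx : x ∈ letters k A N) : dOp f x ∈ letters k A M := by
  cases N with
  | zero => rw [eq_zero_of_mem_letters_zero hx, map_zero]; exact Submodule.zero_mem _
  | succ n =>
    have h1 : R.opMul (R.op p f x) ∈ letters k A M := opMul_mem (op_mem f hx (by omega))
    have h2 : R.op p f (posSum p R.opMul x) ∈ letters k A M :=
      op_mem f (posSum_opMul_mem hx rfl) (by omega)
    have h3 : sgn p • R.op p f (posSum p R.opMul x) ∈ letters k A M := by
      rw [Units.smul_def]; exact zsmul_mem h2 _
    exact Submodule.sub_mem _ (Submodule.add_mem _ h1 (mulOp_mem f h hx)) h3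

/-- The commutator of `f` with `b'`. -/
theorem posSum_opMul_op (f : R.Cochain p) {N : ℕ} {x : ChainTot k A} (hx : x ∈ letters k A N) :
    posSum (N - p) R.opMul (R.op p f x) =
      sgn p • R.op p f (posSum (N - 1) R.opMul x) - mulOp f x + dOp f x := by
  by_cases h : N ≤ p
  · rw [dOp_eq_zero f h hx, mulOp_eq_zero f h hx, op_posSum_eq_zero f h hx,
      Nat.sub_eq_zero_of_le h, posSum_zero]
    simp
  · obtain ⟨s, rfl⟩ : ∃ s, N = s + 1 + p := ⟨N - p - 1, by omega⟩
    -- Products behind the value of `f` commute past `f`. The remaining ones, touching the slot of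
    -- `f`, are collected by the definition of `dOp`.
    have h1 := posSum_op_op f R.mulCochain (s := s) (by omega) hx
    rw [Nat.add_sub_cancel, h1, dOp_apply, sgn₂_two_right,
      show s + 1 + p - 1 = p + s by omega, smul_sub]
    abel

theorem mulOp_lam_one (f : R.Cochain p) (x : ChainTot k A) :
    mulOp f (lam k A 1 x) = R.opMul (lam k A 1 (R.op p f x)) := by
  rw [mulOp_apply, pos_apply, lam_lam]
  rfl

/-- The commutator of `f` with `b`. -/
theorem posSum_opMul_op' (f : R.Cochain p) {N : ℕ} {x : ChainTot k A} (hx : x ∈ letters k A N) :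
    posSum (N + 1 - p) R.opMul (R.op p f x) =
      sgn p • R.op p f (posSum (N - 1) R.opMul x) - mulOp f x + dOp f x +
        mulOp f (lam k A 1 x) := by
  rw [← posSum_opMul_op f hx, mulOp_lam_one]
  by_cases h : N < p
  · rw [op_eq_zero f hx h]
    simp
  · rw [Nat.sub_add_comm (by omega), posSum_opMul_succ (op_mem f hx (by omega))]

theorem opMul_opMul (x : ChainTot k A) :
    R.opMul (R.opMul x) = -R.opMul (pos 1 R.opMul x) := by
  rw [opMul_assoc, neg_neg]

/-- Associativity in the form (a_0 a_1) f(a_2, …) = a_0 (a_1 f(a_2, …)). -/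
theorem mulOp_opMul (f : R.Cochain p) {N : ℕ} (hN : p + 2 ≤ N) {x : ChainTot k A}
    (hx : x ∈ letters k A N) :
    mulOp f (R.opMul x) = -(sgn p • R.opMul (pos 1 (mulOp f) x)) := by
  have h := op_pos_disjoint R.mulCochain f 0 (by omega) hx
  have h2 : Int.negOnePow ((((2 : ℕ) : ℤ) - 1) * ((p : ℤ) - 1)) = sgn p := by
    rw [← sgn₂_two_left, sgn₂]
  rw [Nat.cast_zero, add_zero, zero_add, h2] at h
  have h3 : pos 1 (R.op p f) (R.opMul x) =
      sgn p • R.opMul (pos (2 : ℕ) (R.op p f) x) := by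
    rw [opMul, h, smul_smul, Int.units_mul_self, one_smul]
  rw [mulOp_apply, h3, map_sign, opMul_opMul, smul_neg, mulOp, ← pos_add_comp]
  rfl

/-- This is a_0 times the coboundary of `f` on the following letters. The two extreme products are
reassociated, and the inner ones are the sum appearing in `dOp`. -/
theorem mulOp_posSum (f : R.Cochain p) {N : ℕ} (hN : p + 2 ≤ N) {x : ChainTot k A}
    (hx : x ∈ letters k A N) :
    R.opMul (mulOp f x) + sgn p • mulOp f (posSum (p + 1) R.opMul x) =
      -R.opMul (pos 1 (dOp f) x) := by
  have h1 : ∀ i : ℕ, mulOp f (pos (i + 1) R.opMul x) =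
      R.opMul (pos 1 (R.op p f ∘ₗ pos i R.opMul) x) := fun i => by
    rw [mulOp_apply, add_comm, pos_add_comp]
  have h2 : mulOp f (∑ i ∈ Finset.range p, pos (i + 1) R.opMul x) =
      R.opMul (pos 1 (R.op p f ∘ₗ posSum p R.opMul) x) := by
    rw [map_sum]
    simp only [h1]
    rw [← map_sum]
    simp only [pos_apply, LinearMap.comp_apply, posSum_apply, map_sum]
  have h3 : R.opMul (mulOp f x) = -R.opMul (pos 1 (R.opMul ∘ₗ R.op p f) x) := by
    rw [mulOp_apply, opMul_opMul, pos_comp]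
  rw [posSum_succ', map_add, h2, mulOp_opMul f hN hx, h3]
  simp only [pos_apply, dOp_apply, map_add, map_sub, map_sign, LinearMap.comp_apply]
  rw [smul_add, smul_neg, smul_smul, Int.units_mul_self, one_smul]
  abel

/-- The operator of the product with `f` as an honest cochain. -/
theorem op_comp_mul (f : R.Cochain p) {r : ℕ} (h : 2 + p = r + 1) (x : ChainTot k A) :
    R.op r (R.comp (p := 2) h ⟨1, by omega⟩ R.mulCochain f) x = sgn p • mulOp f x := by
  rw [op_comp, Nat.cast_one, _root_.one_mul]
  rfl

/-- The commutator of `mulOp f` with `b'`. -/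
theorem posSum_opMul_mulOp (f : R.Cochain p) {N : ℕ} {x : ChainTot k A}
    (hx : x ∈ letters k A N) :
    posSum (N - (p + 1)) R.opMul (mulOp f x) =
      -(sgn p • mulOp f (posSum (N - 1) R.opMul x)) - R.opMul (pos 1 (dOp f) x) := by
  -- The product a_0 · f(a_1, …) is itself a cochain of degree p + 1, so its commutator with b' is
  -- known; `mulOp_posSum` then identifies its coboundary terms.
  have h := posSum_opMul_op (R.comp (p := 2) (r := p + 1) (by omega) ⟨1, by omega⟩ R.mulCochain f)
    hx
  by_cases hN : p + 2 ≤ N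
  · have h2 := mulOp_posSum f hN hx
    have h5 : ∀ x, mulOp (R.comp (p := 2) (r := p + 1) (by omega) ⟨1, by omega⟩ R.mulCochain f) x =
        sgn p • R.opMul (pos 1 (mulOp f) x) := fun x => by
      rw [mulOp_apply, pos_apply, op_comp_mul, map_sign, map_sign]
      rfl
    rw [dOp_apply, h5] at h
    simp only [op_comp_mul, map_sign, sgn_succ] at h
    rcases Int.units_eq_one_or (sgn p) with hs | hs <;>
    simp only [hs, one_smul, Units.neg_smul, neg_neg] at h h2 ⊢
    · linear_combination (norm := module) h + h2
    · linear_combination (norm := module) h2 - h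
  · have h3 : R.opMul (pos 1 (dOp f) x) = 0 := by
      by_cases hNp : N ≤ p
      · have hx' := lam_mem hx (-1)
        rw [pos_apply, dOp_eq_zero f hNp hx', map_zero, map_zero]
      · have h' : pos 1 (dOp f) x ∈ letters k A 1 :=
          pos_mem (fun y hy => dOp_mem f (by omega) hy) 1 hx
        exact opMul_eq_zero h' (by omega)
    have h4 : mulOp f (posSum (N - 1) R.opMul x) = 0 :=
      mulOp_eq_zero f (by omega) (posSum_opMul_mem' hx)
    rw [h3, h4, Nat.sub_eq_zero_of_le (by omega), posSum_zero]
    simp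

/-- The commutator of `mulOp f` with `b`. -/
theorem posSum_opMul_mulOp' (f : R.Cochain p) {N : ℕ} {x : ChainTot k A}
    (hx : x ∈ letters k A N) :
    posSum (N - p) R.opMul (mulOp f x) =
      -(sgn p • mulOp f (posSum N R.opMul x)) - R.opMul (pos 1 (dOp f) x) := by
  have h := posSum_opMul_mulOp f hx
  by_cases hN : p + 2 ≤ N
  · obtain ⟨s, rfl⟩ : ∃ s, N = s + 1 + p := ⟨N - p - 1, by omega⟩
    -- Passing from b' to b adds one wrap-around term on each side; these two cancel by
    -- associativity.
    have h1 : R.opMul (lam k A 1 (mulOp f x)) + sgn p • mulOp f (R.opMul (lam k A 1 x)) = 0 := by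
      rw [mulOp_opMul f hN (lam_mem hx 1), pos_lam, sub_self, smul_neg, smul_smul,
        Int.units_mul_self, one_smul, pos_zero, add_neg_cancel]
    rw [Nat.add_sub_cancel, posSum_opMul_succ (mulOp_mem f rfl hx),
      show s + 1 + p = s + p + 1 by omega,
      posSum_opMul_succ (by rwa [show s + p + 1 = s + 1 + p by omega]), map_add, smul_add]
    rw [show s + 1 + p - (p + 1) = s by omega, show s + 1 + p - 1 = s + p by omega] at h
    rw [h, eq_neg_of_add_eq_zero_left h1]
    abel
  · have h3 : ∀ n : ℕ, mulOp f (posSum n R.opMul x) = 0 := fun n =>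
      mulOp_eq_zero f (by omega) (posSum_opMul_mem' hx)
    rw [h3] at h ⊢
    rw [← h, Nat.sub_eq_zero_of_le (show N ≤ p + 1 by omega), posSum_zero, posSum_apply]
    refine Finset.sum_eq_zero fun i _ => ?_
    by_cases hNp : N ≤ p
    · rw [mulOp_eq_zero f hNp hx, map_zero]
    · rw [pos_apply, opMul_eq_zero (lam_mem (mulOp_mem f (M := 1) (by omega) hx) _) (by omega),
        map_zero]

/-- Reassociates a_0 g(…) f(…). The cases with few letters are separate because `mulOp_opMul` needs
both slots to be filled. -/
theorem mulOp_mulOp (f : R.Cochain p) (g : R.Cochain q) (x : ChainTot k A) :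
    mulOp f (mulOp g x) = -(sgn p • R.opMul (pos 1 (mulOp f ∘ₗ R.op q g) x)) := by
  refine chainTot_hom_ext (φ := mulOp f ∘ₗ mulOp g)
    (ψ := -(((sgn p : ℤˣ) : ℤ) • (R.opMul ∘ₗ pos 1 (mulOp f ∘ₗ R.op q g)))) (fun n x hx => ?_) x
  change mulOp f (mulOp g x) = -(sgn p • R.opMul (pos 1 (mulOp f ∘ₗ R.op q g) x))
  have hx' := lam_mem hx (-1)
  by_cases hN : n + 1 < q
  · rw [mulOp_eq_zero g (by omega) hx, pos_apply, LinearMap.comp_apply, op_eq_zero g hx' hN]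
    simp
  · have hy : pos 1 (R.op q g) x ∈ letters k A (n + 2 - q) := pos_op_mem g 1 hx (by omega)
    by_cases hN : p + 2 ≤ n + 2 - q
    · rw [mulOp_apply g, mulOp_opMul f hN hy, pos_comp]
    · have h1 : R.opMul (pos 1 (R.op q g) x) ∈ letters k A (n + 1 - q) :=
        opMul_mem (by rwa [← Nat.sub_add_comm (by omega)])
      rw [mulOp_apply g, mulOp_eq_zero f (by omega) h1, pos_apply, LinearMap.comp_apply]
      have hy' : R.op q g (lam k A (-1) x) ∈ letters k A (n + 2 - q) := op_mem g hx' (by omega)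
      by_cases hN' : n + 2 - q ≤ p
      · rw [mulOp_eq_zero f hN' hy']
        simp
      · rw [opMul_eq_zero (lam_mem (mulOp_mem f (M := 1) (by omega) hy') _) (by omega)]
        simp

/-! ### Cup products -/

theorem op_cup (f : R.Cochain p) (g : R.Cochain q) (x : ChainTot k A) :
    R.op (p + q) (R.cup p q f g) x = sgn p • mulOp f (R.op q g x) := by
  have h := op_comp (p := p + 1) (q := q) (r := p + q)
    (R.comp (p := 2) (r := p + 1) (by omega) ⟨1, by omega⟩ R.mulCochain f) g (by omega) 0
    (by omega) x
  rw [Nat.cast_zero, zero_mul, Int.negOnePow_zero, one_smul, pos_zero, op_comp_mul] at h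
  exact h

/-- Capping is an action of the cup product; the sign disappears once `mulOp` is rescaled by `sgn`,
since `sgn_add` carries the same sign. -/
theorem mulOp_cup (f : R.Cochain p) (g : R.Cochain q) (x : ChainTot k A) :
    mulOp (R.cup p q f g) x = -mulOp f (mulOp g x) := by
  rw [mulOp_mulOp, neg_neg, mulOp_apply, pos_apply, op_cup, map_sign, map_sign]
  rfl

/-- The cup product is associative on cochains. -/
theorem op_cup_assoc {r : ℕ} (f : R.Cochain p) (g : R.Cochain q) (h : R.Cochain r)
    (x : ChainTot k A) :
    R.op (p + q + r) (R.cup (p + q) r (R.cup p q f g) h) x =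
      R.op (p + (q + r)) (R.cup p (q + r) f (R.cup q r g h)) x := by
  rw [op_cup, op_cup, op_cup, mulOp_cup, map_sign, smul_smul]
  have : sgn (p + q) = -(sgn p * sgn q) := by
    simp only [sgn, ← Int.negOnePow_add, ← Int.negOnePow_succ]
    congr 1
    push_cast; ring
  rw [this, Units.neg_smul, smul_neg, neg_neg]

theorem sgn_add (p q : ℕ) : sgn (p + q) = -(sgn p * sgn q) := by
  simp only [sgn, ← Int.negOnePow_add, ← Int.negOnePow_succ]
  congr 1
  push_cast; ring

/-- The coboundary of a cup product. -/
theorem dOp_cup (f : R.Cochain p) (g : R.Cochain q) (x : ChainTot k A) :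
    dOp (R.cup p q f g) x =
      -mulOp f (dOp g x) - sgn p • R.opMul (pos 1 (dOp f) (R.op q g x)) := by
  refine chainTot_hom_ext (φ := dOp (R.cup p q f g))
    (ψ := -(mulOp f ∘ₗ dOp g) - ((sgn p : ℤˣ) : ℤ) • (R.opMul ∘ₗ pos 1 (dOp f) ∘ₗ R.op q g))
    (fun n x hx => ?_) x
  change _ = -mulOp f (dOp g x) - sgn p • R.opMul (pos 1 (dOp f) (R.op q g x))
  -- The commutator of b' with f ∪ g is computed in two ways: for f ∪ g as one cochain, and for the
  -- composite of `mulOp f` with `g`. Comparison isolates the coboundary of f ∪ g.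
  have h1 := posSum_opMul_op (R.cup p q f g) hx
  by_cases hq : n + 1 < q
  · rw [dOp_eq_zero _ (by omega) hx, dOp_eq_zero g (by omega) hx, op_eq_zero g hx hq]
    simp
  have hy : R.op q g x ∈ letters k A (n + 2 - q) := op_mem g hx (by omega)
  have h2 := posSum_opMul_mulOp f hy
  have h3 := posSum_opMul_op g hx
  rw [show n + 2 - q - (p + 1) = n + 1 - (p + q) by omega,
    show n + 2 - q - 1 = n + 1 - q by omega, h3] at h2
  rw [op_cup, op_cup, map_sign, h2, mulOp_cup, sgn_add] at h1
  simp only [map_sub, map_add, map_sign] at h1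
  rcases Int.units_eq_one_or (sgn p) with hs | hs <;>
  rcases Int.units_eq_one_or (sgn q) with hs' | hs' <;>
  simp only [hs, hs', one_smul, Units.neg_smul, neg_neg, _root_.one_mul, neg_mul] at h1 ⊢ <;>
  linear_combination (norm := module) -h1

/-- The operator of the coboundary. -/
theorem op_coboundary (f : R.Cochain p) (x : ChainTot k A) :
    R.op (p + 1) (R.coboundary p f) x = sgn p • dOp f x := by
  have h1 : R.coboundary p f = R.comp (p := 2) (by omega) ⟨1, by omega⟩ R.mulCochain f
    + ∑ i : Fin p, Int.negOnePow ((i : ℤ) + 1) •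
      R.comp (p := p) (q := 2) (r := p + 1) (by omega) i f R.mulCochain
    + Int.negOnePow ((p : ℤ) + 1) • R.comp (p := 2) (by omega) ⟨0, by omega⟩ R.mulCochain f := by
    rw [coboundary, LinearMap.add_apply, LinearMap.add_apply, LinearMap.sum_apply]
    rfl
  have h2 : ∀ i : Fin p, R.op (p + 1) (Int.negOnePow ((i : ℤ) + 1) •
      R.comp (p := p) (q := 2) (r := p + 1) (by omega) i f R.mulCochain) x =
      -R.op p f (pos i R.opMul x) := fun i => by
    rw [map_sign, Units.smul_def, LinearMap.smul_apply, ← Units.smul_def]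
    have := op_comp f R.mulCochain (r := p + 1) (by omega) i i.2 x
    rw [this, smul_smul, ← Int.negOnePow_add, show (i : ℤ) + 1 + (i : ℕ) * ((2 : ℕ) - 1 : ℤ) =
      2 * i + 1 by push_cast; ring, Int.negOnePow_two_mul_add_one, Units.neg_smul, one_smul]
  have h3 : R.op (p + 1) (Int.negOnePow ((p : ℤ) + 1) •
      R.comp (p := 2) (r := p + 1) (by omega) ⟨0, by omega⟩ R.mulCochain f) x =
      sgn p • R.opMul (R.op p f x) := by
    rw [map_sign, Units.smul_def, LinearMap.smul_apply, ← Units.smul_def, op_comp, Nat.cast_zero,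
      zero_mul, Int.negOnePow_zero, one_smul, pos_zero]
    congr 1
    rw [sgn, Int.negOnePow_eq_iff]
    exact ⟨1, by ring⟩
  rw [h1, map_add, map_add, map_sum, LinearMap.add_apply, LinearMap.add_apply,
    LinearMap.sum_apply, h3, op_comp_mul]
  simp only [h2]
  rw [Finset.sum_neg_distrib, ← map_sum, dOp_apply, smul_sub, smul_add, smul_smul,
    Int.units_mul_self, one_smul, posSum_apply,
    ← Fin.sum_univ_eq_sum_range (fun i => pos i R.opMul x)]
  abel

theorem op_pos_top (f : R.Cochain p) (g : R.Cochain q) {N : ℕ} (hN : p + q ≤ N)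
    {x : ChainTot k A} (hx : x ∈ letters k A N) :
    R.op p f (pos p (R.op q g) x) = sgn₂ p q • pos 1 (R.op q g) (R.op p f x) := by
  have := op_pos_disjoint f g 0 (by omega) hx
  simpa only [Nat.cast_zero, add_zero, zero_add, sgn₂] using this

/-- Operators at disjoint positions commute up to sign. -/
theorem pos_pos_disjoint (f : R.Cochain p) (g : R.Cochain q) {N : ℕ} (r : ℕ)
    (hr : p + q + r ≤ N) (l : ℤ) {x : ChainTot k A} (hx : x ∈ letters k A N) :
    pos l (R.op p f) (pos (l + p + r) (R.op q g) x) =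
      sgn₂ p q • pos (l + r + 1) (R.op q g) (pos l (R.op p f) x) := by
  have h := op_pos_disjoint f g r hr (lam_mem hx (-l))
  rw [pos_apply, lam_pos, show -l + (l + p + r) = p + r by ring, h, map_sign, lam_pos, sgn₂,
    show l + ((r : ℤ) + 1) = l + r + 1 by ring]
  rfl

theorem pos_mulOp (g : R.Cochain q) (i : ℤ) (x : ChainTot k A) :
    pos i (mulOp g) x = pos i R.opMul (pos (i + 1) (R.op q g) x) := by
  rw [pos_add_comp]
  rfl

theorem pos_pos_opMul_left (g : R.Cochain q) {N : ℕ} {l r : ℕ} (hr : r < l) (hl : l + 1 + q ≤ N)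
    {x : ChainTot k A} (hx : x ∈ letters k A N) :
    pos l (R.op q g) (pos r R.opMul x) =
      sgn q • pos r R.opMul (pos (l + 1 : ℕ) (R.op q g) x) := by
  obtain ⟨t, rfl⟩ := Nat.exists_eq_add_of_lt hr
  have h := pos_pos_disjoint R.mulCochain g t (by omega) r hx
  rw [sgn₂_two_left] at h
  have h1 : ((r + t + 1 + 1 : ℕ) : ℤ) = r + (2 : ℕ) + t := by push_cast; ring
  rw [h1, h, smul_smul, Int.units_mul_self, one_smul]
  push_cast
  rfl

/-- The products fall into those before the slot of `g`, inside it, and after it. The outer ones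
commute past `g`. The inner ones form the middle part of the coboundary of `g`, whose two outer
terms are the diagonal terms μ_l g_l and μ_l g_(l+1) completing the sums. -/
theorem sum_pos_opMul (g : R.Cochain q) {N a l p : ℕ} (hal : a ≤ l) (hl : l < p)
    (hN : p + q ≤ N) {x : ChainTot k A} (hx : x ∈ letters k A N) :
    ∑ r ∈ Finset.Ico a (p + q - 1), pos l (R.op q g) (pos r R.opMul x) =
      sgn q • (∑ s ∈ Finset.Ico a (l + 1), pos s R.opMul (pos (l + 1 : ℕ) (R.op q g) x) +
        ∑ s ∈ Finset.Ico l p, pos s R.opMul (pos l (R.op q g) x) - pos l (dOp g) x) := by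
  have h1 : ∑ r ∈ Finset.Ico a l, pos l (R.op q g) (pos r R.opMul x) =
      sgn q • ∑ r ∈ Finset.Ico a l, pos r R.opMul (pos (l + 1 : ℕ) (R.op q g) x) := by
    rw [Finset.smul_sum]
    refine Finset.sum_congr rfl fun r hr => ?_
    rw [Finset.mem_Ico] at hr
    exact pos_pos_opMul_left g hr.2 (by omega) hx
  have h2 : ∑ r ∈ Finset.Ico l (l + q), pos l (R.op q g) (pos r R.opMul x) =
      pos l (R.op q g ∘ₗ posSum q R.opMul) x := by
    rw [Finset.sum_Ico_eq_sum_range, Nat.add_sub_cancel_left, pos_apply, LinearMap.comp_apply,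
      posSum_apply, map_sum, map_sum]
    refine Finset.sum_congr rfl fun r _ => ?_
    rw [Nat.cast_add, pos_add_comp]
    rfl
  have h3 : ∑ r ∈ Finset.Ico (l + q) (p + q - 1), pos l (R.op q g) (pos r R.opMul x) =
      sgn q • ∑ s ∈ Finset.Ico (l + 1) p, pos s R.opMul (pos l (R.op q g) x) := by
    rw [Finset.sum_Ico_eq_sum_range, Finset.sum_Ico_eq_sum_range, Finset.smul_sum,
      show p + q - 1 - (l + q) = p - (l + 1) by omega]
    refine Finset.sum_congr rfl fun r hr => ?_
    rw [Finset.mem_range] at hr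
    have h := pos_pos_disjoint g R.mulCochain r (by omega) l hx
    rw [sgn₂_two_right] at h
    push_cast
    rw [h]
    congr 3
    ring
  have h4 : pos l (R.op q g ∘ₗ posSum q R.opMul) x = sgn q • (pos l R.opMul (pos l (R.op q g) x) +
      pos l R.opMul (pos (l + 1 : ℕ) (R.op q g) x) - pos l (dOp g) x) := by
    rw [Nat.cast_succ, ← pos_mulOp, ← pos_comp]
    simp only [pos_apply, dOp_apply, LinearMap.comp_apply, map_sub, map_add, map_sign]
    rw [sub_sub_cancel, smul_smul, Int.units_mul_self, one_smul]
  rw [← Finset.sum_Ico_consecutive _ hal (by omega : l ≤ p + q - 1),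
    ← Finset.sum_Ico_consecutive _ (by omega : l ≤ l + q) (by omega : l + q ≤ p + q - 1), h1, h2,
    h3, h4, Finset.sum_Ico_succ_top hal, Finset.sum_eq_sum_Ico_succ_bot hl, ← smul_add, ← smul_add]
  congr 1
  abel

end RegUnitalHomAssoc

/-- Column m receives its part s < m from l = m - 1 and its part s ≥ m from l = m. Only the first
column m = j lacks its lower part. -/
theorem sum_Ico_triangle {M : Type*} [AddCommGroup M] (Y : ℕ → ℕ → M) {a j p : ℕ} (haj : a ≤ j)
    (hjp : j ≤ p) :
    ∑ l ∈ Finset.Ico j p, (∑ s ∈ Finset.Ico a (l + 1), Y s (l + 1) +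
      ∑ s ∈ Finset.Ico l p, Y s l) =
      ∑ m ∈ Finset.Ico j (p + 1), ∑ s ∈ Finset.Ico a p, Y s m - ∑ s ∈ Finset.Ico a j, Y s j := by
  induction hjp using Nat.decreasingInduction with
  | self => simp
  | of_succ j hj ih =>
    rw [Finset.sum_eq_sum_Ico_succ_bot hj, ih (by omega),
      Finset.sum_eq_sum_Ico_succ_bot (show j < p + 1 by omega),
      ← Finset.sum_Ico_consecutive _ haj (by omega : j ≤ p)]
    abel

end HomHochschild
end

noncomputable section

namespace HomHochschild

namespace RegUnitalHomAssoc

variable {k A : Type*} [CommRing k] [AddCommGroup A] [Module k A] {R : RegUnitalHomAssoc k A}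
  {p q : ℕ}

/-! ### The Gerstenhaber bracket -/

/-- The operator of `∑_{l ≥ j} f ∘_l g`. -/
def compFrom (f : R.Cochain p) (g : R.Cochain q) (j : ℕ) : ChainTot k A →ₗ[k] ChainTot k A :=
  R.op p f ∘ₗ ∑ l ∈ Finset.Ico j p, pos l (R.op q g)

theorem compFrom_apply (f : R.Cochain p) (g : R.Cochain q) (j : ℕ) (x : ChainTot k A) :
    compFrom f g j x = ∑ l ∈ Finset.Ico j p, R.op p f (pos l (R.op q g) x) := by
  rw [compFrom, LinearMap.comp_apply, LinearMap.sum_apply, map_sum]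

theorem compFrom_self (f : R.Cochain p) (g : R.Cochain q) (x : ChainTot k A) :
    compFrom f g p x = 0 := by
  rw [compFrom_apply, Finset.Ico_self, Finset.sum_empty]

theorem compFrom_zero (f : R.Cochain p) (g : R.Cochain q) (x : ChainTot k A) :
    compFrom f g 0 x = R.op p f (posSum p (R.op q g) x) := by
  rw [compFrom_apply, posSum_apply, map_sum, Finset.range_eq_Ico]

theorem op_circ (f : R.Cochain p) (g : R.Cochain q) {r : ℕ} (h : r = p + q - 1)
    (x : ChainTot k A) : R.op r (R.circ p q r h f g) x = compFrom f g 0 x := by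
  have h1 : R.circ p q r h f g = ∑ i : Fin p, Int.negOnePow (((q : ℤ) - 1) * i) •
      R.comp (p := p) (q := q) (r := r) (by have := i.2; omega) i f g := by
    rw [circ, LinearMap.sum_apply, LinearMap.sum_apply]
    rfl
  rw [h1, compFrom_apply, ← Finset.range_eq_Ico,
    ← Fin.sum_univ_eq_sum_range (fun i => R.op p f (pos i (R.op q g) x)), map_sum,
    LinearMap.sum_apply]
  refine Finset.sum_congr rfl fun i _ => ?_
  have := op_comp f g (r := r) (by have := i.2; omega) i i.2 x
  rw [map_sign, Units.smul_def, LinearMap.smul_apply, ← Units.smul_def, this, smul_smul, mul_comm,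
    mul_comm (i.1 : ℤ), Int.units_mul_self, one_smul]

theorem op_posSum_self (f : R.Cochain p) (x : ChainTot k A) :
    R.op p f (posSum p R.opMul x) =
      sgn p • (R.opMul (R.op p f x) + mulOp f x - dOp f x) := by
  rw [dOp_apply, sub_sub_cancel, smul_smul, Int.units_mul_self, one_smul]

theorem mulOp_pos_succ (f : R.Cochain p) (g : R.Cochain q) (m : ℕ) (x : ChainTot k A) :
    mulOp f (pos (m + 1 : ℕ) (R.op q g) x) =
      R.opMul (lam k A 1 (R.op p f (pos m (R.op q g) (lam k A (-1) x)))) := by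
  rw [mulOp_apply, pos_apply, lam_pos]
  congr 4
  push_cast; ring_nf

theorem mulOp_posSum_succ (f : R.Cochain p) (g : R.Cochain q) (x : ChainTot k A) :
    mulOp f (posSum (p + 1) (R.op q g) x) =
      mulOp f (R.op q g x) + R.opMul (pos 1 (compFrom f g 0) x) := by
  have h4 := mulOp_pos_succ f g
  push_cast at h4
  rw [posSum_succ', map_add, map_sum, Finset.sum_congr rfl fun i _ => h4 i x, pos_apply,
    compFrom_apply, map_sum, map_sum, Finset.range_eq_Ico]

theorem opMul_op_pos_top (f : R.Cochain p) (g : R.Cochain q) {N : ℕ} (hN : p + q ≤ N)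
    {x : ChainTot k A} (hx : x ∈ letters k A N) :
    R.opMul (R.op p f (pos p (R.op q g) x)) = sgn₂ p q • mulOp g (R.op p f x) := by
  rw [op_pos_top f g hN hx, map_sign]
  rfl

/-- The homotopy formula behind graded commutativity of the cup product. -/
theorem compFrom_coboundary (f : R.Cochain p) (g : R.Cochain q) {N : ℕ} (hN : p + q ≤ N)
    {x : ChainTot k A} (hx : x ∈ letters k A N) :
    R.opMul (compFrom f g 0 x) + R.opMul (pos 1 (compFrom f g 0) x) -
      (sgn p * sgn q) • compFrom f g 0 (posSum (p + q - 1) R.opMul x) =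
    dOp f (posSum (p + 1) (R.op q g) x) + sgn p • R.op p f (posSum p (dOp g) x) -
      mulOp f (R.op q g x) - sgn₂ p q • mulOp g (R.op p f x) := by
  -- Summing over the slots of `g` fills the rectangle of all products μ_s, s < p, applied after `g`
  -- at all positions m ≤ p. The sum over s is then absorbed by the coboundary of `f`.
  have h1 : compFrom f g 0 (posSum (p + q - 1) R.opMul x) =
      sgn q • (R.op p f (posSum p R.opMul (posSum (p + 1) (R.op q g) x)) -
        R.op p f (posSum p (dOp g) x)) := by
    have h2 : ∀ l ∈ Finset.Ico 0 p,
        pos l (R.op q g) (posSum (p + q - 1) R.opMul x) =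
        sgn q • ((∑ s ∈ Finset.Ico 0 (l + 1), pos s R.opMul (pos (l + 1 : ℕ) (R.op q g) x) +
        ∑ s ∈ Finset.Ico l p, pos s R.opMul (pos l (R.op q g) x)) - pos l (dOp g) x) := by
      intro l hl
      rw [← sum_pos_opMul g (Nat.zero_le l) (Finset.mem_Ico.1 hl).2 hN hx, posSum_apply, map_sum,
        Finset.range_eq_Ico]
    rw [compFrom_apply, ← map_sum, Finset.sum_congr rfl h2, ← Finset.smul_sum,
      Finset.sum_sub_distrib, sum_Ico_triangle (fun s m => pos s R.opMul (pos m (R.op q g) x))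
        le_rfl (Nat.zero_le p), map_sign, map_sub]
    simp only [Finset.Ico_self, Finset.sum_empty, sub_zero, ← Finset.range_eq_Ico]
    simp only [posSum_apply, map_sum]
  -- The position m = p lies outside the arguments of `f` and gives the product of the two values in
  -- the order f, g. At the other end, m = 0 gives the opposite order through `mulOp_posSum_succ`.
  have h5 : R.opMul (R.op p f (posSum (p + 1) (R.op q g) x)) =
      R.opMul (compFrom f g 0 x) + sgn₂ p q • mulOp g (R.op p f x) := by
    rw [← opMul_op_pos_top f g hN hx, posSum_apply, Finset.sum_range_succ, ← posSum_apply, map_add,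
      map_add, compFrom_zero]
  rw [h1, op_posSum_self, mulOp_posSum_succ, h5]
  rcases Int.units_eq_one_or (sgn p) with hs | hs <;>
  rcases Int.units_eq_one_or (sgn q) with hs' | hs' <;>
  rcases Int.units_eq_one_or (sgn₂ p q) with hs'' | hs'' <;>
  simp only [hs, hs', hs'', one_smul, Units.neg_smul, neg_neg, _root_.one_mul, neg_mul] <;>
  abel

/-! ### Cycles -/

/-- A cycle satisfies `b' λ^i x = ∑_{r < i} μ_r λ^i x - ∑_{r ≤ i} μ_r λ^{i+1} x`. -/
theorem posSum_opMul_lam {M : ℕ} {x : ChainTot k A} (hx : x ∈ letters k A (M + 1))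
    (hb : posSum (M + 1) R.opMul x = 0) (i : ℕ) :
    posSum M R.opMul (lam k A i x) =
      posSum i R.opMul (lam k A i x) - posSum (i + 1) R.opMul (lam k A (i + 1 : ℕ) x) := by
  induction i with
  | zero =>
    rw [posSum_opMul_succ hx] at hb
    rw [posSum_zero, posSum_succ']
    simpa [lam_zero, zero_sub] using eq_neg_of_add_eq_zero_left hb
  | succ i ih =>
    have h1 := congrArg (lam k A 1) ih
    have h2 : ∀ j : ℕ, lam k A 1 (lam k A j x) = lam k A (j + 1 : ℕ) x := fun j => by
      rw [lam_lam]; push_cast; rw [add_comm]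
    have h3 := posSum_opMul_succ (R := R) (lam_mem hx (i + 1 : ℕ))
    rw [map_sub, lam_one_posSum_opMul, lam_one_posSum_opMul, lam_one_posSum_opMul, h2, h2, h3,
      h2] at h1
    linear_combination (norm := module) h1

theorem sgn_comp {p q r : ℕ} (h : p + q = r + 1) : sgn r = sgn p * sgn q := by
  simp only [sgn, ← Int.negOnePow_add]
  congr 1
  omega

/-- The commutator of `(f ∘_l g) λ^i` with `b`, on cycles. -/
theorem posSum_opMul_comp_lam (f : R.Cochain p) (g : R.Cochain q) {N l i : ℕ} (hl : l < p)
    (hi : i < p) (hN : p + q ≤ N) {x : ChainTot k A} (hx : x ∈ letters k A N)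
    (hb : posSum N R.opMul x = 0) :
    posSum (N + 2 - (p + q)) R.opMul (R.op p f (pos l (R.op q g) (lam k A i x))) =
      R.opMul (R.op p f (pos l (R.op q g) (lam k A i x))) +
      R.opMul (lam k A 1 (R.op p f (pos l (R.op q g) (lam k A i x)))) -
      (sgn p * sgn q) • (∑ r ∈ Finset.Ico i (p + q - 1),
        R.op p f (pos l (R.op q g) (pos r R.opMul (lam k A i x))) +
      R.op p f (pos l (R.op q g) (posSum (i + 1) R.opMul (lam k A (i + 1 : ℕ) x)))) := by
  obtain ⟨r, hr⟩ : ∃ r, p + q = r + 1 := ⟨p + q - 1, by omega⟩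
  obtain ⟨M, rfl⟩ : ∃ M, N = M + 1 := ⟨N - 1, by omega⟩
  have hF : ∀ z, R.op p f (pos l (R.op q g) z) = Int.negOnePow (l * ((q : ℤ) - 1)) •
      R.op r (R.comp hr ⟨l, hl⟩ f g) z := fun z => by
    rw [op_comp, smul_smul, Int.units_mul_self, one_smul]
  have h1 := posSum_opMul_op' (R.comp hr ⟨l, hl⟩ f g) (lam_mem hx i)
  rw [mulOp_lam_one, dOp_apply, Nat.add_sub_cancel, posSum_opMul_lam hx hb, sgn_comp hr,
    show M + 1 + 1 - r = M + 1 + 2 - (p + q) by omega] at h1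
  -- The products before position i cancel against those in the cycle relation, leaving r ≥ i and
  -- the contribution of λ^(i+1) x.
  have h2 : posSum r R.opMul (lam k A i x) = posSum i R.opMul (lam k A i x) +
      ∑ s ∈ Finset.Ico i (p + q - 1), pos s R.opMul (lam k A i x) := by
    rw [posSum_apply, posSum_apply, hr, Nat.add_sub_cancel]
    exact (Finset.sum_range_add_sum_Ico _ (by omega)).symm
  simp only [hF]
  rw [h2] at h1
  simp only [map_sign, map_add, map_sub, map_sum, ← Finset.smul_sum] at h1 ⊢
  rw [h1]
  rcases Int.units_eq_one_or (sgn p) with hs | hs <;>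
  rcases Int.units_eq_one_or (sgn q) with hs' | hs' <;>
  rcases Int.units_eq_one_or (Int.negOnePow (l * ((q : ℤ) - 1))) with hs'' | hs'' <;>
  simp only [hs, hs', hs'', one_smul, Units.neg_smul, neg_neg, _root_.one_mul, neg_mul] <;>
  abel

theorem mulOp_op_eq_zero (f : R.Cochain p) (g : R.Cochain q) {N : ℕ} (hN : N < p + q)
    {x : ChainTot k A} (hx : x ∈ letters k A N) : mulOp g (R.op p f x) = 0 := by
  by_cases hNp : N < p
  · rw [op_eq_zero f hx hNp, map_zero]
  · exact mulOp_eq_zero g (N := N + 1 - p) (by omega) (op_mem f hx (by omega))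

theorem compFrom_mem_eq_zero (f : R.Cochain p) (g : R.Cochain q) (j : ℕ) {N : ℕ}
    (hN : N + 1 < p + q) {x : ChainTot k A} (hx : x ∈ letters k A N) : compFrom f g j x = 0 := by
  rw [compFrom_apply]
  refine Finset.sum_eq_zero fun l _ => ?_
  by_cases hNq : N < q
  · rw [pos_op_eq_zero g _ hx hNq, map_zero]
  · exact op_eq_zero f (pos_op_mem g (M := N + 1 - q) _ hx (by omega)) (by omega)

theorem compFrom_mem (f : R.Cochain p) (g : R.Cochain q) (j : ℕ) {N M : ℕ}
    (hN : M + p + q = N + 2) {x : ChainTot k A} (hx : x ∈ letters k A N) :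
    compFrom f g j x ∈ letters k A M := by
  rw [compFrom_apply]
  refine Submodule.sum_mem _ fun l hl => ?_
  rw [Finset.mem_Ico] at hl
  by_cases hNq : N < q
  · rw [pos_op_eq_zero g _ hx hNq, map_zero]; exact Submodule.zero_mem _
  · exact op_mem f (pos_op_mem g (M := N + 1 - q) _ hx (by omega)) (by omega)

theorem opMul_pos_compFrom_eq_zero (f : R.Cochain p) (g : R.Cochain q) {N : ℕ} (hN : N < p + q)
    {x : ChainTot k A} (hx : x ∈ letters k A N) : R.opMul (pos 1 (compFrom f g 0) x) = 0 := by
  by_cases hN' : N + 1 < p + q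
  · rw [pos_apply, compFrom_mem_eq_zero f g 0 hN' (lam_mem hx _), map_zero, map_zero]
  · have h' : pos 1 (compFrom f g 0) x ∈ letters k A 1 :=
      pos_mem (fun y hy => compFrom_mem f g 0 (by omega) hy) 1 hx
    exact opMul_eq_zero h' (by omega)

/-- On cycles, the parts of `L_f i_g - i_g L_f` in which `f` involves the first letter combine, up
to a boundary, to the product with `f ∘ g`. -/
theorem exists_boundary_compFrom (f : R.Cochain p) (g : R.Cochain q) (hf : ∀ x, dOp f x = 0)
    (hg : ∀ x, dOp g x = 0) {N : ℕ} {x : ChainTot k A} (hx : x ∈ letters k A N)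
    (hb : posSum N R.opMul x = 0) :
    ∃ z ∈ letters k A (N + 2 - (p + q)), posSum (N + 2 - (p + q)) R.opMul z =
      sgn p • ∑ i ∈ Finset.range p, R.op p f (lam k A i (mulOp g x)) -
      sgn₂ p q • mulOp g (∑ i ∈ Finset.range p, R.op p f (lam k A i x)) -
      R.opMul (pos 1 (compFrom f g 0) x) := by
  by_cases hN : p + q ≤ N
  swap
  · refine ⟨0, Submodule.zero_mem _, ?_⟩
    have h1 : ∀ i : ℕ, R.op p f (lam k A i (mulOp g x)) = 0 := fun i => by
      by_cases hNq : N ≤ q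
      · rw [mulOp_eq_zero g hNq hx, map_zero, map_zero]
      · exact op_eq_zero f (lam_mem (mulOp_mem g (M := N - q) (by omega) hx) _) (by omega)
    have h2 : ∀ i : ℕ, mulOp g (R.op p f (lam k A i x)) = 0 := fun i =>
      mulOp_op_eq_zero f g (by omega) (lam_mem hx _)
    rw [map_sum, Finset.sum_eq_zero fun i _ => h1 i, Finset.sum_eq_zero fun i _ => h2 i,
      opMul_pos_compFrom_eq_zero f g (by omega) hx]
    simp
  set y : ℕ → ChainTot k A := fun i => lam k A i x with hy
  have hym : ∀ i, y i ∈ letters k A N := fun i => lam_mem hx i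
  -- After λ^i the original first letter stands at position i. The boundary of the i-th row splits
  -- into a part `a i` attached to λ^i and a part `b (i + 1)` coming from λ^(i+1); regrouping as `a
  -- i + b i` makes the sum telescope.
  set a : ℕ → ChainTot k A := fun i => R.opMul (compFrom f g (i + 1) (y i)) -
    (sgn p * sgn q) • compFrom f g (i + 1) (∑ r ∈ Finset.Ico i (p + q - 1), pos r R.opMul (y i))
    with ha
  set b : ℕ → ChainTot k A := fun j => R.opMul (lam k A 1 (compFrom f g j (lam k A (j - 1) x))) -
    (sgn p * sgn q) • compFrom f g j (posSum j R.opMul (y j)) with hb'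
  have hsum : ∀ i < p, posSum (N + 2 - (p + q)) R.opMul (compFrom f g (i + 1) (y i)) =
      a i + b (i + 1) := by
    intro i hi
    have h1 : ∀ l ∈ Finset.Ico (i + 1) p, _ := fun l hl =>
      posSum_opMul_comp_lam f g (Finset.mem_Ico.1 hl).2 hi hN hx hb
    rw [compFrom_apply, map_sum, Finset.sum_congr rfl h1]
    simp only [ha, hb', hy, Nat.cast_succ, add_sub_cancel_right, compFrom_apply, map_sum,
      Finset.sum_add_distrib, Finset.sum_sub_distrib, ← Finset.smul_sum, smul_add]
    rw [Finset.sum_comm (s := Finset.Ico i (p + q - 1))]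
    abel
  have hv : ∀ i < p, a i + b i = sgn p • R.op p f (lam k A i (mulOp g x)) -
      sgn₂ p q • mulOp g (R.op p f (y i)) := by
    intro i hi
    -- The triangle starting at column i + 1 misses only μ_i g_(i+1) λ^i x = λ^i (a_0 · g(…)), which
    -- produces the term with `mulOp g`. The second summand supplies the products at s < i.
    have h1 : compFrom f g (i + 1) (∑ r ∈ Finset.Ico i (p + q - 1), pos r R.opMul (y i)) +
        compFrom f g i (posSum i R.opMul (y i)) = sgn q • (R.op p f (posSum p R.opMul
          (∑ m ∈ Finset.Ico (i + 1) (p + 1), pos m (R.op q g) (y i))) -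
          R.op p f (lam k A i (mulOp g x))) := by
      have h2 : ∀ l ∈ Finset.Ico (i + 1) p,
          pos l (R.op q g) (∑ r ∈ Finset.Ico i (p + q - 1), pos r R.opMul (y i)) =
          sgn q • (∑ s ∈ Finset.Ico i (l + 1), pos s R.opMul (pos (l + 1 : ℕ) (R.op q g) (y i)) +
            ∑ s ∈ Finset.Ico l p, pos s R.opMul (pos l (R.op q g) (y i))) := by
        intro l hl
        rw [Finset.mem_Ico] at hl
        rw [map_sum, sum_pos_opMul g (by omega) hl.2 hN (hym i), pos_apply l (dOp g), hg, map_zero,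
          sub_zero]
      have h3 : ∀ l ∈ Finset.Ico i p, pos l (R.op q g) (posSum i R.opMul (y i)) =
          sgn q • ∑ s ∈ Finset.Ico 0 i, pos s R.opMul (pos (l + 1 : ℕ) (R.op q g) (y i)) := by
        intro l hl
        rw [Finset.mem_Ico] at hl
        rw [posSum_apply, map_sum, Finset.range_eq_Ico, Finset.smul_sum]
        refine Finset.sum_congr rfl fun s hs => ?_
        rw [Finset.mem_Ico] at hs
        exact pos_pos_opMul_left g (by omega) (by omega) (hym i)
      have h4 : R.op p f (lam k A i (mulOp g x)) =
          R.op p f (pos i R.opMul (pos (i + 1 : ℕ) (R.op q g) (y i))) := by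
        rw [Nat.cast_succ, ← pos_mulOp, pos_lam, sub_self]
        rfl
      rw [compFrom_apply, compFrom_apply, ← map_sum, ← map_sum, Finset.sum_congr rfl h2,
        Finset.sum_congr rfl h3, ← Finset.smul_sum, ← Finset.smul_sum,
        sum_Ico_triangle (fun s m => pos s R.opMul (pos m (R.op q g) (y i))) (Nat.le_succ i) hi,
        h4, map_sign, map_sign, ← smul_add, ← map_add, ← map_sub]
      congr 2
      rw [Finset.sum_Ico_add' (fun m : ℕ => ∑ s ∈ Finset.Ico 0 i,
        pos s R.opMul (pos m (R.op q g) (y i))) i p 1, Nat.Ico_succ_singleton,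
        Finset.sum_singleton, posSum_apply, sub_add_eq_add_sub, ← Finset.sum_add_distrib]
      congr 1
      simp only [map_sum]
      rw [Finset.sum_comm (s := Finset.range p)]
      refine Finset.sum_congr rfl fun m _ => ?_
      rw [add_comm, Finset.sum_Ico_consecutive _ (Nat.zero_le i) hi.le, Finset.range_eq_Ico]
    have h5 : R.opMul (R.op p f (∑ m ∈ Finset.Ico (i + 1) (p + 1), pos m (R.op q g) (y i))) =
        R.opMul (compFrom f g (i + 1) (y i)) + sgn₂ p q • mulOp g (R.op p f (y i)) := by
      rw [← opMul_op_pos_top f g hN (hym i), Finset.sum_Ico_succ_top (by omega), map_add, map_add,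
        compFrom_apply, map_sum]
    have h6 : mulOp f (∑ m ∈ Finset.Ico (i + 1) (p + 1), pos m (R.op q g) (y i)) =
        R.opMul (lam k A 1 (compFrom f g i (lam k A (i - 1) x))) := by
      rw [map_sum, ← Finset.sum_Ico_add' (fun m : ℕ => mulOp f (pos m (R.op q g) (y i))) i p 1,
        compFrom_apply, map_sum, map_sum]
      refine Finset.sum_congr rfl fun m _ => ?_
      rw [mulOp_pos_succ, hy, lam_lam, neg_add_eq_sub]
    have h7 : a i + b i = R.opMul (compFrom f g (i + 1) (y i)) +
        R.opMul (lam k A 1 (compFrom f g i (lam k A (i - 1) x))) - (sgn p * sgn q) •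
        (compFrom f g (i + 1) (∑ r ∈ Finset.Ico i (p + q - 1), pos r R.opMul (y i)) +
        compFrom f g i (posSum i R.opMul (y i))) := by
      rw [ha, hb', smul_add]
      exact sub_add_sub_comm _ _ _ _
    rw [h7, h1, op_posSum_self, h5, h6, hf, sub_zero]
    rcases Int.units_eq_one_or (sgn p) with hs | hs <;>
    rcases Int.units_eq_one_or (sgn q) with hs' | hs' <;>
    rcases Int.units_eq_one_or (sgn₂ p q) with hs'' | hs'' <;>
    simp only [hs, hs', hs'', one_smul, Units.neg_smul, neg_neg, _root_.one_mul, neg_mul] <;>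
    abel
  -- The homotopy sums f(…, a_0, …, g(…), …) over all places of a_0 strictly before `g` inside `f`.
  refine ⟨∑ i ∈ Finset.range p, compFrom f g (i + 1) (y i),
    Submodule.sum_mem _ fun i hi => compFrom_mem f g _ (by omega) (hym i), ?_⟩
  -- Of the telescoping sum only `b 0` remains, the cap product with f ∘ g; the other end has no
  -- slot left for `g`.
  have hb0 : b 0 = R.opMul (pos 1 (compFrom f g 0) x) := by
    simp only [hb', posSum_zero, map_zero, smul_zero, sub_zero, Nat.cast_zero, zero_sub]
    rfl
  have hbp : b p = 0 := by
    simp only [hb', compFrom_self, map_zero, smul_zero, sub_zero]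
  have h8 := Finset.sum_range_succ b p
  rw [Finset.sum_range_succ', hb0, hbp, add_zero] at h8
  rw [map_sum, Finset.sum_congr rfl fun i hi => hsum i (Finset.mem_range.1 hi),
    Finset.sum_add_distrib, eq_sub_of_add_eq h8, ← add_sub_assoc, ← Finset.sum_add_distrib,
    Finset.sum_congr rfl fun i hi => hv i (Finset.mem_range.1 hi), Finset.sum_sub_distrib,
    map_sum, Finset.smul_sum, Finset.smul_sum]

end RegUnitalHomAssoc
end HomHochschild
end

noncomputable section

namespace HomHochschild

namespace RegUnitalHomAssoc

variable {k A : Type*} [CommRing k] [AddCommGroup A] [Module k A] {R : RegUnitalHomAssoc k A}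
  {p q : ℕ}

/-! ### The Cartan homotopy formula -/

/-- A rotation has period m + 1 before the product and m after it, so a shift of the position by m +
1 leaves one rotation behind. -/
theorem lam_one_pos_opMul {m : ℕ} {y : ChainTot k A} (hy : y ∈ letters k A (m + 1)) (i : ℤ) :
    lam k A 1 (pos i R.opMul y) = pos (i + (m + 1)) R.opMul y := by
  rw [pos_apply, pos_apply, lam_lam,
    lam_add_period hy (show -i = -(i + (m + 1)) + (m + 1 : ℕ) by push_cast; ring)]
  exact (lam_add_period (opMul_mem (lam_mem hy _)) (by ring)).symm

/-- Splits b' after a rotation into products that have not passed the end of the word and those that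
have; the latter lose one rotation by `lam_one_pos_opMul`. -/
theorem posSum_opMul_lam_succ {m t : ℕ} (ht : t < m) {y : ChainTot k A}
    (hy : y ∈ letters k A (m + 1)) :
    posSum m R.opMul (lam k A (t + 1 : ℕ) y) =
      lam k A (t + 1 : ℕ) (posSum (m - (t + 1)) R.opMul y) +
      lam k A t (posSum (m + 1) R.opMul y - posSum (m - t) R.opMul y) := by
  obtain ⟨s, rfl⟩ : ∃ s, m = t + 1 + s := ⟨m - (t + 1), by omega⟩
  have h1 : posSum (t + 1 + s + 1) R.opMul y - posSum (s + 1) R.opMul y =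
      ∑ w ∈ Finset.range (t + 1), pos (s + 1 + w) R.opMul y := by
    rw [posSum_apply, posSum_apply, show t + 1 + s + 1 = s + 1 + (t + 1) by omega,
      Finset.sum_range_add, add_sub_cancel_left]
    push_cast
    rfl
  rw [Nat.add_sub_cancel_left, show t + 1 + s - t = s + 1 by omega, h1, posSum_apply,
    Finset.sum_range_add, add_comm]
  congr 1
  · rw [posSum_apply, map_sum]
    refine Finset.sum_congr rfl fun w _ => ?_
    rw [lam_pos, Nat.cast_add]
  · rw [map_sum]
    refine Finset.sum_congr rfl fun w _ => ?_
    have h2 := lam_one_pos_opMul (R := R) hy (w - (t + 1))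
    rw [pos_lam, Nat.cast_succ, ← lam_lam, h2]
    congr 2
    push_cast; ring_nf

/-- Each rotation contributes a full b plus a difference of partial sums; the differences telescope.
-/
theorem posSum_opMul_sum_lam {m i : ℕ} (hi : i ≤ m) {y : ChainTot k A}
    (hy : y ∈ letters k A (m + 1)) :
    posSum m R.opMul (∑ t ∈ Finset.Ico (i + 1) (m + 1), lam k A t y) =
      ∑ t ∈ Finset.Ico i m, lam k A t (posSum (m + 1) R.opMul y) -
        lam k A i (posSum (m - i) R.opMul y) := by
  rw [← Finset.sum_Ico_add' (fun t : ℕ => lam k A t y) i m 1, map_sum,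
    Finset.sum_congr rfl fun t ht => posSum_opMul_lam_succ (Finset.mem_Ico.1 ht).2 hy,
    eq_sub_iff_add_eq]
  have h : ∀ t : ℕ, lam k A (t + 1 : ℕ) (posSum (m - (t + 1)) R.opMul y) +
      lam k A t (posSum (m + 1) R.opMul y - posSum (m - t) R.opMul y) =
      lam k A t (posSum (m + 1) R.opMul y) + (lam k A (t + 1 : ℕ)
        (posSum (m - (t + 1)) R.opMul y) - lam k A t (posSum (m - t) R.opMul y)) := fun t => by
    rw [map_sub]; abel
  simp only [h]
  rw [Finset.sum_add_distrib, Finset.sum_Ico_sub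
    (fun t : ℕ => lam k A t (posSum (m - t) R.opMul y)) hi, Nat.sub_self, posSum_zero, map_zero]
  abel

/-- For a cocycle `f`, part of the commutator of `f` with `b'`. -/
theorem posSum_opMul_op_of_cocycle (f : R.Cochain p) (hf : ∀ x, dOp f x = 0) {N s : ℕ}
    (hs : s + p + 1 ≤ N) {x : ChainTot k A} (hx : x ∈ letters k A N) :
    posSum (s + 1) R.opMul (R.op p f x) =
      sgn p • R.op p f (posSum (p + s) R.opMul x) - mulOp f x := by
  have h1 := hf x
  rw [dOp_apply] at h1
  have h2 : ∑ r ∈ Finset.range s, pos (r + 1) R.opMul (R.op p f x) =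
      sgn p • ∑ r ∈ Finset.range s, R.op p f (pos (p + r : ℕ) R.opMul x) := by
    rw [Finset.smul_sum]
    refine Finset.sum_congr rfl fun r hr => ?_
    rw [Finset.mem_range] at hr
    rw [Nat.cast_add, op_pos_disjoint f R.mulCochain r (by omega) hx, smul_smul,
      ← sgn₂_two_right, sgn₂, Int.units_mul_self, one_smul]
  rw [posSum_succ', h2, posSum_apply (p + s), Finset.sum_range_add, ← posSum_apply, map_add,
    map_sum, smul_add]
  rcases Int.units_eq_one_or (sgn p) with hs | hs <;>
  simp only [hs, one_smul, Units.neg_smul] at h1 ⊢ <;>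
  linear_combination (norm := module) h1

variable (R) in
/-- Connes' operator on chains with `M` letters. -/
def connesOp (M : ℕ) : ChainTot k A →ₗ[k] ChainTot k A :=
  (LinearMap.id - lam k A 1) ∘ₗ R.opOne ∘ₗ norm k A M

theorem connesOp_apply (M : ℕ) (x : ChainTot k A) : R.connesOp M x =
    R.opOne (norm k A M x) - lam k A 1 (R.opOne (norm k A M x)) := rfl

/-- The homotopy of the Cartan formula. -/
def cartanHomotopy (f : R.Cochain p) (m : ℕ) (x : ChainTot k A) : ChainTot k A :=
  ∑ i ∈ Finset.range m, ∑ t ∈ Finset.Ico (i + 1) (m + 1),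
    lam k A t (R.op p f (lam k A (m - 1 - i + p : ℕ) x))

/-- On m + p letters the inner rotation is λ^(-(i+1)), so the homotopy places `f` at position i + 1
and rotates the result until its value reaches the end. Interchanging the two sums reduces the claim
to `h3` for each outer rotation t. -/
theorem posSum_opMul_cartanHomotopy (f : R.Cochain p) (hf : ∀ x, dOp f x = 0) {m : ℕ}
    {x : ChainTot k A} (hx : x ∈ letters k A (m + p)) (hb : posSum (m + p) R.opMul x = 0) :
    posSum m R.opMul (cartanHomotopy f m x) = norm k A m (mulOp f x) := by
  have hym : ∀ j : ℕ, R.op p f (lam k A j x) ∈ letters k A (m + 1) := fun j =>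
    op_mem f (lam_mem hx _) (by omega)
  set B : ℕ → ChainTot k A := fun i =>
    posSum (m + 1) R.opMul (R.op p f (lam k A (m - 1 - i + p : ℕ) x)) with hB
  set C : ℕ → ChainTot k A := fun i =>
    posSum (m - i) R.opMul (R.op p f (lam k A (m - 1 - i + p : ℕ) x)) with hC
  have h1 : ∀ i ∈ Finset.range m, posSum m R.opMul (∑ t ∈ Finset.Ico (i + 1) (m + 1),
      lam k A t (R.op p f (lam k A (m - 1 - i + p : ℕ) x))) =
      ∑ t ∈ Finset.Ico i m, lam k A t (B i) - lam k A i (C i) := fun i hi =>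
    posSum_opMul_sum_lam (Finset.mem_range.1 hi).le (hym _)
  have h2 : ∀ j : ℕ, R.opMul (lam k A 1 (R.op p f (lam k A j x))) =
      mulOp f (lam k A (j + 1 : ℕ) x) := fun j => by
    rw [← mulOp_lam_one, lam_lam, Nat.cast_succ, add_comm]
  -- At t = 0 only the wrap-around product survives, which is `mulOp f x`. From t to t + 1 nothing
  -- changes: this is the cycle relation `posSum_opMul_lam` seen through the cocycle `f`.
  have h3 : ∀ t < m, ∑ i ∈ Finset.range (t + 1), B i - C t = mulOp f x := by
    intro t ht
    induction t with
    | zero =>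
      rw [Finset.sum_range_one]
      simp only [hB, hC, Nat.sub_zero]
      rw [posSum_opMul_succ (hym _), add_sub_cancel_left, h2,
        show m - 1 + p + 1 = m + p by omega, lam_period hx]
    | succ i ih =>
      obtain ⟨s, rfl⟩ : ∃ s, m = s + i + 2 := ⟨m - i - 2, by omega⟩
      rw [← ih (by omega), Finset.sum_range_succ _ (i + 1)]
      simp only [hB, hC]
      rw [show s + i + 2 - 1 - (i + 1) + p = s + p by omega,
        show s + i + 2 - 1 - i + p = s + p + 1 by omega,
        show s + i + 2 - (i + 1) = s + 1 by omega, show s + i + 2 - i = s + 1 + 1 by omega,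
        posSum_opMul_succ (hym _), h2,
        posSum_opMul_op_of_cocycle f hf (s := s + i + 1) (by omega) (lam_mem hx _),
        posSum_opMul_op_of_cocycle f hf (s := s) (by omega) (lam_mem hx _),
        posSum_opMul_op_of_cocycle f hf (s := s + 1) (by omega) (lam_mem hx _)]
      have h4 := posSum_opMul_lam (R := R) (M := p + (s + i + 1)) (x := x)
        (by rwa [show p + (s + i + 1) + 1 = s + i + 2 + p by omega])
        (by rwa [show p + (s + i + 1) + 1 = s + i + 2 + p by omega]) (s + p)
      rw [h4, map_sub, smul_sub, show p + s = s + p by omega,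
        show p + (s + 1) = s + p + 1 by omega]
      abel
  rw [cartanHomotopy, map_sum, Finset.sum_congr rfl h1, Finset.sum_sub_distrib, norm_apply,
    Finset.range_eq_Ico, Finset.sum_Ico_Ico_comm, ← Finset.sum_sub_distrib]
  refine Finset.sum_congr rfl fun t ht => ?_
  rw [← map_sum, ← map_sub, ← Finset.range_eq_Ico, h3 t (Finset.mem_Ico.1 ht).2]

/-- Applying 1 - λ telescopes the outer rotation: its start is `f` at position i + 1, its end is `f`
after a rotation. The end terms are the part of f N with at least p rotations. -/
theorem sub_lam_cartanHomotopy (f : R.Cochain p) {m : ℕ}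
    {x : ChainTot k A} (hx : x ∈ letters k A (m + p)) :
    cartanHomotopy f m x - lam k A 1 (cartanHomotopy f m x) =
      posSum (m + 1) (R.op p f) x + ∑ i ∈ Finset.range p, R.op p f (lam k A i x) -
        R.op p f x - R.op p f (norm k A (m + p) x) := by
  have hym : ∀ j : ℕ, R.op p f (lam k A j x) ∈ letters k A (m + 1) := fun j =>
    op_mem f (lam_mem hx _) (by omega)
  have h1 : ∀ i ∈ Finset.range m, (∑ t ∈ Finset.Ico (i + 1) (m + 1),
      lam k A t (R.op p f (lam k A (m - 1 - i + p : ℕ) x))) -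
      lam k A 1 (∑ t ∈ Finset.Ico (i + 1) (m + 1),
      lam k A t (R.op p f (lam k A (m - 1 - i + p : ℕ) x))) =
      pos (i + 1) (R.op p f) x - R.op p f (lam k A (m - 1 - i + p : ℕ) x) := by
    intro i hi
    rw [Finset.mem_range] at hi
    have h2 := Finset.sum_Ico_sub
      (fun t : ℕ => lam k A t (R.op p f (lam k A (m - 1 - i + p : ℕ) x)))
      (show i + 1 ≤ m + 1 by omega)
    rw [lam_period (hym _), Finset.sum_sub_distrib] at h2
    have h3 : lam k A (-((i : ℤ) + 1)) x = lam k A (m - 1 - i + p : ℕ) x :=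
      (lam_add_period hx (by omega)).symm
    rw [pos_apply, h3, map_sum, ← neg_inj, neg_sub]
    simp only [lam_lam]
    push_cast at h2 ⊢
    simp only [add_comm (1 : ℤ)]
    rw [h2, neg_sub]
  have h4 : ∑ i ∈ Finset.range m, R.op p f (lam k A (m - 1 - i + p : ℕ) x) =
      ∑ i ∈ Finset.range m, R.op p f (lam k A (p + i : ℕ) x) := by
    rw [← Finset.sum_range_reflect]
    refine Finset.sum_congr rfl fun i hi => ?_
    rw [Finset.mem_range] at hi
    rw [show m - 1 - (m - 1 - i) + p = p + i by omega]
  rw [cartanHomotopy, map_sum, ← Finset.sum_sub_distrib, Finset.sum_congr rfl h1,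
    Finset.sum_sub_distrib, h4, posSum_succ', norm_apply, add_comm m p, Finset.sum_range_add,
    map_add, map_sum, map_sum]
  abel

end RegUnitalHomAssoc
end HomHochschild
end

noncomputable section

namespace HomHochschild

/-! ## Total complexes -/

theorem bilin_lof {k : Type*} [CommRing k] {M N : ℕ → Type*} {E : Type*}
    [∀ n, AddCommGroup (M n)] [∀ n, Module k (M n)] [∀ n, AddCommGroup (N n)]
    [∀ n, Module k (N n)] [AddCommGroup E] [Module k E] (T : ∀ p q : ℕ, M p →ₗ[k] N q →ₗ[k] E)
    (p q : ℕ) (x : M p) (y : N q) :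
    bilin T (DirectSum.lof k ℕ M p x) (DirectSum.lof k ℕ N q y) = T p q x y := by
  rw [bilin, DirectSum.toModule_lof, LinearMap.flip_apply, DirectSum.toModule_lof,
    LinearMap.flip_apply]

namespace RegUnitalHomAssoc

variable {k A : Type*} [CommRing k] [AddCommGroup A] [Module k A] {R : RegUnitalHomAssoc k A}
  {p q : ℕ}

variable (R) in
/-- The inclusion of the cochains of degree `p`. -/
abbrev inc (p : ℕ) : R.Cochain p →ₗ[k] R.CochainTot := DirectSum.lof k ℕ (fun n => R.Cochain n) p

theorem inc_eq {p p' : ℕ} (h : p = p') {f : R.Cochain p} {f' : R.Cochain p'}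
    (hf : ∀ x, R.op p f x = R.op p' f' x) : R.inc p f = R.inc p' f' := by
  subst h
  rw [op_injective hf]

theorem δ_inc (f : R.Cochain p) : R.δ (R.inc p f) = R.inc (p + 1) (R.coboundary p f) := by
  rw [δ, DirectSum.toModule_lof]
  rfl

theorem cupTot_inc (f : R.Cochain p) (g : R.Cochain q) :
    R.cupTot (R.inc p f) (R.inc q g) = R.inc (p + q) (R.cup p q f g) := by
  rw [cupTot, bilin_lof]
  rfl

theorem bracketTot_inc (f : R.Cochain p) (g : R.Cochain q) :
    R.bracketTot (R.inc p f) (R.inc q g) = R.inc (p + q - 1) (R.bracket p q f g) := by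
  rw [bracketTot, bilin_lof]
  rfl

theorem δ_inc_eq_zero_iff (f : R.Cochain p) : R.δ (R.inc p f) = 0 ↔ ∀ x, dOp f x = 0 := by
  constructor
  · intro h x
    rw [δ_inc] at h
    have h1 : R.coboundary p f = 0 := DirectSum.of_injective (p + 1) (h.trans (map_zero _).symm)
    have h2 := op_coboundary f x
    rw [h1, map_zero, LinearMap.zero_apply] at h2
    have h3 := congrArg (fun z => sgn p • z) h2
    simpa only [smul_zero, smul_smul, Int.units_mul_self, one_smul, eq_comm] using h3
  · intro h
    rw [δ_inc]
    have h1 : R.coboundary p f = 0 := op_injective fun x => by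
      rw [op_coboundary, h, smul_zero, map_zero, LinearMap.zero_apply]
    rw [h1, map_zero]

theorem op_bracket (f : R.Cochain p) (g : R.Cochain q) (x : ChainTot k A) :
    R.op (p + q - 1) (R.bracket p q f g) x = compFrom f g 0 x - sgn₂ p q • compFrom g f 0 x := by
  rw [← op_circ f g rfl, ← op_circ g f (show p + q - 1 = q + p - 1 by omega)]
  have h : R.bracket p q f g = R.circ p q _ rfl f g - sgn₂ p q • R.circ q p _ (by omega) g f := rfl
  rw [h, map_sub, map_sign, LinearMap.sub_apply]
  rfl

/-! ### Operators on chains -/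

/-- The sign (-1)^i is the one carried by `pos`, and the cyclic summand is the product at the last
position. On one letter the sum is zero, matching the convention for b in degree 0. -/
theorem b_eq {N : ℕ} {x : ChainTot k A} (hx : x ∈ letters k A N) :
    R.b x = posSum N R.opMul x := by
  cases N with
  | zero => rw [eq_zero_of_mem_letters_zero hx, map_zero, map_zero]
  | succ n =>
    cases n with
    | zero =>
      obtain ⟨y, rfl⟩ := exists_lof_of_mem_letters hx
      rw [b, DirectSum.toModule_lof, posSum_succ', Finset.sum_range_zero, add_zero,
        opMul_eq_zero hx (by omega)]
      rfl
    | succ n =>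
      rw [posSum_opMul_succ hx]
      obtain ⟨y, rfl⟩ := exists_lof_of_mem_letters hx
      have h1 : R.b (DirectSum.lof k ℕ (fun n => Chain k A n) (n + 1) y) =
          DirectSum.lof k ℕ (fun n => Chain k A n) n (R.boundary n y) := by
        rw [b, DirectSum.toModule_lof]
        rfl
      have h2 : R.boundary n y = ∑ i : Fin (n + 1), Int.negOnePow (i : ℤ) •
          R.act (p := 2) (m := n) (n := n + 1) (by omega) i R.mulCochain y +
          Int.negOnePow ((n : ℤ) + 1) • R.act (p := 2) (m := n) (n := n + 1) (by omega)
            ⟨0, by omega⟩ R.mulCochain (cyc k A (n + 1) y) := by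
        rw [boundary, LinearMap.add_apply, LinearMap.sum_apply]
        rfl
      rw [h1, h2, map_add, map_sum, map_sign, lam_one_lof, map_sign, op_lof (p := 2) _ rfl,
        Nat.cast_succ, posSum_apply,
        ← Fin.sum_univ_eq_sum_range (fun i => pos i R.opMul
          (DirectSum.lof k ℕ (fun n => Chain k A n) (n + 1) y))]
      congr 1
      refine Finset.sum_congr rfl fun i _ => ?_
      have h := pos_op_lof R.mulCochain (m := n) (n := n + 1) rfl i i.2 y
      rw [h, map_sign]
      congr 2
      push_cast; ring

theorem capTot_inc (f : R.Cochain p) (x : ChainTot k A) :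
    R.capTot (R.inc p f) x = sgn p • mulOp f x := by
  refine chainTot_hom_ext (φ := R.capTot (R.inc p f)) (ψ := ((sgn p : ℤˣ) : ℤ) • mulOp f)
    (fun n x hx => ?_) x
  change _ = sgn p • mulOp f x
  by_cases h : p ≤ n
  · rw [← op_comp_mul f (r := p + 1) (by omega)]
    obtain ⟨y, rfl⟩ := exists_lof_of_mem_letters hx
    rw [capTot, bilin_lof, dif_pos h, op_lof (p := p + 1) (m := n - p) _ (by omega)]
    rfl
  · rw [mulOp_eq_zero f (by omega) hx]
    obtain ⟨y, rfl⟩ := exists_lof_of_mem_letters hx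
    rw [capTot, bilin_lof, dif_neg h]
    simp

/-- Appending a unit at the end and rotating once puts it in front, and the signs cancel. -/
theorem lof_cyc_act_last (n : ℕ) (y : Chain k A n) :
    DirectSum.lof k ℕ (fun n => Chain k A n) (n + 1) (cyc k A (n + 1)
      (R.act (p := 0) (m := n + 1) (n := n) (by omega) (Fin.last (n + 1)) R.oneCochain y)) =
      R.opOne (DirectSum.lof k ℕ (fun n => Chain k A n) n y) := by
  have h1 := pos_op_lof R.oneCochain (m := n + 1) (n := n) rfl (n + 1) (by omega) y
  have h2 := congrArg (lam k A 1) h1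
  have hy := lof_mem_letters (k := k) (A := A) n y
  rw [pos_apply, lam_lam,
    ← lam_add_period hy (i := 0) (j := -((n + 1 : ℕ) : ℤ)) (by rw [neg_add_cancel]), lam_zero,
    lam_add_period (opOne_mem hy) (j := 0) (by push_cast; ring), lam_zero, map_sign, lam_one_lof,
    smul_smul, ← Int.negOnePow_add] at h2
  have h3 : ((n + 1 : ℕ) : ℤ) * (((0 : ℕ) : ℤ) - 1) + ((n + 1 : ℕ) : ℤ) = 0 := by push_cast; ring
  rw [h2, h3, Int.negOnePow_zero, one_smul]
  rfl

theorem connesTot_eq {N : ℕ} {x : ChainTot k A} (hx : x ∈ letters k A N) :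
    R.connesTot x = R.connesOp N x := by
  cases N with
  | zero => rw [eq_zero_of_mem_letters_zero hx, map_zero, map_zero]
  | succ n =>
    obtain ⟨y, rfl⟩ := exists_lof_of_mem_letters hx
    have h1 : R.connes n y = ∑ i ∈ Finset.range (n + 1), Int.negOnePow ((i : ℤ) * n) •
        (cyc k A (n + 1) (R.act (p := 0) (m := n + 1) (n := n) (by omega) (Fin.last (n + 1))
          R.oneCochain ((cyc k A n ^ i) y)) - Int.negOnePow ((n : ℤ) + 1) • cyc k A (n + 1)
          (cyc k A (n + 1) (R.act (p := 0) (m := n + 1) (n := n) (by omega) (Fin.last (n + 1))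
          R.oneCochain ((cyc k A n ^ i) y)))) := by
      rw [connes, LinearMap.sum_apply]
      rfl
    have h2 : R.connesTot (DirectSum.lof k ℕ (fun n => Chain k A n) n y) =
        DirectSum.lof k ℕ (fun n => Chain k A n) (n + 1) (R.connes n y) := by
      rw [connesTot, DirectSum.toModule_lof]
      rfl
    have h3 : ∀ z : Chain k A (n + 1), DirectSum.lof k ℕ (fun n => Chain k A n) (n + 1)
        (Int.negOnePow ((n : ℤ) + 1) • cyc k A (n + 1) z) =
        lam k A 1 (DirectSum.lof k ℕ (fun n => Chain k A n) (n + 1) z) := fun z => by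
      rw [lam_one_lof, map_sign, Nat.cast_succ]
    rw [h2, h1, map_sum, connesOp_apply, norm_apply, map_sum, map_sum, ← Finset.sum_sub_distrib]
    refine Finset.sum_congr rfl fun i _ => ?_
    rw [map_sign, map_sub, h3, lof_cyc_act_last, lam_natCast_lof, map_sign, map_sign, smul_sub]

theorem b_mem {N : ℕ} {x : ChainTot k A} (hx : x ∈ letters k A (N + 1)) :
    R.b x ∈ letters k A N := by
  rw [b_eq hx]
  exact posSum_opMul_mem hx rfl

theorem connesOp_mem {N : ℕ} {x : ChainTot k A} (hx : x ∈ letters k A N) (M : ℕ) :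
    R.connesOp M x ∈ letters k A (N + 1) :=
  have h := opOne_mem (R := R) (norm_mem hx M)
  Submodule.sub_mem _ h (lam_mem h 1)

/-- b(1 - λ)EN = (1 - λ)b'EN = (1 - λ)(1 - Eb')N. The first part dies because (1 - λ)N = 0; the
second is -Bb because b'N = Nb. -/
theorem b_connesTot (x : ChainTot k A) : R.b (R.connesTot x) = -R.connesTot (R.b x) := by
  refine chainTot_hom_ext (φ := R.b ∘ₗ R.connesTot) (ψ := -(R.connesTot ∘ₗ R.b))
    (fun n x hx => ?_) x
  change R.b (R.connesTot x) = -R.connesTot (R.b x)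
  have h1 := norm_mem hx (n + 1)
  rw [connesTot_eq hx, connesTot_eq (b_mem hx), b_eq (connesOp_mem hx _), b_eq hx,
    connesOp_apply, connesOp_apply, posSum_opMul_sub_lam (opOne_mem h1), posSum_opMul_opOne h1,
    norm_posSum_opMul hx, map_sub, lam_one_norm hx]
  abel

theorem norm_sub_lam {N : ℕ} {x : ChainTot k A} (hx : x ∈ letters k A N) :
    norm k A N (x - lam k A 1 x) = 0 := by
  rw [map_sub, norm_lam_one hx, sub_self]

/-- B² contains the factor N(1 - λ) = 0. -/
theorem connesTot_connesTot (x : ChainTot k A) : R.connesTot (R.connesTot x) = 0 := by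
  refine chainTot_hom_ext (φ := R.connesTot ∘ₗ R.connesTot) (ψ := 0) (fun n x hx => ?_) x
  change R.connesTot (R.connesTot x) = 0
  have h1 := norm_mem hx (n + 1)
  rw [connesTot_eq hx, connesTot_eq (connesOp_mem hx _), connesOp_apply, connesOp_apply,
    norm_sub_lam (opOne_mem h1)]
  simp

end RegUnitalHomAssoc
end HomHochschild
end

noncomputable section

namespace HomHochschild

namespace RegUnitalHomAssoc

variable {k A : Type*} [CommRing k] [AddCommGroup A] [Module k A] {R : RegUnitalHomAssoc k A}
  {p q : ℕ}

/-! ### The calculus on homology -/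

/-- The Lie derivative along `f` on chains with `N` letters. -/
def lieOp (f : R.Cochain p) (N : ℕ) : ChainTot k A →ₗ[k] ChainTot k A :=
  posSum (N + 1 - p) (R.op p f) + (∑ i ∈ Finset.range p, R.op p f ∘ₗ lam k A i) - R.op p f

theorem lieOp_apply (f : R.Cochain p) (N : ℕ) (x : ChainTot k A) :
    lieOp f N x = posSum (N + 1 - p) (R.op p f) x +
      ∑ i ∈ Finset.range p, R.op p f (lam k A i x) - R.op p f x := by
  rw [lieOp, LinearMap.sub_apply, LinearMap.add_apply, LinearMap.sum_apply]
  rfl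

/-- Take (1 - λ)E applied to the Cartan homotopy Q. By b(1 - λ) = (1 - λ)b' and b'E = 1 - Eb', its
boundary is (1 - λ)Q - (1 - λ)E b'Q, and b'Q is the norm of `mulOp f x`. In `lieOp`, subtracting `f`
removes the unrotated placement counted twice, or, for p = 0, the insertion in front of a_0. -/
theorem exists_b_eq_lieOp (f : R.Cochain p) (hf : ∀ x, dOp f x = 0) {N : ℕ} {x : ChainTot k A}
    (hx : x ∈ letters k A N) (hb : R.b x = 0) :
    ∃ z, R.b z = lieOp f N x - R.op p f (norm k A N x) - R.connesTot (mulOp f x) := by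
  by_cases hN : N < p
  · refine ⟨0, ?_⟩
    rw [mulOp_eq_zero f hN.le hx, op_eq_zero f (norm_mem hx _) hN, lieOp_apply,
      Nat.sub_eq_zero_of_le hN, posSum_zero, op_eq_zero f hx hN,
      Finset.sum_eq_zero fun i _ => op_eq_zero f (lam_mem hx _) hN]
    simp
  · obtain ⟨m, rfl⟩ : ∃ m, N = m + p := ⟨N - p, by omega⟩
    rw [b_eq hx] at hb
    have h1 := posSum_opMul_cartanHomotopy f hf hx hb
    have h2 := sub_lam_cartanHomotopy f hx
    have hQ : cartanHomotopy f m x ∈ letters k A (m + 1) :=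
      Submodule.sum_mem _ fun i _ => Submodule.sum_mem _ fun t _ =>
        lam_mem (op_mem f (lam_mem hx _) (by omega)) _
    have hE := opOne_mem (R := R) hQ
    refine ⟨R.opOne (cartanHomotopy f m x) - lam k A 1 (R.opOne (cartanHomotopy f m x)), ?_⟩
    rw [b_eq (Submodule.sub_mem _ hE (lam_mem hE 1)), posSum_opMul_sub_lam hE,
      posSum_opMul_opOne hQ, h1, lieOp_apply, connesTot_eq (mulOp_mem f rfl hx), connesOp_apply,
      show m + p + 1 - p = m + 1 by omega, ← h2, map_sub]
    abel

theorem mulOp_opOne (f : R.Cochain p) {N : ℕ} {x : ChainTot k A} (hx : x ∈ letters k A N) :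
    mulOp f (R.opOne x) = sgn p • R.op p f x := by
  by_cases hN : N < p
  · rw [op_eq_zero f hx hN, mulOp_eq_zero f hN (opOne_mem hx), smul_zero]
  · have h := op_pos_disjoint R.oneCochain f 0 (by omega) hx
    have h1 : Int.negOnePow (((0 : ℤ) - 1) * ((p : ℤ) - 1)) = sgn p := by
      rw [sgn, Int.negOnePow_eq_iff]
      exact ⟨-(p - 1), by push_cast; ring⟩
    rw [Nat.cast_zero, add_zero, pos_zero, zero_add, h1] at h
    have h2 := congrArg R.opMul h
    rw [opMul_opOne, map_sign] at h2
    rw [h2, smul_smul, Int.units_mul_self, one_smul, mulOp_apply]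

/-- Write B = EN - λEN. Capping the first term with `f` gives f N, as the unit is absorbed. For the
second, w = f(ENx) satisfies b'w = 0, because the two terms of its commutator cancel; hence μλw =
b(λw) is a boundary. -/
theorem exists_b_eq_mulOp_connesTot (f : R.Cochain p) (hf : ∀ x, dOp f x = 0) {N : ℕ}
    {x : ChainTot k A} (hx : x ∈ letters k A N) (hb : R.b x = 0) :
    ∃ z, R.b z = mulOp f (R.connesTot x) - sgn p • R.op p f (norm k A N x) := by
  rw [connesTot_eq hx, connesOp_apply, map_sub, mulOp_opOne f (norm_mem hx N), sub_sub_cancel_left]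
  set y := norm k A N x with hy
  have hym : y ∈ letters k A N := norm_mem hx N
  refine ⟨-lam k A 1 (R.op p f (R.opOne y)), ?_⟩
  rw [map_neg, mulOp_lam_one, neg_inj]
  cases N with
  | zero => rw [eq_zero_of_mem_letters_zero hym]; simp
  | succ M =>
    have hby : posSum M R.opMul y = 0 := by
      rw [hy, ← norm_posSum_opMul hx, ← b_eq hx, hb, map_zero]
    by_cases hN : M + 2 < p
    · rw [op_eq_zero f (opOne_mem hym) hN]
      simp
    · have hw : R.op p f (R.opOne y) ∈ letters k A (M + 3 - p) :=
        op_mem f (opOne_mem hym) (by omega)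
      have h1 := posSum_opMul_op f (opOne_mem (R := R) hym)
      have h3 : R.op p f (posSum (M + 1) R.opMul (R.opOne y)) = R.op p f y := by
        rw [posSum_opMul_opOne hym, hby, map_zero, sub_zero]
      rw [Nat.add_sub_cancel, h3, mulOp_opOne f hym, hf, sub_self, add_zero] at h1
      rw [b_eq (lam_mem hw 1), show M + 3 - p = M + 1 + 1 - p + 1 by omega]
      have h2 := lam_one_posSum_opMul (R := R) (M := M + 1 + 1 - p) (R.op p f (R.opOne y))
      rw [h1, map_zero] at h2
      exact sub_eq_zero.1 h2.symm

theorem sgn₂_succ_left (p q : ℕ) : sgn₂ (q + 1) p = sgn₂ p q * sgn p := by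
  rw [sgn₂, sgn₂, sgn, ← Int.negOnePow_add]
  congr 1
  push_cast; ring

/-- Placing `f` after a_0 · g(…) differs from placing it before capping only where `f` meets the
arguments of the product: inside `g` this gives g ∘ f, and on the first letter the extra terms are
the rotated placements, kept explicit on both sides. -/
theorem lieOp_mulOp (f : R.Cochain p) (g : R.Cochain q) {N : ℕ} (hN : p + q ≤ N)
    {x : ChainTot k A} (hx : x ∈ letters k A N) :
    lieOp f (N - q) (mulOp g x) = (sgn₂ p q * sgn p) • (mulOp g (lieOp f N x) -
      mulOp g (∑ i ∈ Finset.range p, R.op p f (lam k A i x)) -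
      R.opMul (pos 1 (compFrom g f 0) x)) +
      ∑ i ∈ Finset.range p, R.op p f (lam k A i (mulOp g x)) := by
  obtain ⟨s, rfl⟩ : ∃ s, N = s + q + p := ⟨N - (p + q), by omega⟩
  have h1 := posSum_op_op (R.comp (p := 2) (r := q + 1) (by omega) ⟨1, by omega⟩ R.mulCochain g) f
    (s := s) (by omega) hx
  simp only [op_comp_mul, map_sign, sgn₂_succ_left, mulOp_posSum_succ] at h1
  rw [lieOp_apply, lieOp_apply, show s + q + p - q + 1 - p = s + 1 by omega,
    show s + q + p + 1 - p = q + 1 + s by omega]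
  simp only [map_sub, map_add]
  rcases Int.units_eq_one_or (sgn p) with hs | hs <;>
  rcases Int.units_eq_one_or (sgn q) with hs' | hs' <;>
  rcases Int.units_eq_one_or (sgn₂ p q) with hs'' | hs'' <;>
  simp only [hs, hs', hs'', one_smul, Units.neg_smul, neg_neg, _root_.one_mul, neg_mul] at h1 ⊢ <;>
  first
  | linear_combination (norm := module) h1
  | linear_combination (norm := module) -h1

theorem capTot_bracketTot (f : R.Cochain p) (g : R.Cochain q) (x : ChainTot k A) :
    R.capTot (R.bracketTot (R.inc p f) (R.inc q g)) x = (sgn p * sgn q) •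
      (R.opMul (pos 1 (compFrom f g 0) x) - sgn₂ p q • R.opMul (pos 1 (compFrom g f 0) x)) := by
  have h : mulOp (R.bracket p q f g) x = R.opMul (pos 1 (compFrom f g 0) x) -
      sgn₂ p q • R.opMul (pos 1 (compFrom g f 0) x) := by
    rw [mulOp_apply, pos_apply, op_bracket, map_sub, map_sub, map_sign, map_sign]
    rfl
  rw [bracketTot_inc, capTot_inc, h]
  -- Here p + q - 1 is truncated and the sign rule for `sgn` fails, but both compositions are empty
  -- sums.
  by_cases hpq : p + q = 0
  · obtain ⟨rfl, rfl⟩ : p = 0 ∧ q = 0 := by omega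
    simp [pos_apply, compFrom_self]
  · rw [sgn_comp (p := p) (q := q) (r := p + q - 1) (by omega)]

theorem mulOp_b (f : R.Cochain p) (hf : ∀ x, dOp f x = 0) (x : ChainTot k A) :
    mulOp f (R.b x) = -(sgn p • R.b (mulOp f x)) := by
  refine chainTot_hom_ext (φ := mulOp f ∘ₗ R.b) (ψ := -(((sgn p : ℤˣ) : ℤ) • (R.b ∘ₗ mulOp f)))
    (fun n x hx => ?_) x
  change _ = -(sgn p • R.b (mulOp f x))
  by_cases hn : n + 1 < p
  · rw [mulOp_eq_zero f hn.le hx, LinearMap.comp_apply, b_eq hx,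
      mulOp_eq_zero f (by omega) (posSum_opMul_mem' hx)]
    simp
  · have h := posSum_opMul_mulOp' f hx
    rw [LinearMap.comp_apply, b_eq hx, b_eq (mulOp_mem f (M := n + 1 - p) (by omega) hx), h,
      pos_apply, hf]
    simp [smul_smul]

theorem mulOp_mem' (f : R.Cochain p) {N : ℕ} {x : ChainTot k A} (hx : x ∈ letters k A N) :
    mulOp f x ∈ letters k A (N - p) := by
  by_cases hN : N < p
  · rw [mulOp_eq_zero f hN.le hx]; exact Submodule.zero_mem _
  · exact mulOp_mem f (by omega) hx

theorem mulOp_connesTot_mulOp_eq_zero (f : R.Cochain p) (g : R.Cochain q) {N : ℕ}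
    (hN : N < p + q) {x : ChainTot k A} (hx : x ∈ letters k A N) :
    mulOp f (R.connesTot (mulOp g x)) = 0 := by
  by_cases hq : N ≤ q
  · rw [mulOp_eq_zero g hq hx, map_zero, map_zero]
  · have hu := mulOp_mem' g hx
    rw [connesTot_eq hu]
    exact mulOp_eq_zero f (by omega) (connesOp_mem hu _)

/-- The commutator of the Lie derivative along `f` with the cap product by `g` is, up to a boundary,
the cap product by `[f, g]`. -/
theorem exists_b_eq_capTot_bracketTot (f : R.Cochain p) (g : R.Cochain q) (hf : ∀ x, dOp f x = 0)
    (hg : ∀ x, dOp g x = 0) {N : ℕ} {x : ChainTot k A} (hx : x ∈ letters k A N)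
    (hb : R.b x = 0) :
    ∃ z, R.b z = R.capTot (R.bracketTot (R.inc p f) (R.inc q g)) x -
      (R.capTot (R.inc p f) (R.connesTot (R.capTot (R.inc q g) x)) +
      sgn p • R.connesTot (R.capTot (R.inc p f) (R.capTot (R.inc q g) x)) -
      (sgn₂ p q * sgn p) • R.capTot (R.inc q g) (R.capTot (R.inc p f) (R.connesTot x)) -
      sgn₂ p q • R.capTot (R.inc q g) (R.connesTot (R.capTot (R.inc p f) x))) := by
  have hu := mulOp_mem' g hx
  have hbu : R.b (mulOp g x) = 0 := by
    have h := mulOp_b g hg x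
    rw [hb, map_zero] at h
    have h1 := congrArg (fun z => sgn q • z) h
    simpa [smul_smul, eq_comm] using h1
  rw [capTot_bracketTot]
  simp only [capTot_inc, map_sign]
  by_cases hN : p + q ≤ N
  swap
  · refine ⟨0, ?_⟩
    have hBx : R.connesTot x ∈ letters k A (N + 1) := by
      rw [connesTot_eq hx]
      exact connesOp_mem hx N
    rw [opMul_pos_compFrom_eq_zero f g (by omega) hx, opMul_pos_compFrom_eq_zero g f (by omega) hx,
      mulOp_connesTot_mulOp_eq_zero f g (by omega) hx,
      mulOp_connesTot_mulOp_eq_zero g f (by omega) hx, mulOp_eq_zero f (by omega) hu,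
      mulOp_eq_zero g (by omega) (mulOp_mem' f hBx)]
    simp
  -- Both halves of the Cartan formula are needed at x and at the cycle `mulOp g x`; the terms with
  -- the norm cancel between the halves.
  obtain ⟨z₁, h₁⟩ := exists_b_eq_lieOp f hf hx hb
  obtain ⟨z₂, h₂⟩ := exists_b_eq_lieOp f hf hu hbu
  obtain ⟨z₃, h₃⟩ := exists_b_eq_mulOp_connesTot f hf hx hb
  obtain ⟨z₄, h₄⟩ := exists_b_eq_mulOp_connesTot f hf hu hbu
  obtain ⟨z₅, hz₅, h₅⟩ := exists_boundary_compFrom f g hf hg hx (by rw [← b_eq hx, hb])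
  have h₆ := lieOp_mulOp f g hN hx
  have h₇ : R.b (mulOp g z₁) = -(sgn q • (mulOp g (lieOp f N x) -
      mulOp g (R.op p f (norm k A N x)) - mulOp g (R.connesTot (mulOp f x)))) := by
    rw [← map_sub, ← map_sub, ← h₁, mulOp_b g hg, smul_neg, smul_smul, Int.units_mul_self,
      one_smul, neg_neg]
  have h₈ : R.b (mulOp g z₃) = -(sgn q • (mulOp g (mulOp f (R.connesTot x)) -
      sgn p • mulOp g (R.op p f (norm k A N x)))) := by
    rw [← map_sign, ← map_sub, ← h₃, mulOp_b g hg, smul_neg, smul_smul, Int.units_mul_self,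
      one_smul, neg_neg]
  have h₉ : R.b z₅ = sgn p • ∑ i ∈ Finset.range p, R.op p f (lam k A i (mulOp g x)) -
      sgn₂ p q • mulOp g (∑ i ∈ Finset.range p, R.op p f (lam k A i x)) -
      R.opMul (pos 1 (compFrom f g 0) x) := by
    rw [← h₅, b_eq hz₅]
  refine ⟨sgn q • (z₂ - sgn p • z₄ - sgn p • z₅) + (sgn₂ p q * sgn p) • mulOp g z₁ -
    sgn₂ p q • mulOp g z₃, ?_⟩
  rw [map_sub, map_add, map_sign, map_sub, map_sub, map_sign, map_sign, map_sign, map_sign, h₂, h₄,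
    h₉, h₇, h₈, h₆]
  generalize sgn p = a, sgn q = b, sgn₂ p q = c
  rcases Int.units_eq_one_or a with hs | hs <;>
  rcases Int.units_eq_one_or b with hs' | hs' <;>
  rcases Int.units_eq_one_or c with hs'' | hs'' <;>
  simp only [hs, hs', hs'', one_smul, Units.neg_smul, neg_neg, _root_.one_mul, neg_mul] <;>
  abel

end RegUnitalHomAssoc
end HomHochschild
end

noncomputable section

namespace HomHochschild

/-! ## Homology -/

/-! ### Maps induced on homology -/

section Induced

variable {k C D E : Type*} [CommRing k] [AddCommGroup C] [Module k C] [AddCommGroup D] [Module k D]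
  [AddCommGroup E] [Module k E]

theorem cls_surjective (d : C →ₗ[k] C) (x : Homology d) : ∃ z, cls d z = x :=
  Submodule.mkQ_surjective _ x

theorem cls_eq_zero_iff {d : C →ₗ[k] C} (x : LinearMap.ker d) :
    cls d x = 0 ↔ ∃ z, d z = x := by
  rw [cls, Submodule.mkQ_apply, Submodule.Quotient.mk_eq_zero]
  rfl

/-- `T` need not commute with the differentials; it is enough that it preserves cycles and sends
boundaries to boundaries, which covers anticommuting maps such as B. -/
theorem induces_induced {dC : C →ₗ[k] C} {dD : D →ₗ[k] D} {T : C →ₗ[k] D}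
    (h0 : ∀ x, dC x = 0 → dD (T x) = 0) (h1 : ∀ x, ∃ z, dD z = T (dC x)) :
    Induces dC dD T (induced dC dD T) := by
  have h : ∃ T', Induces dC dD T T' := by
    refine ⟨Submodule.liftQ _ (cls dD ∘ₗ T.restrict h0) ?_, fun x => ⟨h0 x x.2, ?_⟩⟩
    · rintro x ⟨z, hz⟩
      obtain ⟨w, hw⟩ := h1 z
      refine (cls_eq_zero_iff _).2 ⟨w, ?_⟩
      rw [hw, hz]
      rfl
    · exact Submodule.liftQ_apply _ _ _
  rw [induced, dif_pos h]
  exact h.choose_spec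

theorem induces₂_induced₂ {dC : C →ₗ[k] C} {dD : D →ₗ[k] D} {dE : E →ₗ[k] E}
    {T : C →ₗ[k] D →ₗ[k] E} (h0 : ∀ x y, dC x = 0 → dD y = 0 → dE (T x y) = 0)
    (h1 : ∀ x y, dD y = 0 → ∃ z, dE z = T (dC x) y)
    (h2 : ∀ x y, dC x = 0 → ∃ z, dE z = T x (dD y)) :
    Induces₂ dC dD dE T (induced₂ dC dD dE T) := by
  have h : ∃ T', Induces₂ dC dD dE T T' := by
    let φ : LinearMap.ker dC →ₗ[k] LinearMap.ker dD →ₗ[k] Homology dE :=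
      LinearMap.mk₂ k (fun x y => cls dE ⟨T x y, h0 x y x.2 y.2⟩)
        (fun x x' y => by
          rw [← map_add]
          exact congrArg _ (Subtype.ext (by simp)))
        (fun c x y => by
          rw [← map_smul]
          exact congrArg _ (Subtype.ext (by simp)))
        (fun x y y' => by
          rw [← map_add]
          exact congrArg _ (Subtype.ext (by simp)))
        (fun c x y => by
          rw [← map_smul]
          exact congrArg _ (Subtype.ext (by simp)))
    have hφ : ∀ x y, φ x y = cls dE ⟨T x y, h0 x y x.2 y.2⟩ := fun _ _ => rfl
    let ψ : Homology dC →ₗ[k] LinearMap.ker dD →ₗ[k] Homology dE := Submodule.liftQ _ φ (by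
      rintro x ⟨z, hz⟩
      refine LinearMap.ext fun y => ?_
      obtain ⟨w, hw⟩ := h1 z y y.2
      rw [hφ]
      refine (cls_eq_zero_iff _).2 ⟨w, ?_⟩
      rw [hw, hz]
      rfl)
    have hψ : ∀ x, ψ (cls dC x) = φ x := fun x => Submodule.liftQ_apply _ _ _
    have hψ' : (LinearMap.range dD).submoduleOf (LinearMap.ker dD) ≤ LinearMap.ker ψ.flip := by
      rintro y ⟨z, hz⟩
      refine LinearMap.ext fun x => ?_
      obtain ⟨x, rfl⟩ := cls_surjective dC x
      obtain ⟨w, hw⟩ := h2 x z x.2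
      rw [LinearMap.flip_apply, hψ, hφ]
      refine (cls_eq_zero_iff _).2 ⟨w, ?_⟩
      rw [hw, hz]
      rfl
    refine ⟨(Submodule.liftQ _ ψ.flip hψ').flip, fun x y => ⟨h0 x y x.2 y.2, ?_⟩⟩
    rw [← hφ, ← hψ]
    rfl
  rw [induced₂, dif_pos h]
  exact h.choose_spec

end Induced

/-! ### The grading of homology -/

section Graded

variable {k : Type*} [CommRing k] {M : ℕ → Type*} [∀ m, AddCommGroup (M m)] [∀ m, Module k (M m)]

variable (k M) in
/-- The projection to the component of degree `n ∈ ℤ`. -/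
def homProj (n : ℤ) : DirectSum ℕ M →ₗ[k] DirectSum ℕ M :=
  DirectSum.toModule k ℕ _ fun m => if (m : ℤ) = n then DirectSum.lof k ℕ M m else 0

theorem homogeneous_induction {C : DirectSum ℕ M → Prop} (h0 : C 0)
    (hadd : ∀ x y, C x → C y → C (x + y)) (h : ∀ (n : ℕ) (y : M n), C (DirectSum.lof k ℕ M n y))
    (x : DirectSum ℕ M) : C x := by
  induction x using DirectSum.induction_on with
  | zero => exact h0
  | of n y => exact h n y
  | add x y hx hy => exact hadd x y hx hy

theorem homProj_self {n : ℤ} {x : DirectSum ℕ M} (hx : x ∈ homogeneous k M n) :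
    homProj k M n x = x := by
  rcases lt_or_ge n 0 with hn | hn
  · rw [homogeneous_of_neg hn hx, map_zero]
  · lift n to ℕ using hn
    rw [exists_lof_of_mem_homogeneous hx, homProj, DirectSum.toModule_lof, if_pos rfl]

theorem homProj_of_ne {n m : ℤ} (h : m ≠ n) {x : DirectSum ℕ M} (hx : x ∈ homogeneous k M m) :
    homProj k M n x = 0 := by
  rcases lt_or_ge m 0 with hm | hm
  · rw [homogeneous_of_neg hm hx, map_zero]
  · lift m to ℕ using hm
    rw [exists_lof_of_mem_homogeneous hx, homProj, DirectSum.toModule_lof, if_neg h,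
      LinearMap.zero_apply]

theorem homProj_mem (n : ℤ) (x : DirectSum ℕ M) : homProj k M n x ∈ homogeneous k M n := by
  refine homogeneous_induction (k := k) (C := fun x => homProj k M n x ∈ homogeneous k M n)
    (by rw [map_zero]; exact Submodule.zero_mem _)
    (fun x y hx hy => by rw [map_add]; exact Submodule.add_mem _ hx hy) (fun m y => ?_) x
  rw [homProj, DirectSum.toModule_lof]
  split_ifs with h
  · exact lof_mem_homogeneous h.symm y
  · exact Submodule.zero_mem _

variable (k) in
theorem exists_sum_homProj (x : DirectSum ℕ M) :
    ∃ s : Finset ℤ, ∀ t, s ⊆ t → ∑ n ∈ t, homProj k M n x = x := by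
  refine homogeneous_induction (k := k)
    (C := fun x => ∃ s : Finset ℤ, ∀ t, s ⊆ t → ∑ n ∈ t, homProj k M n x = x) ⟨∅, by simp⟩
    (fun x y ⟨s, hs⟩ ⟨t, ht⟩ => ⟨s ∪ t, fun u hu => ?_⟩) (fun m y => ⟨{(m : ℤ)}, fun t ht => ?_⟩) x
  · simp only [map_add, Finset.sum_add_distrib]
    rw [hs u (Finset.union_subset_left hu), ht u (Finset.union_subset_right hu)]
  · have hy := lof_mem_homogeneous (k := k) (M := M) (z := m) rfl y
    rw [Finset.sum_eq_single (m : ℤ) (fun n _ hn => homProj_of_ne hn.symm hy)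
      (fun h => absurd (ht (Finset.mem_singleton_self _)) h), homProj_self hy]

variable {d : DirectSum ℕ M →ₗ[k] DirectSum ℕ M} {e : ℤ}

theorem homProj_comm (hd : ∀ n x, x ∈ homogeneous k M n → d x ∈ homogeneous k M (n + e)) (n : ℤ)
    (x : DirectSum ℕ M) : homProj k M (n + e) (d x) = d (homProj k M n x) := by
  refine homogeneous_induction (k := k)
    (C := fun x => homProj k M (n + e) (d x) = d (homProj k M n x)) (by simp)
    (fun x y hx hy => by simp only [map_add, hx, hy]) (fun m y => ?_) x
  have hy := lof_mem_homogeneous (k := k) (M := M) (z := m) rfl y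
  by_cases h : (m : ℤ) = n
  · subst h
    rw [homProj_self hy, homProj_self (hd _ _ hy)]
  · rw [homProj_of_ne h hy, homProj_of_ne (by simpa using h) (hd _ _ hy), map_zero]

theorem homProj_comm' (hd : ∀ n x, x ∈ homogeneous k M n → d x ∈ homogeneous k M (n + e)) (n : ℤ)
    (x : DirectSum ℕ M) : homProj k M n (d x) = d (homProj k M (n - e) x) := by
  rw [← homProj_comm hd, sub_add_cancel]

theorem exists_cls_of_mem_homologyDeg {n : ℤ} {x : Homology d} (hx : x ∈ homologyDeg d n) :
    ∃ (z : DirectSum ℕ M) (h : d z = 0), z ∈ homogeneous k M n ∧ x = cls d ⟨z, h⟩ := by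
  obtain ⟨z, hz, rfl⟩ := hx
  exact ⟨z, z.2, hz, rfl⟩

theorem cls_mem_homologyDeg {n : ℤ} {z : LinearMap.ker d}
    (hz : (z : DirectSum ℕ M) ∈ homogeneous k M n) :
    cls d z ∈ homologyDeg d n := ⟨z, hz, rfl⟩

theorem homologyDeg_of_neg {n : ℤ} (hn : n < 0) {x : Homology d} (hx : x ∈ homologyDeg d n) :
    x = 0 := by
  obtain ⟨z, h, hz, rfl⟩ := exists_cls_of_mem_homologyDeg hx
  have : (⟨z, h⟩ : LinearMap.ker d) = 0 := Subtype.ext (homogeneous_of_neg hn hz)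
  rw [this, map_zero]

theorem exists_lof_of_mem_homologyDeg {n : ℕ} {x : Homology d} (hx : x ∈ homologyDeg d n) :
    ∃ (y : M n) (h : d (DirectSum.lof k ℕ M n y) = 0), x = cls d ⟨_, h⟩ := by
  obtain ⟨z, h, hz, rfl⟩ := exists_cls_of_mem_homologyDeg hx
  obtain ⟨y, rfl⟩ : ∃ y, z = DirectSum.lof k ℕ M n y := ⟨_, exists_lof_of_mem_homogeneous hz⟩
  exact ⟨y, h, rfl⟩

variable (d) in
/-- The projection of the homology to its part of degree `n`. -/
def homologyProj (n : ℤ) : Homology d →ₗ[k] Homology d := induced d d (homProj k M n)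

theorem induces_homologyProj
    (hd : ∀ n x, x ∈ homogeneous k M n → d x ∈ homogeneous k M (n + e)) (n : ℤ) :
    Induces d d (homProj k M n) (homologyProj d n) :=
  induces_induced (fun x hx => by
    have := homProj_comm hd n x
    rw [hx, map_zero] at this
    exact this.symm) fun x => ⟨_, (homProj_comm' hd n x).symm⟩

theorem homologyProj_self
    (hd : ∀ n x, x ∈ homogeneous k M n → d x ∈ homogeneous k M (n + e)) {n : ℤ} {x : Homology d}
    (hx : x ∈ homologyDeg d n) : homologyProj d n x = x := by
  obtain ⟨z, h, hz, rfl⟩ := exists_cls_of_mem_homologyDeg hx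
  obtain ⟨h', h2⟩ := induces_homologyProj hd n ⟨z, h⟩
  rw [h2]
  exact congrArg _ (Subtype.ext (homProj_self hz))

theorem homologyProj_of_ne
    (hd : ∀ n x, x ∈ homogeneous k M n → d x ∈ homogeneous k M (n + e)) {n m : ℤ} (hnm : m ≠ n)
    {x : Homology d} (hx : x ∈ homologyDeg d m) : homologyProj d n x = 0 := by
  obtain ⟨z, h, hz, rfl⟩ := exists_cls_of_mem_homologyDeg hx
  obtain ⟨h', h2⟩ := induces_homologyProj hd n ⟨z, h⟩
  rw [h2, ← map_zero (cls d)]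
  exact congrArg _ (Subtype.ext (homProj_of_ne hnm hz))

theorem homologyProj_mem
    (hd : ∀ n x, x ∈ homogeneous k M n → d x ∈ homogeneous k M (n + e)) (n : ℤ)
    (x : Homology d) : homologyProj d n x ∈ homologyDeg d n := by
  obtain ⟨z, rfl⟩ := cls_surjective d x
  obtain ⟨h', h2⟩ := induces_homologyProj hd n z
  rw [h2]
  exact cls_mem_homologyDeg (homProj_mem _ _)

theorem exists_sum_homologyProj
    (hd : ∀ n x, x ∈ homogeneous k M n → d x ∈ homogeneous k M (n + e)) (x : Homology d) :
    ∃ s : Finset ℤ, ∑ n ∈ s, homologyProj d n x = x := by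
  obtain ⟨z, rfl⟩ := cls_surjective d x
  obtain ⟨s, hs⟩ := exists_sum_homProj k (z : DirectSum ℕ M)
  refine ⟨s, ?_⟩
  choose h' h2 using fun n => induces_homologyProj hd n z
  simp only [h2, ← map_sum]
  refine congrArg _ (Subtype.ext ?_)
  simpa using hs s subset_rfl

theorem homology_induction
    (hd : ∀ n x, x ∈ homogeneous k M n → d x ∈ homogeneous k M (n + e)) {C : Homology d → Prop}
    (h0 : C 0) (hadd : ∀ x y, C x → C y → C (x + y))
    (h : ∀ (n : ℤ) (x), x ∈ homologyDeg d n → C x) (x : Homology d) : C x := by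
  obtain ⟨s, hs⟩ := exists_sum_homologyProj hd x
  rw [← hs]
  exact Finset.sum_induction _ C (fun _ _ => hadd _ _) h0 fun n _ => h n _ (homologyProj_mem hd n x)

/-- The projections of the total complex intertwine d with a shift of degree, hence descend; every
element is a finite sum of its projections, and the projections recover the components. -/
theorem isInternal_homologyDeg
    (hd : ∀ n x, x ∈ homogeneous k M n → d x ∈ homogeneous k M (n + e)) :
    DirectSum.IsInternal (homologyDeg d) := by
  constructor
  · rw [injective_iff_map_eq_zero]
    intro x hx
    refine DFinsupp.ext fun n => Subtype.ext ?_
    have h : ∀ y : DirectSum ℤ fun n => homologyDeg d n, homologyProj d n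
        (DirectSum.coeAddMonoidHom (homologyDeg d) y) = y n := by
      intro y
      induction y using DirectSum.induction_on with
      | zero => simp
      | of m y =>
        rw [DirectSum.coeAddMonoidHom_of]
        by_cases h : m = n
        · subst h
          rw [homologyProj_self hd y.2, DirectSum.of_eq_same]
        · rw [homologyProj_of_ne hd h y.2, DirectSum.of_eq_of_ne _ _ _ (Ne.symm h)]
          rfl
      | add y z hy hz => rw [map_add, map_add, hy, hz]; rfl
    rw [← h, hx, map_zero]
    rfl
  · intro x
    obtain ⟨s, hs⟩ := exists_sum_homologyProj hd x
    refine ⟨∑ n ∈ s, DirectSum.of (fun n => homologyDeg d n) n ⟨_, homologyProj_mem hd n x⟩, ?_⟩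
    rw [map_sum]
    simpa only [DirectSum.coeAddMonoidHom_of] using hs

end Graded
end HomHochschild
end

noncomputable section

namespace HomHochschild

namespace RegUnitalHomAssoc

variable {k A : Type*} [CommRing k] [AddCommGroup A] [Module k A] {R : RegUnitalHomAssoc k A}
  {p q : ℕ}

/-! ### Operations on the total complexes -/

variable (R) in
/-- The operators of all cochains. -/
def opTot : R.CochainTot →ₗ[k] ChainTot k A →ₗ[k] ChainTot k A :=
  DirectSum.toModule k ℕ _ R.op

theorem opTot_inc (f : R.Cochain p) : R.opTot (R.inc p f) = R.op p f := by
  rw [opTot, DirectSum.toModule_lof]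

/-- Reduces an identity of homogeneous cochains to chains with n + 1 letters, where the commutator
formulas have all the letters they require. -/
theorem opTot_ext {n : ℤ} {u v : R.CochainTot}
    (hu : u ∈ homogeneous k (fun n => R.Cochain n) n)
    (hv : v ∈ homogeneous k (fun n => R.Cochain n) n)
    (h : ∀ x ∈ letters k A (n.toNat + 1), R.opTot u x = R.opTot v x) : u = v := by
  rcases lt_or_ge n 0 with hn | hn
  · rw [homogeneous_of_neg hn hu, homogeneous_of_neg hn hv]
  lift n to ℕ using hn
  obtain ⟨f, rfl⟩ : ∃ f, u = R.inc n f := ⟨_, exists_lof_of_mem_homogeneous hu⟩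
  obtain ⟨g, rfl⟩ : ∃ g, v = R.inc n g := ⟨_, exists_lof_of_mem_homogeneous hv⟩
  rw [opTot_inc, opTot_inc, Int.toNat_natCast] at h
  congr 1
  refine R.cochain_ext fun y => ?_
  have := h _ (lof_mem_letters n y)
  rw [op_lof f (m := 1) (by omega), op_lof g (m := 1) (by omega)] at this
  exact DirectSum.of_injective _ this

theorem cochainTot_induction {C : R.CochainTot → Prop} (h0 : C 0)
    (hadd : ∀ x y, C x → C y → C (x + y)) (h : ∀ (n : ℕ) (f : R.Cochain n), C (R.inc n f))
    (u : R.CochainTot) : C u :=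
  homogeneous_induction h0 hadd h u

theorem inc_mem (f : R.Cochain p) {n : ℤ} (h : n = p) :
    R.inc p f ∈ homogeneous k (fun n => R.Cochain n) n := lof_mem_homogeneous h f

variable (R) in
/-- The sign `(-1)^(p-1)` on cochains of degree `p`. -/
def twist : R.CochainTot →ₗ[k] R.CochainTot :=
  DirectSum.toModule k ℕ _ fun p => ((sgn p : ℤˣ) : ℤ) • R.inc p

theorem twist_inc (f : R.Cochain p) : R.twist (R.inc p f) = sgn p • R.inc p f := by
  rw [twist, DirectSum.toModule_lof]
  rfl

theorem twist_twist (u : R.CochainTot) : R.twist (R.twist u) = u := by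
  refine cochainTot_induction (C := fun u => R.twist (R.twist u) = u) (by simp)
    (fun x y hx hy => by simp only [map_add, hx, hy]) (fun n f => ?_) u
  rw [twist_inc, map_sign, twist_inc, smul_smul, Int.units_mul_self, one_smul]

theorem δ_twist (u : R.CochainTot) : R.δ (R.twist u) = -R.twist (R.δ u) := by
  refine cochainTot_induction (C := fun u => R.δ (R.twist u) = -R.twist (R.δ u)) (by simp)
    (fun x y hx hy => by simp only [map_add, hx, hy, neg_add]) (fun n f => ?_) u
  rw [twist_inc, map_sign, δ_inc, twist_inc, sgn_succ, Units.neg_smul, neg_neg]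

theorem opTot_δ_inc (f : R.Cochain p) (x : ChainTot k A) :
    R.opTot (R.δ (R.inc p f)) x = sgn p • dOp f x := by
  rw [δ_inc, opTot_inc, op_coboundary]

theorem δ_mem {n : ℤ} {u : R.CochainTot} (hu : u ∈ homogeneous k (fun n => R.Cochain n) n) :
    R.δ u ∈ homogeneous k (fun n => R.Cochain n) (n + 1) := by
  rcases lt_or_ge n 0 with hn | hn
  · rw [homogeneous_of_neg hn hu, map_zero]; exact Submodule.zero_mem _
  lift n to ℕ using hn
  obtain ⟨f, rfl⟩ : ∃ f, u = R.inc n f := ⟨_, exists_lof_of_mem_homogeneous hu⟩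
  rw [δ_inc]
  exact inc_mem _ (by push_cast; rfl)

theorem mulOp_coboundary (f : R.Cochain p) (x : ChainTot k A) :
    mulOp (R.coboundary p f) x = sgn p • R.opMul (pos 1 (dOp f) x) := by
  rw [mulOp_apply, pos_apply, op_coboundary, map_sign, map_sign]
  rfl

theorem δ_cupTot_inc (f : R.Cochain p) (g : R.Cochain q) :
    R.δ (R.cupTot (R.inc p f) (R.inc q g)) = R.cupTot (R.inc p f) (R.δ (R.inc q g)) -
      sgn q • R.cupTot (R.δ (R.inc p f)) (R.inc q g) := by
  rw [cupTot_inc, δ_inc f, δ_inc g, cupTot_inc, cupTot_inc]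
  refine opTot_ext (n := p + q + 1) (δ_mem (inc_mem _ (by push_cast; ring)))
    (Submodule.sub_mem _ (inc_mem _ (by push_cast; ring)) ?_) fun x _ => ?_
  · rw [Units.smul_def]
    exact zsmul_mem (inc_mem _ (by push_cast; ring)) _
  · rw [opTot_δ_inc, map_sub, map_sign, LinearMap.sub_apply, Units.smul_def, LinearMap.smul_apply,
      ← Units.smul_def, opTot_inc, opTot_inc, op_cup, op_cup, op_coboundary, mulOp_coboundary,
      dOp_cup, sgn_add, map_sign, sgn_succ]
    rcases Int.units_eq_one_or (sgn p) with hs | hs <;>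
    rcases Int.units_eq_one_or (sgn q) with hs' | hs' <;>
    simp only [hs, hs', one_smul, Units.neg_smul, neg_neg, _root_.one_mul, neg_mul] <;>
    abel

/-- The Leibniz sign depends on the degree of the second factor; `twist` makes it part of a bilinear
identity on inhomogeneous cochains. -/
theorem δ_cupTot (u v : R.CochainTot) :
    R.δ (R.cupTot u v) = R.cupTot u (R.δ v) - R.cupTot (R.δ u) (R.twist v) := by
  refine cochainTot_induction (C := fun u => R.δ (R.cupTot u v) = R.cupTot u (R.δ v) -
    R.cupTot (R.δ u) (R.twist v)) (by simp) (fun x y hx hy => ?_) (fun p f => ?_) u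
  · simp only [map_add, LinearMap.add_apply, hx, hy]; abel
  refine cochainTot_induction (C := fun v => R.δ (R.cupTot (R.inc p f) v) =
    R.cupTot (R.inc p f) (R.δ v) - R.cupTot (R.δ (R.inc p f)) (R.twist v)) (by simp)
    (fun x y hx hy => ?_) (fun q g => ?_) v
  · simp only [map_add, hx, hy]; abel
  · rw [δ_cupTot_inc, twist_inc, map_sign]

theorem compFrom_coboundary_left (f : R.Cochain p) (g : R.Cochain q) (x : ChainTot k A) :
    compFrom (R.coboundary p f) g 0 x = sgn p • dOp f (posSum (p + 1) (R.op q g) x) := by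
  rw [compFrom_zero, op_coboundary]

theorem compFrom_coboundary_right (f : R.Cochain p) (g : R.Cochain q) (x : ChainTot k A) :
    compFrom f (R.coboundary q g) 0 x = sgn q • R.op p f (posSum p (dOp g) x) := by
  rw [compFrom_zero, ← map_sign]
  congr 1
  rw [posSum_apply, posSum_apply, Finset.smul_sum]
  refine Finset.sum_congr rfl fun i _ => ?_
  rw [pos_apply, op_coboundary, map_sign]
  rfl

/-- The formula for the coboundary of f ∘ g has a defect made of the two cup products. It is
symmetric in the graded sense, so it cancels in the bracket. -/
theorem op_bracket_coboundary (f : R.Cochain p) (g : R.Cochain q) {N : ℕ} (hN : p + q ≤ N)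
    {x : ChainTot k A} (hx : x ∈ letters k A N) :
    R.opMul (R.op (p + q - 1) (R.bracket p q f g) x) +
      R.opMul (pos 1 (R.op (p + q - 1) (R.bracket p q f g)) x) -
      (sgn p * sgn q) • R.op (p + q - 1) (R.bracket p q f g) (posSum (p + q - 1) R.opMul x) =
    sgn p • R.op (p + 1 + q - 1) (R.bracket (p + 1) q (R.coboundary p f) g) x +
      (sgn p * sgn q) • R.op (p + (q + 1) - 1) (R.bracket p (q + 1) f (R.coboundary q g)) x := by
  have h1 := compFrom_coboundary f g hN hx
  have h2 := compFrom_coboundary g f (by omega) hx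
  have h3 : sgn₂ p (q + 1) = sgn₂ p q * sgn p := by rw [sgn₂_comm, sgn₂_succ_left]
  have h4 : sgn₂ (p + 1) q = sgn₂ p q * sgn q := by rw [sgn₂_succ_left, sgn₂_comm]
  rw [add_comm q p, sgn₂_comm q p] at h2
  simp only [pos_apply, op_bracket, compFrom_coboundary_left, compFrom_coboundary_right, map_sub,
    map_sign, h3, h4] at h1 h2 ⊢
  rcases Int.units_eq_one_or (sgn p) with hs | hs <;>
  rcases Int.units_eq_one_or (sgn q) with hs' | hs' <;>
  rcases Int.units_eq_one_or (sgn₂ p q) with hs'' | hs'' <;>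
  simp only [hs, hs', hs'', one_smul, Units.neg_smul, neg_neg, _root_.one_mul, neg_mul] at h1 h2 ⊢
  all_goals first
  | linear_combination (norm := module) h1 - h2
  | linear_combination (norm := module) h1 + h2

theorem bracket_zero_zero (f g : R.Cochain 0) : R.bracket 0 0 f g = 0 := by
  refine op_injective fun x => ?_
  rw [op_bracket, compFrom_self, compFrom_self, map_zero]
  simp

theorem bracketTot_mem {n m : ℤ} {u v : R.CochainTot}
    (hu : u ∈ homogeneous k (fun n => R.Cochain n) n)
    (hv : v ∈ homogeneous k (fun n => R.Cochain n) m) :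
    R.bracketTot u v ∈ homogeneous k (fun n => R.Cochain n) (n + m - 1) := by
  rcases lt_or_ge n 0 with hn | hn
  · rw [homogeneous_of_neg hn hu, map_zero]; exact Submodule.zero_mem _
  rcases lt_or_ge m 0 with hm | hm
  · rw [homogeneous_of_neg hm hv, map_zero]; exact Submodule.zero_mem _
  lift n to ℕ using hn
  lift m to ℕ using hm
  obtain ⟨f, rfl⟩ : ∃ f, u = R.inc n f := ⟨_, exists_lof_of_mem_homogeneous hu⟩
  obtain ⟨g, rfl⟩ : ∃ g, v = R.inc m g := ⟨_, exists_lof_of_mem_homogeneous hv⟩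
  rw [bracketTot_inc]
  by_cases h : n + m = 0
  · obtain ⟨rfl, rfl⟩ : n = 0 ∧ m = 0 := by omega
    rw [bracket_zero_zero, map_zero]
    exact Submodule.zero_mem _
  · exact inc_mem _ (by omega)

theorem cupTot_mem {n m : ℤ} {u v : R.CochainTot}
    (hu : u ∈ homogeneous k (fun n => R.Cochain n) n)
    (hv : v ∈ homogeneous k (fun n => R.Cochain n) m) :
    R.cupTot u v ∈ homogeneous k (fun n => R.Cochain n) (n + m) := by
  rcases lt_or_ge n 0 with hn | hn
  · rw [homogeneous_of_neg hn hu, map_zero]; exact Submodule.zero_mem _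
  rcases lt_or_ge m 0 with hm | hm
  · rw [homogeneous_of_neg hm hv, map_zero]; exact Submodule.zero_mem _
  lift n to ℕ using hn
  lift m to ℕ using hm
  obtain ⟨f, rfl⟩ : ∃ f, u = R.inc n f := ⟨_, exists_lof_of_mem_homogeneous hu⟩
  obtain ⟨g, rfl⟩ : ∃ g, v = R.inc m g := ⟨_, exists_lof_of_mem_homogeneous hv⟩
  rw [cupTot_inc]
  exact inc_mem _ (by push_cast; rfl)

theorem δ_bracketTot_inc (f : R.Cochain p) (g : R.Cochain q) :
    R.δ (R.bracketTot (R.inc p f) (R.inc q g)) = R.bracketTot (R.inc p f) (R.δ (R.inc q g)) +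
      sgn q • R.bracketTot (R.δ (R.inc p f)) (R.inc q g) := by
  have hf := inc_mem f rfl
  have hg := inc_mem g rfl
  refine opTot_ext (n := p + q) ?_ (Submodule.add_mem _ ?_ ?_) fun x hx => ?_
  · simpa using δ_mem (bracketTot_mem hf hg)
  · simpa [← add_assoc] using bracketTot_mem hf (δ_mem hg)
  · rw [Units.smul_def]
    refine zsmul_mem ?_ _
    have := bracketTot_mem (δ_mem hf) hg
    rwa [show (p : ℤ) + 1 + q - 1 = p + q by ring] at this
  · have h := op_bracket_coboundary f g (N := p + q + 1) (by omega)
      (by rwa [← Nat.cast_add, Int.toNat_natCast] at hx)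
    rw [bracketTot_inc, δ_inc f, δ_inc g, bracketTot_inc, bracketTot_inc, map_add, map_sign,
      LinearMap.add_apply, Units.smul_def, LinearMap.smul_apply, ← Units.smul_def, opTot_inc,
      opTot_inc, opTot_δ_inc, dOp_apply]
    -- The bracket of two degree-0 cochains is zero in a truncated degree, so the sign identity must
    -- be avoided.
    by_cases hpq : p + q = 0
    · obtain ⟨rfl, rfl⟩ : p = 0 ∧ q = 0 := by omega
      have hs : sgn 0 = -1 := rfl
      simp only [bracket_zero_zero, mulOp_apply, pos_apply, map_zero, LinearMap.zero_apply, hs,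
        smul_zero, add_zero, sub_zero, Units.neg_smul, one_smul, mul_neg, _root_.mul_one,
        neg_neg] at h ⊢
      rw [h, add_comm]
    · rw [sgn_comp (p := p) (q := q) (r := p + q - 1) (by omega), mulOp_apply, h]
      rcases Int.units_eq_one_or (sgn p) with hs | hs <;>
      rcases Int.units_eq_one_or (sgn q) with hs' | hs' <;>
      simp only [hs, hs', one_smul, Units.neg_smul, neg_neg, _root_.one_mul, neg_mul] <;>
      abel

theorem δ_bracketTot (u v : R.CochainTot) :
    R.δ (R.bracketTot u v) = R.bracketTot u (R.δ v) + R.bracketTot (R.δ u) (R.twist v) := by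
  refine cochainTot_induction (C := fun u => R.δ (R.bracketTot u v) = R.bracketTot u (R.δ v) +
    R.bracketTot (R.δ u) (R.twist v)) (by simp) (fun x y hx hy => ?_) (fun p f => ?_) u
  · simp only [map_add, LinearMap.add_apply, hx, hy]; abel
  refine cochainTot_induction (C := fun v => R.δ (R.bracketTot (R.inc p f) v) =
    R.bracketTot (R.inc p f) (R.δ v) + R.bracketTot (R.δ (R.inc p f)) (R.twist v)) (by simp)
    (fun x y hx hy => ?_) (fun q g => ?_) v
  · simp only [map_add, hx, hy]; abel
  · rw [δ_bracketTot_inc, twist_inc, map_sign]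

theorem b_capTot (u : R.CochainTot) (x : ChainTot k A) :
    R.b (R.capTot u x) = R.capTot (R.δ (R.twist u)) x - R.capTot (R.twist u) (R.b x) := by
  refine cochainTot_induction (C := fun u => R.b (R.capTot u x) = R.capTot (R.δ (R.twist u)) x -
    R.capTot (R.twist u) (R.b x)) (by simp) (fun u v hu hv => ?_) (fun p f => ?_) u
  · simp only [map_add, LinearMap.add_apply, hu, hv]; abel
  refine chainTot_induction (C := fun x => R.b (R.capTot (R.inc p f) x) =
    R.capTot (R.δ (R.twist (R.inc p f))) x - R.capTot (R.twist (R.inc p f)) (R.b x)) (by simp)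
    (fun x y hx hy => ?_) (fun n x hx => ?_) x
  · simp only [map_add, hx, hy]; abel
  rw [twist_inc, map_sign, map_sign, map_sign, δ_inc]
  simp only [Units.smul_def, LinearMap.smul_apply]
  simp only [← Units.smul_def]
  rw [capTot_inc, capTot_inc, capTot_inc, map_sign, mulOp_coboundary, sgn_succ, b_eq hx,
    b_eq (mulOp_mem' f hx), posSum_opMul_mulOp' f hx]
  rcases Int.units_eq_one_or (sgn p) with hs | hs <;>
  simp only [hs, one_smul, Units.neg_smul, neg_neg] <;>
  abel

/-- For cocycles, `compFrom_coboundary` expresses the coboundary of f ∘ g by the graded commutator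
of the cup product. -/
theorem δ_circ (f : R.Cochain p) (g : R.Cochain q) (hf : ∀ x, dOp f x = 0)
    (hg : ∀ x, dOp g x = 0) :
    ∃ z, R.δ z = R.cupTot (R.inc p f) (R.inc q g) -
      Int.negOnePow (p * q) • R.cupTot (R.inc q g) (R.inc p f) := by
  have hsgn : Int.negOnePow (p * q) = -(sgn₂ p q * sgn p * sgn q) := by
    rw [sgn, sgn, sgn₂, ← Int.negOnePow_add, ← Int.negOnePow_add, ← Int.negOnePow_succ]
    congr 1
    ring
  have hmem : R.cupTot (R.inc p f) (R.inc q g) -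
      Int.negOnePow (p * q) • R.cupTot (R.inc q g) (R.inc p f) ∈
      homogeneous k (fun n => R.Cochain n) (p + q) := by
    refine Submodule.sub_mem _ (cupTot_mem (inc_mem f rfl) (inc_mem g rfl)) ?_
    rw [Units.smul_def, add_comm]
    exact zsmul_mem (cupTot_mem (inc_mem g rfl) (inc_mem f rfl)) _
  have h : ∀ x ∈ letters k A (p + q + 1),
      R.opMul (compFrom f g 0 x) + R.opMul (pos 1 (compFrom f g 0) x) -
      (sgn p * sgn q) • compFrom f g 0 (posSum (p + q - 1) R.opMul x) =
      -(sgn p • R.opTot (R.cupTot (R.inc p f) (R.inc q g) -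
      Int.negOnePow (p * q) • R.cupTot (R.inc q g) (R.inc p f)) x) := fun x hx => by
    rw [compFrom_coboundary f g (by omega) hx, hf, hsgn, cupTot_inc, cupTot_inc, map_sub, map_sign,
      LinearMap.sub_apply, Units.smul_def, LinearMap.smul_apply, ← Units.smul_def, opTot_inc,
      opTot_inc, op_cup, op_cup, posSum_apply]
    simp only [pos_apply, hg, map_zero, Finset.sum_const_zero, smul_zero]
    rcases Int.units_eq_one_or (sgn p) with hs | hs <;>
    rcases Int.units_eq_one_or (sgn q) with hs' | hs' <;>
    rcases Int.units_eq_one_or (sgn₂ p q) with hs'' | hs'' <;>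
    simp only [hs, hs', hs'', one_smul, Units.neg_smul, neg_neg, _root_.one_mul, neg_mul] <;>
    abel
  -- In degree 0 there is no cochain f ∘ g to serve as homotopy; the formula itself shows that the
  -- graded commutator vanishes.
  by_cases hpq : p + q = 0
  · obtain ⟨rfl, rfl⟩ : p = 0 ∧ q = 0 := by omega
    refine ⟨0, opTot_ext (n := 0) (by simp) (by simpa using hmem) fun x hx => ?_⟩
    have h := h x (by simpa using hx)
    have hs : sgn 0 = -1 := rfl
    simp only [pos_apply, compFrom_self, map_zero, smul_zero, add_zero, sub_zero, hs,
      Units.neg_smul, one_smul, neg_neg, LinearMap.zero_apply] at h ⊢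
    exact h
  · refine ⟨-(sgn q • R.inc (p + q - 1) (R.circ p q _ rfl f g)), ?_⟩
    refine opTot_ext (n := p + q) ?_ hmem fun x hx => ?_
    · have := δ_mem (inc_mem (R.circ p q _ rfl f g) rfl)
      rw [map_neg, map_sign, Units.smul_def]
      refine Submodule.neg_mem _ (zsmul_mem ?_ _)
      convert this using 2
      omega
    · have h := h x (by rwa [← Nat.cast_add, Int.toNat_natCast] at hx)
      rw [map_neg, map_neg, LinearMap.neg_apply, map_sign, map_sign, Units.smul_def,
        LinearMap.smul_apply, ← Units.smul_def, opTot_δ_inc, dOp_apply, mulOp_apply, pos_apply,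
        sgn_comp (p := p) (q := q) (r := p + q - 1) (by omega)]
      simp only [op_circ]
      rw [pos_apply] at h
      rw [h]
      rcases Int.units_eq_one_or (sgn p) with hs | hs <;>
      rcases Int.units_eq_one_or (sgn q) with hs' | hs' <;>
      simp only [hs, hs', one_smul, Units.neg_smul, neg_neg, _root_.one_mul, neg_mul]

theorem cupTot_assoc (u v w : R.CochainTot) :
    R.cupTot (R.cupTot u v) w = R.cupTot u (R.cupTot v w) := by
  refine cochainTot_induction (C := fun u => R.cupTot (R.cupTot u v) w =
    R.cupTot u (R.cupTot v w)) (by simp) (fun x y hx hy => ?_) (fun p f => ?_) u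
  · simp only [map_add, LinearMap.add_apply, hx, hy]
  refine cochainTot_induction (C := fun v => R.cupTot (R.cupTot (R.inc p f) v) w =
    R.cupTot (R.inc p f) (R.cupTot v w)) (by simp) (fun x y hx hy => ?_) (fun q g => ?_) v
  · simp only [map_add, LinearMap.add_apply, hx, hy]
  refine cochainTot_induction (C := fun w => R.cupTot (R.cupTot (R.inc p f) (R.inc q g)) w =
    R.cupTot (R.inc p f) (R.cupTot (R.inc q g) w)) (by simp) (fun x y hx hy => ?_)
    (fun r h => ?_) w
  · simp only [map_add, hx, hy]
  rw [cupTot_inc, cupTot_inc, cupTot_inc, cupTot_inc]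
  exact inc_eq (add_assoc _ _ _) (op_cup_assoc f g h)

theorem capTot_cupTot (u v : R.CochainTot) (x : ChainTot k A) :
    R.capTot (R.cupTot u v) x = R.capTot u (R.capTot v x) := by
  refine cochainTot_induction (C := fun u => R.capTot (R.cupTot u v) x =
    R.capTot u (R.capTot v x)) (by simp) (fun x y hx hy => ?_) (fun p f => ?_) u
  · simp only [map_add, LinearMap.add_apply, hx, hy]
  refine cochainTot_induction (C := fun v => R.capTot (R.cupTot (R.inc p f) v) x =
    R.capTot (R.inc p f) (R.capTot v x)) (by simp) (fun x y hx hy => ?_) (fun q g => ?_) v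
  · simp only [map_add, LinearMap.add_apply, hx, hy]
  rw [cupTot_inc, capTot_inc, capTot_inc, capTot_inc, mulOp_cup, sgn_add, map_sign, smul_smul,
    Units.neg_smul, smul_neg, neg_neg]

theorem bracketTot_skew (f : R.Cochain p) (g : R.Cochain q) :
    R.bracketTot (R.inc p f) (R.inc q g) =
      -(sgn₂ p q • R.bracketTot (R.inc q g) (R.inc p f)) := by
  have h : R.inc (p + q - 1) (R.bracket p q f g) =
      R.inc (q + p - 1) (-(sgn₂ p q • R.bracket q p g f)) := by
    refine inc_eq (by omega) fun x => ?_
    rw [map_neg, map_sign, LinearMap.neg_apply, Units.smul_def, LinearMap.smul_apply,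
      ← Units.smul_def, op_bracket, op_bracket, smul_sub, smul_smul, sgn₂_comm q p,
      Int.units_mul_self, one_smul, neg_sub]
  rw [bracketTot_inc, bracketTot_inc, h, map_neg, map_sign]

end RegUnitalHomAssoc
end HomHochschild
end

noncomputable section

namespace HomHochschild

namespace RegUnitalHomAssoc

variable {k A : Type*} [CommRing k] [AddCommGroup A] [Module k A] {R : RegUnitalHomAssoc k A}
  {p q : ℕ}

/-! ### Operations on cohomology and homology -/

theorem δ_twist_eq_zero {u : R.CochainTot} (hu : R.δ u = 0) : R.δ (R.twist u) = 0 := by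
  rw [δ_twist, hu, map_zero, neg_zero]

variable (R) in
theorem induces_cupH : Induces₂ R.δ R.δ R.δ R.cupTot R.cupH :=
  induces₂_induced₂ (fun u v hu hv => by rw [δ_cupTot, hu, hv]; simp)
    (fun u v hv => ⟨-R.cupTot u (R.twist v), by
      rw [map_neg, δ_cupTot, δ_twist_eq_zero hv, twist_twist, map_zero, zero_sub, neg_neg]⟩)
    (fun u v hu => ⟨R.cupTot u v, by rw [δ_cupTot, hu]; simp⟩)

variable (R) in
theorem induces_bracketH : Induces₂ R.δ R.δ R.δ R.bracketTot R.bracketH :=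
  induces₂_induced₂ (fun u v hu hv => by rw [δ_bracketTot, hu, hv]; simp)
    (fun u v hv => ⟨R.bracketTot u (R.twist v), by
      rw [δ_bracketTot, δ_twist_eq_zero hv, twist_twist, map_zero, zero_add]⟩)
    (fun u v hu => ⟨R.bracketTot u v, by rw [δ_bracketTot, hu]; simp⟩)

variable (R) in
theorem induces_capH : Induces₂ R.δ R.b R.b R.capTot R.capH :=
  induces₂_induced₂ (fun u x hu hx => by rw [b_capTot, δ_twist_eq_zero hu, hx]; simp)
    (fun u x hx => ⟨R.capTot (R.twist u) x, by rw [b_capTot, twist_twist, hx]; simp⟩)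
    (fun u x hu => ⟨-R.capTot (R.twist u) x, by
      rw [map_neg, b_capTot, twist_twist, hu]; simp⟩)

variable (R) in
theorem induces_connesH : Induces R.b R.b R.connesTot R.connesH :=
  induces_induced (fun x hx => by rw [b_connesTot, hx, map_zero, neg_zero])
    (fun x => ⟨-R.connesTot x, by rw [map_neg, b_connesTot, neg_neg]⟩)

variable (R) in
theorem operationsDescend : R.OperationsDescend :=
  ⟨R.induces_cupH, R.induces_bracketH, R.induces_capH, R.induces_connesH⟩

/-! ### Degrees -/

theorem b_mem_homogeneous (n : ℤ) (x : ChainTot k A) (hx : x ∈ homogeneous k (Chain k A) n) :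
    R.b x ∈ homogeneous k (Chain k A) (n + -1) := by
  rcases lt_or_ge n 0 with hn | hn
  · rw [homogeneous_of_neg hn hx, map_zero]; exact Submodule.zero_mem _
  lift n to ℕ using hn
  exact b_mem (N := n) (by simpa [letters] using hx)

theorem capTot_mem {n m : ℤ} {u : R.CochainTot} {x : ChainTot k A}
    (hu : u ∈ homogeneous k (fun n => R.Cochain n) n) (hx : x ∈ homogeneous k (Chain k A) m) :
    R.capTot u x ∈ homogeneous k (Chain k A) (m - n) := by
  rcases lt_or_ge n 0 with hn | hn
  · rw [homogeneous_of_neg hn hu, map_zero]; exact Submodule.zero_mem _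
  rcases lt_or_ge m 0 with hm | hm
  · rw [homogeneous_of_neg hm hx, map_zero]; exact Submodule.zero_mem _
  lift n to ℕ using hn
  lift m to ℕ using hm
  obtain ⟨f, rfl⟩ : ∃ f, u = R.inc n f := ⟨_, exists_lof_of_mem_homogeneous hu⟩
  have hx : x ∈ letters k A (m + 1) := by simpa [letters] using hx
  rw [capTot_inc, Units.smul_def]
  refine zsmul_mem ?_ _
  by_cases h : m < n
  · rw [mulOp_eq_zero f h hx]; exact Submodule.zero_mem _
  · have := mulOp_mem' f hx
    rw [letters] at this
    convert this using 2
    omega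

theorem connesTot_mem {n : ℤ} {x : ChainTot k A} (hx : x ∈ homogeneous k (Chain k A) n) :
    R.connesTot x ∈ homogeneous k (Chain k A) (n + 1) := by
  rcases lt_or_ge n 0 with hn | hn
  · rw [homogeneous_of_neg hn hx, map_zero]; exact Submodule.zero_mem _
  lift n to ℕ using hn
  have hx : x ∈ letters k A (n + 1) := by simpa [letters] using hx
  rw [connesTot_eq hx]
  simpa [letters] using connesOp_mem (R := R) hx (n + 1)

theorem cupH_mem {p q : ℤ} {f g : R.HCoh} (hf : f ∈ R.cohDeg p) (hg : g ∈ R.cohDeg q) :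
    R.cupH f g ∈ R.cohDeg (p + q) := by
  obtain ⟨u, hu, hup, rfl⟩ := exists_cls_of_mem_homologyDeg hf
  obtain ⟨v, hv, hvq, rfl⟩ := exists_cls_of_mem_homologyDeg hg
  obtain ⟨h, e⟩ := R.induces_cupH ⟨u, hu⟩ ⟨v, hv⟩
  rw [e]
  exact cls_mem_homologyDeg (cupTot_mem hup hvq)

theorem bracketH_mem {p q : ℤ} {f g : R.HCoh} (hf : f ∈ R.cohDeg p) (hg : g ∈ R.cohDeg q) :
    R.bracketH f g ∈ R.cohDeg (p + q - 1) := by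
  obtain ⟨u, hu, hup, rfl⟩ := exists_cls_of_mem_homologyDeg hf
  obtain ⟨v, hv, hvq, rfl⟩ := exists_cls_of_mem_homologyDeg hg
  obtain ⟨h, e⟩ := R.induces_bracketH ⟨u, hu⟩ ⟨v, hv⟩
  rw [e]
  exact cls_mem_homologyDeg (bracketTot_mem hup hvq)

theorem capH_mem {p n : ℤ} {f : R.HCoh} {x : R.HHom} (hf : f ∈ R.cohDeg p) (hx : x ∈ R.homDeg n) :
    R.capH f x ∈ R.homDeg (n - p) := by
  obtain ⟨u, hu, hup, rfl⟩ := exists_cls_of_mem_homologyDeg hf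
  obtain ⟨y, hy, hyn, rfl⟩ := exists_cls_of_mem_homologyDeg hx
  obtain ⟨h, e⟩ := R.induces_capH ⟨u, hu⟩ ⟨y, hy⟩
  rw [e]
  exact cls_mem_homologyDeg (capTot_mem hup hyn)

theorem connesH_mem {n : ℤ} {x : R.HHom} (hx : x ∈ R.homDeg n) :
    R.connesH x ∈ R.homDeg (n + 1) := by
  obtain ⟨y, hy, hyn, rfl⟩ := exists_cls_of_mem_homologyDeg hx
  obtain ⟨h, e⟩ := R.induces_connesH ⟨y, hy⟩
  rw [e]
  exact cls_mem_homologyDeg (connesTot_mem hyn)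

theorem exists_inc_of_mem_cohDeg {n : ℤ} {f : R.HCoh} (hf : f ∈ R.cohDeg n) :
    f = 0 ∨ ∃ (p : ℕ) (f' : R.Cochain p) (h : R.δ (R.inc p f') = 0),
      n = p ∧ f = cls R.δ ⟨_, h⟩ := by
  rcases lt_or_ge n 0 with hn | hn
  · exact Or.inl (homologyDeg_of_neg hn hf)
  lift n to ℕ using hn
  obtain ⟨y, h, e⟩ := exists_lof_of_mem_homologyDeg hf
  exact Or.inr ⟨n, y, h, rfl, e⟩

/-! ### Identities -/

theorem cupH_assoc (f g h : R.HCoh) : R.cupH (R.cupH f g) h = R.cupH f (R.cupH g h) := by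
  obtain ⟨f, rfl⟩ := cls_surjective _ f
  obtain ⟨g, rfl⟩ := cls_surjective _ g
  obtain ⟨h, rfl⟩ := cls_surjective _ h
  obtain ⟨h1, e1⟩ := R.induces_cupH f g
  obtain ⟨h2, e2⟩ := R.induces_cupH ⟨_, h1⟩ h
  obtain ⟨h3, e3⟩ := R.induces_cupH g h
  obtain ⟨h4, e4⟩ := R.induces_cupH f ⟨_, h3⟩
  rw [e1, e2, e3, e4]
  exact congrArg _ (Subtype.ext (cupTot_assoc _ _ _))

theorem capH_cupH (f g : R.HCoh) (x : R.HHom) : R.capH (R.cupH f g) x = R.capH f (R.capH g x) := by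
  obtain ⟨f, rfl⟩ := cls_surjective _ f
  obtain ⟨g, rfl⟩ := cls_surjective _ g
  obtain ⟨x, rfl⟩ := cls_surjective _ x
  obtain ⟨h1, e1⟩ := R.induces_cupH f g
  obtain ⟨h2, e2⟩ := R.induces_capH ⟨_, h1⟩ x
  obtain ⟨h3, e3⟩ := R.induces_capH g x
  obtain ⟨h4, e4⟩ := R.induces_capH f ⟨_, h3⟩
  rw [e1, e2, e3, e4]
  exact congrArg _ (Subtype.ext (capTot_cupTot _ _ _))

theorem connesH_connesH (x : R.HHom) : R.connesH (R.connesH x) = 0 := by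
  obtain ⟨x, rfl⟩ := cls_surjective _ x
  obtain ⟨h1, e1⟩ := R.induces_connesH x
  obtain ⟨h2, e2⟩ := R.induces_connesH ⟨_, h1⟩
  rw [e1, e2, ← map_zero (cls R.b)]
  exact congrArg _ (Subtype.ext (connesTot_connesTot _))

theorem cupH_comm {p q : ℤ} {f g : R.HCoh} (hf : f ∈ R.cohDeg p) (hg : g ∈ R.cohDeg q) :
    R.cupH f g = Int.negOnePow (p * q) • R.cupH g f := by
  rcases exists_inc_of_mem_cohDeg hf with rfl | ⟨p, f, hf', rfl, rfl⟩
  · simp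
  rcases exists_inc_of_mem_cohDeg hg with rfl | ⟨q, g, hg', rfl, rfl⟩
  · simp
  obtain ⟨h1, e1⟩ := R.induces_cupH ⟨_, hf'⟩ ⟨_, hg'⟩
  obtain ⟨h2, e2⟩ := R.induces_cupH ⟨_, hg'⟩ ⟨_, hf'⟩
  rw [e1, e2, ← sub_eq_zero, ← map_sign, ← map_sub, cls_eq_zero_iff]
  exact δ_circ f g ((δ_inc_eq_zero_iff f).1 hf') ((δ_inc_eq_zero_iff g).1 hg')

theorem bracketH_skew {p q : ℤ} {f g : R.HCoh} (hf : f ∈ R.cohDeg p) (hg : g ∈ R.cohDeg q) :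
    R.bracketH f g = -(Int.negOnePow ((p - 1) * (q - 1)) • R.bracketH g f) := by
  rcases exists_inc_of_mem_cohDeg hf with rfl | ⟨p, f, hf', rfl, rfl⟩
  · simp
  rcases exists_inc_of_mem_cohDeg hg with rfl | ⟨q, g, hg', rfl, rfl⟩
  · simp
  obtain ⟨h1, e1⟩ := R.induces_bracketH ⟨_, hf'⟩ ⟨_, hg'⟩
  obtain ⟨h2, e2⟩ := R.induces_bracketH ⟨_, hg'⟩ ⟨_, hf'⟩
  rw [e1, e2, ← map_sign, ← map_neg]
  exact congrArg _ (Subtype.ext (bracketTot_skew f g))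

theorem capH_bracketH_cls (f : R.Cochain p) (g : R.Cochain q) (hf : R.δ (R.inc p f) = 0)
    (hg : R.δ (R.inc q g) = 0) {N : ℕ} {x : ChainTot k A} (hx : x ∈ letters k A N)
    (hb : R.b x = 0) :
    R.capH (R.bracketH (cls R.δ ⟨_, hf⟩) (cls R.δ ⟨_, hg⟩)) (cls R.b ⟨x, hb⟩) =
      R.capH (cls R.δ ⟨_, hf⟩) (R.connesH (R.capH (cls R.δ ⟨_, hg⟩) (cls R.b ⟨x, hb⟩))) +
      sgn p • R.connesH (R.capH (cls R.δ ⟨_, hf⟩) (R.capH (cls R.δ ⟨_, hg⟩) (cls R.b ⟨x, hb⟩))) -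
      (sgn₂ p q * sgn p) • R.capH (cls R.δ ⟨_, hg⟩)
        (R.capH (cls R.δ ⟨_, hf⟩) (R.connesH (cls R.b ⟨x, hb⟩))) -
      sgn₂ p q • R.capH (cls R.δ ⟨_, hg⟩)
        (R.connesH (R.capH (cls R.δ ⟨_, hf⟩) (cls R.b ⟨x, hb⟩))) := by
  obtain ⟨h1, e1⟩ := R.induces_capH ⟨_, hg⟩ ⟨x, hb⟩
  obtain ⟨h2, e2⟩ := R.induces_connesH ⟨_, h1⟩
  obtain ⟨h3, e3⟩ := R.induces_capH ⟨_, hf⟩ ⟨_, h2⟩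
  obtain ⟨h4, e4⟩ := R.induces_capH ⟨_, hf⟩ ⟨_, h1⟩
  obtain ⟨h5, e5⟩ := R.induces_connesH ⟨_, h4⟩
  obtain ⟨h6, e6⟩ := R.induces_connesH ⟨x, hb⟩
  obtain ⟨h7, e7⟩ := R.induces_capH ⟨_, hf⟩ ⟨_, h6⟩
  obtain ⟨h8, e8⟩ := R.induces_capH ⟨_, hg⟩ ⟨_, h7⟩
  obtain ⟨h9, e9⟩ := R.induces_capH ⟨_, hf⟩ ⟨x, hb⟩
  obtain ⟨h10, e10⟩ := R.induces_connesH ⟨_, h9⟩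
  obtain ⟨h11, e11⟩ := R.induces_capH ⟨_, hg⟩ ⟨_, h10⟩
  obtain ⟨h12, e12⟩ := R.induces_bracketH ⟨_, hf⟩ ⟨_, hg⟩
  obtain ⟨h13, e13⟩ := R.induces_capH ⟨_, h12⟩ ⟨x, hb⟩
  rw [e1, e2, e3, e4, e5, e6, e7, e8, e9, e10, e11, e12, e13, ← map_sign, ← map_sign, ← map_sign,
    ← map_add, ← map_sub, ← map_sub, ← sub_eq_zero, ← map_sub, cls_eq_zero_iff]
  exact exists_b_eq_capTot_bracketTot f g ((δ_inc_eq_zero_iff f).1 hf) ((δ_inc_eq_zero_iff g).1 hg)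
    hx hb

/-- The derived bracket identity on homology, expanded into its four terms. Both sides are additive
in x, so homogeneous classes suffice. -/
theorem capH_bracketH {p q : ℤ} {f g : R.HCoh} (hf : f ∈ R.cohDeg p) (hg : g ∈ R.cohDeg q)
    (x : R.HHom) : R.capH (R.bracketH f g) x =
      R.capH f (R.connesH (R.capH g x)) +
      Int.negOnePow (p - 1) • R.connesH (R.capH f (R.capH g x)) -
      Int.negOnePow ((p - 1) * q) • R.capH g (R.capH f (R.connesH x)) -
      Int.negOnePow ((p - 1) * (q - 1)) • R.capH g (R.connesH (R.capH f x)) := by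
  rcases exists_inc_of_mem_cohDeg hf with rfl | ⟨p, f, hf', rfl, rfl⟩
  · simp
  rcases exists_inc_of_mem_cohDeg hg with rfl | ⟨q, g, hg', rfl, rfl⟩
  · simp
  have hs : Int.negOnePow (((p : ℤ) - 1) * q) = sgn₂ p q * sgn p := by
    rw [sgn, sgn₂, ← Int.negOnePow_add]
    congr 1
    ring
  generalize hF : cls R.δ ⟨_, hf'⟩ = F
  generalize hG : cls R.δ ⟨_, hg'⟩ = G
  refine homology_induction (b_mem_homogeneous (R := R)) (C := fun x =>
    R.capH (R.bracketH F G) x = R.capH F (R.connesH (R.capH G x)) +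
      Int.negOnePow ((p : ℤ) - 1) • R.connesH (R.capH F (R.capH G x)) -
      Int.negOnePow (((p : ℤ) - 1) * q) • R.capH G (R.capH F (R.connesH x)) -
      Int.negOnePow (((p : ℤ) - 1) * ((q : ℤ) - 1)) • R.capH G (R.connesH (R.capH F x)))
    (by simp) (fun x y hx hy => ?_) (fun n x hx => ?_) x
  · simp only [map_add, smul_add, hx, hy]
    abel
  · rcases lt_or_ge n 0 with hn | hn
    · rw [homologyDeg_of_neg hn hx]
      simp
    · lift n to ℕ using hn
      obtain ⟨y, hy, rfl⟩ := exists_lof_of_mem_homologyDeg hx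
      rw [← hF, ← hG, hs]
      exact capH_bracketH_cls f g hf' hg' (lof_mem_letters n y) hy

end RegUnitalHomAssoc
end HomHochschild
end

noncomputable section

namespace HomHochschild

namespace RegUnitalHomAssoc

variable {k A : Type*} [CommRing k] [AddCommGroup A] [Module k A] {R : RegUnitalHomAssoc k A}

theorem capH_sign (u : ℤˣ) (f : R.HCoh) (x : R.HHom) : R.capH (u • f) x = u • R.capH f x := by
  rw [map_sign]
  rfl

/-- The Leibniz rule, after the cap product with any class. -/
theorem capH_bracketH_cupH {p q r : ℤ} {f g h : R.HCoh} (hf : f ∈ R.cohDeg p)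
    (hg : g ∈ R.cohDeg q) (hh : h ∈ R.cohDeg r) (x : R.HHom) :
    R.capH (R.bracketH f (R.cupH g h)) x = R.capH (R.cupH (R.bracketH f g) h +
      Int.negOnePow ((p - 1) * q) • R.cupH g (R.bracketH f h)) x := by
  have e1 : Int.negOnePow ((p - 1) * (q - 1)) =
      Int.negOnePow (p - 1) * Int.negOnePow ((p - 1) * q) := by
    rw [← Int.negOnePow_add, Int.negOnePow_eq_iff]
    exact ⟨-(p - 1), by ring⟩
  have e2 : Int.negOnePow ((p - 1) * (r - 1)) =
      Int.negOnePow (p - 1) * Int.negOnePow ((p - 1) * r) := by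
    rw [← Int.negOnePow_add, Int.negOnePow_eq_iff]
    exact ⟨-(p - 1), by ring⟩
  have e3 : Int.negOnePow ((p - 1) * (q + r)) =
      Int.negOnePow ((p - 1) * q) * Int.negOnePow ((p - 1) * r) := by
    rw [← Int.negOnePow_add]
    congr 1
    ring
  have e4 : Int.negOnePow ((p - 1) * (q + r - 1)) =
      Int.negOnePow (p - 1) * Int.negOnePow ((p - 1) * q) * Int.negOnePow ((p - 1) * r) := by
    rw [← Int.negOnePow_add, ← Int.negOnePow_add, Int.negOnePow_eq_iff]
    exact ⟨-(p - 1), by ring⟩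
  rw [map_add, LinearMap.add_apply, capH_sign]
  -- All terms become words in the three caps and B. The words with B between g and h cancel, as for
  -- a derivation of composition.
  simp only [capH_bracketH hf (cupH_mem hg hh), capH_cupH, capH_bracketH hf hg, capH_bracketH hf hh,
    map_add, map_sub, map_sign, e1, e2, e3, e4]
  generalize Int.negOnePow (p - 1) = a, Int.negOnePow ((p - 1) * q) = b,
    Int.negOnePow ((p - 1) * r) = c, R.capH f = F, R.capH g = G, R.capH h = H, R.connesH = B
  rcases Int.units_eq_one_or a with rfl | rfl <;>
  rcases Int.units_eq_one_or b with rfl | rfl <;>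
  rcases Int.units_eq_one_or c with rfl | rfl <;>
  simp only [one_smul, Units.neg_smul, neg_neg, _root_.one_mul, neg_mul] <;>
  abel

set_option maxHeartbeats 2000000 in
/-- The Jacobi identity, after the cap product with any class. -/
theorem capH_jacobi {p q r : ℤ} {f g h : R.HCoh} (hf : f ∈ R.cohDeg p)
    (hg : g ∈ R.cohDeg q) (hh : h ∈ R.cohDeg r) (x : R.HHom) :
    R.capH (R.bracketH f (R.bracketH g h)) x = R.capH (R.bracketH (R.bracketH f g) h +
      Int.negOnePow ((p - 1) * (q - 1)) • R.bracketH g (R.bracketH f h)) x := by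
  obtain ⟨a, ha⟩ : ∃ a, a = Int.negOnePow (p - 1) := ⟨_, rfl⟩
  obtain ⟨b, hb⟩ : ∃ b, b = Int.negOnePow (q - 1) := ⟨_, rfl⟩
  obtain ⟨u, hu⟩ : ∃ u, u = Int.negOnePow ((p - 1) * (q - 1)) := ⟨_, rfl⟩
  obtain ⟨v, hv⟩ : ∃ v, v = Int.negOnePow ((p - 1) * r) := ⟨_, rfl⟩
  obtain ⟨w, hw⟩ : ∃ w, w = Int.negOnePow ((q - 1) * r) := ⟨_, rfl⟩
  have e1 : Int.negOnePow ((p - 1) * q) = u * a := by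
    rw [ha, hu, ← Int.negOnePow_add]; congr 1; ring
  have e2 : Int.negOnePow ((p - 1) * (q + r - 1)) = u * v := by
    rw [hu, hv, ← Int.negOnePow_add]; congr 1; ring
  have e3 : Int.negOnePow ((p - 1) * (q + r - 1 - 1)) = u * v * a := by
    rw [hu, hv, ha, ← Int.negOnePow_add, ← Int.negOnePow_add, Int.negOnePow_eq_iff]
    exact ⟨-(p - 1), by ring⟩
  have e4 : Int.negOnePow ((q - 1) * (r - 1)) = w * b := by
    rw [hw, hb, ← Int.negOnePow_add, Int.negOnePow_eq_iff]
    exact ⟨-(q - 1), by ring⟩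
  have e5 : Int.negOnePow (p + q - 1 - 1) = a * b := by
    rw [ha, hb, ← Int.negOnePow_add]; congr 1; ring
  have e6 : Int.negOnePow ((p + q - 1 - 1) * r) = v * w := by
    rw [hv, hw, ← Int.negOnePow_add]; congr 1; ring
  have e7 : Int.negOnePow ((p + q - 1 - 1) * (r - 1)) = v * w * a * b := by
    rw [hv, hw, ha, hb, ← Int.negOnePow_add, ← Int.negOnePow_add, ← Int.negOnePow_add,
      Int.negOnePow_eq_iff]
    exact ⟨-(p + q - 2), by ring⟩
  have e8 : Int.negOnePow ((q - 1) * (p + r - 1)) = u * w := by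
    rw [hu, hw, ← Int.negOnePow_add]; congr 1; ring
  have e9 : Int.negOnePow ((q - 1) * (p + r - 1 - 1)) = u * w * b := by
    rw [hu, hw, hb, ← Int.negOnePow_add, ← Int.negOnePow_add, Int.negOnePow_eq_iff]
    exact ⟨-(q - 1), by ring⟩
  have e10 : Int.negOnePow ((p - 1) * (r - 1)) = v * a := by
    rw [hv, ha, ← Int.negOnePow_add, Int.negOnePow_eq_iff]
    exact ⟨-(p - 1), by ring⟩
  rw [map_add, LinearMap.add_apply, capH_sign]
  -- Each double bracket expands into words with two letters B; those with adjacent B vanish. Five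
  -- independent signs then account for all exponents, and the comparison is a finite check.
  simp only [map_add, capH_bracketH hf (bracketH_mem hg hh), capH_bracketH (bracketH_mem hf hg) hh,
    capH_bracketH hg (bracketH_mem hf hh),
    capH_bracketH hf hg, capH_bracketH hf hh, capH_bracketH hg hh, map_sub, map_sign,
    connesH_connesH, map_zero, smul_zero, e1, e2, e3, e4, e5, e6, e7, e8, e9, e10, ← ha, ← hb,
    ← hu, ← hv, ← hw]
  generalize R.capH f = F, R.capH g = G, R.capH h = H, R.connesH = B
  clear e1 e2 e3 e4 e5 e6 e7 e8 e9 e10 ha hb hu hv hw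
  rcases Int.units_eq_one_or a with rfl | rfl <;>
  rcases Int.units_eq_one_or b with rfl | rfl <;>
  rcases Int.units_eq_one_or u with rfl | rfl <;>
  rcases Int.units_eq_one_or v with rfl | rfl <;>
  rcases Int.units_eq_one_or w with rfl | rfl <;>
  simp only [one_smul, Units.neg_smul, neg_neg, _root_.one_mul, neg_mul] <;>
  abel

/-! ### Duality -/

/-- Capping with the homogeneous class `c` turns degree n into degree d - n, a bijection of degrees,
so components correspond. -/
theorem homologyProj_capH {d : ℤ} {c : R.HHom} (hc : c ∈ R.homDeg d) (n : ℤ) (f : R.HCoh) :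
    homologyProj R.b (d - n) (R.capH f c) = R.capH (homologyProj R.δ n f) c := by
  refine homology_induction (fun _ _ => δ_mem (R := R)) (C := fun f =>
    homologyProj R.b (d - n) (R.capH f c) = R.capH (homologyProj R.δ n f) c) (by simp)
    (fun f g hf hg => by simp only [map_add, LinearMap.add_apply, hf, hg]) (fun m f hf => ?_) f
  by_cases h : m = n
  · subst h
    rw [homologyProj_self (fun _ _ => δ_mem) hf,
      homologyProj_self b_mem_homogeneous (capH_mem hf hc)]
  · rw [homologyProj_of_ne (fun _ _ => δ_mem) h hf,
      homologyProj_of_ne b_mem_homogeneous (by omega) (capH_mem hf hc), map_zero,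
      LinearMap.zero_apply]

/-- Injectivity in each degree extends to inhomogeneous classes by taking components; negative
degrees contain only zero. -/
theorem capH_injective {d : ℤ} {c : R.HHom} (hc : c ∈ R.homDeg d)
    (hinj : ∀ n : ℕ, Set.InjOn (fun f => R.capH f c) (R.cohDeg n)) {f g : R.HCoh}
    (h : R.capH f c = R.capH g c) : f = g := by
  rw [← sub_eq_zero]
  obtain ⟨s, hs⟩ := exists_sum_homologyProj (fun _ _ => δ_mem (R := R)) (f - g)
  rw [← hs]
  refine Finset.sum_eq_zero fun n _ => ?_
  have h1 := homologyProj_mem (fun _ _ => δ_mem (R := R)) n (f - g)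
  rcases lt_or_ge n 0 with hn | hn
  · exact homologyDeg_of_neg hn h1
  lift n to ℕ using hn
  refine hinj n h1 (Submodule.zero_mem _) ?_
  change R.capH _ c = R.capH 0 c
  rw [← homologyProj_capH hc, map_sub, LinearMap.sub_apply, h, sub_self, map_zero, map_zero,
    LinearMap.zero_apply]

theorem isGerstenhaber {d : ℤ} {c : R.HHom} (hc : c ∈ R.homDeg d)
    (hinj : ∀ n : ℕ, Set.InjOn (fun f => R.capH f c) (R.cohDeg n)) :
    IsGerstenhaber R.cohDeg R.cupH R.bracketH where
  isInternal := isInternal_homologyDeg fun _ _ => δ_mem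
  cup_mem := cupH_mem
  cup_assoc := cupH_assoc
  cup_comm := cupH_comm
  br_mem := bracketH_mem
  br_skew := bracketH_skew
  jacobi hf hg hh := capH_injective hc hinj (capH_jacobi hf hg hh c)
  leibniz hf hg hh := capH_injective hc hinj (capH_bracketH_cupH hf hg hh c)

/-- B(i_f c) has degree d - (n - 1), so surjectivity in degree n - 1 applies when n ≥ 1. For n = 0
the target degree d + 1 is out of reach of the duality, and `h0` is used. -/
theorem connesH_capH_mem_range {d : ℤ} {c : R.HHom} (hc : c ∈ R.homDeg d)
    (hsurj : ∀ n : ℕ, Set.SurjOn (fun f => R.capH f c) (R.cohDeg n) (R.homDeg (d - n)))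
    (h0 : ∀ f ∈ R.cohDeg 0, R.connesH (R.capH f c) = 0) {n : ℤ} {f : R.HCoh}
    (hf : f ∈ R.cohDeg n) : ∃ g ∈ R.cohDeg (n - 1), R.capH g c = R.connesH (R.capH f c) := by
  rcases lt_trichotomy n 0 with hn | rfl | hn
  · rw [homologyDeg_of_neg hn hf]
    exact ⟨0, Submodule.zero_mem _, by simp⟩
  · rw [h0 f hf]
    exact ⟨0, Submodule.zero_mem _, by simp⟩
  · obtain ⟨m, rfl⟩ : ∃ m : ℕ, n = m + 1 := ⟨(n - 1).toNat, by omega⟩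
    have h := connesH_mem (capH_mem hf hc)
    rw [show d - (m + 1 : ℤ) + 1 = d - m by ring] at h
    obtain ⟨g, hg, e⟩ := hsurj m h
    exact ⟨g, by simpa using hg, e⟩

theorem isBVGenerator {d : ℤ} {c : R.HHom} (hc : c ∈ R.homDeg d) (hBc : R.connesH c = 0)
    (hbij : ∀ n : ℕ, Set.BijOn (fun f => R.capH f c) (R.cohDeg n) (R.homDeg (d - n)))
    (h0 : ∀ f ∈ R.cohDeg 0, R.connesH (R.capH f c) = 0) {Δ : R.HCoh →ₗ[k] R.HCoh}
    (hΔ : ∀ f, R.capH (Δ f) c = R.connesH (R.capH f c)) :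
    IsBVGenerator R.cohDeg R.cupH R.bracketH Δ := by
  have hinj : ∀ {f g : R.HCoh}, R.capH f c = R.capH g c → f = g := fun h =>
    capH_injective hc (fun n => (hbij n).injOn) h
  have hmem : ∀ {n : ℤ} {f : R.HCoh}, f ∈ R.cohDeg n → Δ f ∈ R.cohDeg (n - 1) := by
    intro n f hf
    obtain ⟨g, hg, e⟩ := connesH_capH_mem_range hc (fun n => (hbij n).surjOn) h0 hf
    rwa [hinj ((hΔ f).trans e.symm)]
  refine ⟨hmem, fun f => hinj ?_, fun {p f} hf g => ?_⟩
  · rw [hΔ, hΔ, connesH_connesH, map_zero, LinearMap.zero_apply]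
  · refine homology_induction (fun _ _ => δ_mem (R := R)) (C := fun g =>
      R.bracketH f g = -(Int.negOnePow p • (Δ (R.cupH f g) - R.cupH (Δ f) g -
        Int.negOnePow p • R.cupH f (Δ g)))) (by simp) (fun g h hg hh => ?_) (fun q g hg => ?_) g
    · simp only [map_add, hg, hh, ← neg_add, ← smul_add]
      congr 2
      rw [smul_add]
      abel
    · refine hinj ?_
      have e1 : Int.negOnePow ((p - 1) * q) =
          Int.negOnePow ((p - 1) * (q - 1)) * Int.negOnePow (p - 1) := by
        rw [← Int.negOnePow_add]; congr 1; ring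
      have e2 : Int.negOnePow p = -Int.negOnePow (p - 1) := by
        rw [← Int.negOnePow_succ, sub_add_cancel]
      -- The bracket identity at `c` contains i_g B i_f c, that is g ∪ Δf; commutativity brings Δf ∪
      -- g to this order. The term with Bc drops out.
      rw [cupH_comm (hmem hf) hg, capH_bracketH hf hg, hBc]
      simp only [map_neg, map_sub, LinearMap.neg_apply, LinearMap.sub_apply, capH_sign, hΔ,
        capH_cupH, map_zero, smul_zero, sub_zero, e1, e2]
      generalize Int.negOnePow (p - 1) = a, Int.negOnePow ((p - 1) * (q - 1)) = b
      rcases Int.units_eq_one_or a with rfl | rfl <;>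
      rcases Int.units_eq_one_or b with rfl | rfl <;>
      simp only [one_smul, Units.neg_smul, neg_neg, _root_.one_mul, neg_mul] <;>
      abel

/-- Capping with `c` is injective and its range contains B(i_f c) for every f, so Δ is B followed by
the inverse of this map on its range. -/
theorem exists_generator {d : ℤ} {c : R.HHom} (hc : c ∈ R.homDeg d)
    (hbij : ∀ n : ℕ, Set.BijOn (fun f => R.capH f c) (R.cohDeg n) (R.homDeg (d - n)))
    (h0 : ∀ f ∈ R.cohDeg 0, R.connesH (R.capH f c) = 0) :
    ∃ Δ : R.HCoh →ₗ[k] R.HCoh, ∀ f, R.capH (Δ f) c = R.connesH (R.capH f c) := by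
  have hinj : Function.Injective (R.capH.flip c) := fun f g h =>
    capH_injective hc (fun n => (hbij n).injOn) h
  have hrange : ∀ f, (R.connesH ∘ₗ R.capH.flip c) f ∈ LinearMap.range (R.capH.flip c) := by
    intro f
    refine homology_induction (fun _ _ => δ_mem (R := R)) (C := fun f =>
      (R.connesH ∘ₗ R.capH.flip c) f ∈ LinearMap.range (R.capH.flip c))
      (by rw [map_zero]; exact Submodule.zero_mem _)
      (fun f g hf hg => by rw [map_add]; exact Submodule.add_mem _ hf hg) (fun n f hf => ?_) f
    obtain ⟨g, -, e⟩ := connesH_capH_mem_range hc (fun n => (hbij n).surjOn) h0 hf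
    exact ⟨g, e⟩
  refine ⟨(LinearEquiv.ofInjective _ hinj).symm.toLinearMap ∘ₗ
    (R.connesH ∘ₗ R.capH.flip c).codRestrict _ hrange, fun f => ?_⟩
  exact congrArg Subtype.val ((LinearEquiv.ofInjective _ hinj).apply_symm_apply
    ((R.connesH ∘ₗ R.capH.flip c).codRestrict _ hrange f))

end RegUnitalHomAssoc
end HomHochschild
end

theorem mainTheorem5 {k A : Type*} [CommRing k] [CharZero k] [AddCommGroup A] [Module k A]
    (R : HomHochschild.RegUnitalHomAssoc k A) :
    R.OperationsDescend ∧
    ∀ (d : ℕ) (c : R.HHom), c ∈ R.homDeg d → R.connesH c = 0 →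
      (∀ n : ℕ, Set.BijOn (fun f => R.capH f c) (R.cohDeg n) (R.homDeg ((d : ℤ) - n))) →
      (∀ f ∈ R.cohDeg 0, R.connesH (R.capH f c) = 0) →
      HomHochschild.IsGerstenhaber R.cohDeg R.cupH R.bracketH ∧
      ∃ Δ : R.HCoh →ₗ[k] R.HCoh,
        (∀ f : R.HCoh, R.capH (Δ f) c = R.connesH (R.capH f c)) ∧
        HomHochschild.IsBVGenerator R.cohDeg R.cupH R.bracketH Δ ∧
        ∀ Δ' : R.HCoh →ₗ[k] R.HCoh,
          (∀ f : R.HCoh, R.capH (Δ' f) c = R.connesH (R.capH f c)) → Δ' = Δ := by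
  refine ⟨R.operationsDescend, fun d c hc hBc hbij h0 => ?_⟩
  have hinj := fun n => (hbij n).injOn
  obtain ⟨Δ, hΔ⟩ := HomHochschild.RegUnitalHomAssoc.exists_generator hc hbij h0
  exact ⟨HomHochschild.RegUnitalHomAssoc.isGerstenhaber hc hinj, Δ, hΔ,
    HomHochschild.RegUnitalHomAssoc.isBVGenerator hc hBc hbij h0 hΔ, fun Δ' hΔ' =>
    LinearMap.ext fun f => HomHochschild.RegUnitalHomAssoc.capH_injective hc hinj
      ((hΔ' f).trans (hΔ f).symm)⟩
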